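/- Let $K$ be a number field, $\mathrm{Gal}_K$ its absolute Galois group, $\ell$ a prime, and let $\rho:\mathrm{Gal}_K\to \mathrm{GL}_n(\overline{\mathbb Q}_\ell)$ be a continuous semisimple representation. Let $\mathbf G_\ell$ be its usual algebraic monodromy group, i.e. the Zariski closure of $\rho(\mathrm{Gal}_K)$ in $\mathrm{GL}_{n,\overline{\mathbb Q}_\ell}$. Let $\mathcal F$ be the set of subfields $F\subset\overline{\mathbb Q}_\ell$ containing $\mathbb Q_\ell$ such that $\det(\rho(g)-T\cdot \mathrm{Id})\in F[T]$ for all $g\in \mathrm{Gal}_K$. An $F$-valued determinant law of dimension $n$ on an $F$-algebra $R$ is a family of maps $D_B:B\otimes_F R\to B$, natural in the commutative $F$-algebra $B$, multiplicative (with $D_B(1)=1$) and homogeneous of degree $n$. Its kernel $\mathrm{Ker}(D)$ is the biggest two-sided ideal of $R$ such that $D$ factors through the quotient of $R$ by it. Let $D_\rho:\overline{\mathbb Q}_\ell[\mathrm{Gal}_K]\to M_n(\overline{\mathbb Q}_\ell)\xrightarrow{\det}\overline{\mathbb Q}_\ell$ be the determinant law of $\rho$. Then for every $F\in\mathcal F$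 there is a unique $F$-valued determinant law $D_{\rho/F}$ of dimension $n$ on $F[\mathrm{Gal}_K]$ through which $D_\rho$ factors (that is, $D_\rho$ and $D_{\rho/F}$ agree on $B[\mathrm{Gal}_K]$ for every commutative $\overline{\mathbb Q}_\ell$-algebra $B$). Put $S_F=F[\mathrm{Gal}_K]/\mathrm{Ker}(D_{\rho/F})$, let $\underline{S}_F^\times$ be the $F$-group functor $A\mapsto (S_F\otimes_F A)^\times$, let $\pi_F:\mathrm{Gal}_K\to \underline{S}_F^\times(F)$ be the natural map, and let $\mathbf G_{\rho,F}$ be the Zariski closure of $\pi_F(\mathrm{Gal}_K)$ in $\underline{S}_F^\times$. There are homomorphisms $j_F:\mathbf G_{\rho,F}\times_F\overline{\mathbb Q}_\ell\to\mathrm{GL}_{n,\overline{\mathbb Q}_\ell}$, one for each $F\in\mathcal F$, such that the following hold for every $F\in\mathcal F$. (i) $j_F$ is a faithful representation (a closed immersion), and $\rho$ is equivalent to the composition $\mathrm{Gal}_K\xrightarrow{\pi_F}\mathbf G_{\rho,F}(F)\to\mathbf G_{\rho,F}(\overline{\mathbb Q}_\ell)\xrightarrow{j_F}\mathrm{GL}_n(\overline{\mathbb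 Q}_\ell)$. (ii) $\mathbf G_{\rho,F}$ is an $F$-model of $\mathbf G_\ell$: there is an isomorphism $\mathbf G_{\rho,F}\times_F\overline{\mathbb Q}_\ell\simeq\mathbf G_\ell$ carrying $\pi_F(g)$ to $\rho(g)$ for all $g\in\mathrm{Gal}_K$. The $F$-group $\mathbf G_{\rho,F}$ is reductive (not necessarily connected). The isomorphism induces an isomorphism $\pi_0(\mathbf G_{\rho,F})\times_F\overline{\mathbb Q}_\ell\simeq\pi_0(\mathbf G_\ell)$ of component group schemes (universal étale quotients), and $\pi_0(\mathbf G_{\rho,F})(F)=\pi_0(\mathbf G_{\rho,F})(\overline{\mathbb Q}_\ell)$, so that $\pi_0(\mathbf G_{\rho,F})\simeq\pi_0(\mathbf G_\ell)$ also as finite groups. (iii) There are a finite extension $F'\supset F$ in $\mathcal F$ and a closed immersion of $F'$-groups $\mathbf G_{\rho,F'}\hookrightarrow\mathrm{GL}_{n,F'}$ whose composition with $\pi_{F'}$ is equivalent to $\rho$ over $\overline{\mathbb Q}_\ell$. (iv) For every field $F'$ with $F\subset F'\subset\overline{\mathbb Q}_\ell$ there is a unique isomorphism $\iota_{F'/F}:\mathbf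 G_{\rho,F}\times_F F'\to\mathbf G_{\rho,F'}$ with $\pi_{F'}=\iota_{F'/F}\circ\pi_F$, and it satisfies $j_F=j_{F'}\circ(\iota_{F'/F}\times_{F'}\overline{\mathbb Q}_\ell)$. (v) If $\rho(\mathrm{Gal}_K)\subset\mathrm{GL}_n(F)$, and $\mathbf G$ denotes the Zariski closure of $\rho(\mathrm{Gal}_K)$ in $\mathrm{GL}_{n,F}$, then there is an isomorphism $\mathbf G_{\rho,F}\simeq\mathbf G$ of $F$-groups carrying $\pi_F(g)$ to $\rho(g)$ for all $g\in\mathrm{Gal}_K$. -/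

import Mathlib

open scoped TensorProduct
open Matrix (GeneralLinearGroup)

noncomputable section

namespace Monodromy

universe u v w w' w''

/-! ## Group functors and group schemes over a field -/

/-- A group functor over a field `k`: a functor from commutative `k`-algebras to groups.
Group schemes over `k` are treated through their functors of points. -/
structure GroupFunctor (k : Type v) [Field k] where
  obj (A : Type v) [CommRing A] [Algebra k A] : Type w
  [group (A : Type v) [CommRing A] [Algebra k A] : Group (obj A)]
  map {A B : Type v} [CommRing A] [Algebra k A] [CommRing B] [Algebra k B] (φ : A →ₐ[k] B) :
    obj A →* obj B
  map_id (A : Type v) [CommRing A] [Algebra k A] (x : obj A) : map (AlgHom.id k A) x = x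
  map_comp {A B C : Type v} [CommRing A] [Algebra k A] [CommRing B] [Algebra k B]
    [CommRing C] [Algebra k C] (φ : A →ₐ[k] B) (ψ : B →ₐ[k] C) (x : obj A) :
    map (ψ.comp φ) x = map ψ (map φ x)

attribute [instance] GroupFunctor.group

/-- Homomorphisms of group functors: natural families of group homomorphisms. -/
@[ext]
structure Hom {k : Type v} [Field k] (G : GroupFunctor.{v, w} k) (H : GroupFunctor.{v, w'} k) where
  app (A : Type v) [CommRing A] [Algebra k A] : G.obj A →* H.obj A
  naturality {A B : Type v} [CommRing A] [Algebra k A] [CommRing B] [Algebra k B]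
    (φ : A →ₐ[k] B) (x : G.obj A) : app B (G.map φ x) = H.map φ (app A x)

/-- Isomorphisms of group functors. -/
@[ext]
structure Iso {k : Type v} [Field k] (G : GroupFunctor.{v, w} k) (H : GroupFunctor.{v, w'} k) where
  app (A : Type v) [CommRing A] [Algebra k A] : G.obj A ≃* H.obj A
  naturality {A B : Type v} [CommRing A] [Algebra k A] [CommRing B] [Algebra k B]
    (φ : A →ₐ[k] B) (x : G.obj A) : app B (G.map φ x) = H.map φ (app A x)

namespace Iso

variable {k : Type v} [Field k] {G : GroupFunctor.{v, w} k} {H : GroupFunctor.{v, w'} k}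

/-- The homomorphism underlying an isomorphism. -/
def toHom (e : Iso G H) : Hom G H where
  app A _ _ := (e.app A).toMonoidHom
  naturality φ x := e.naturality φ x

end Iso

namespace Hom

variable {k : Type v} [Field k] {G : GroupFunctor.{v, w} k} {H : GroupFunctor.{v, w'} k}
  {J : GroupFunctor.{v, w''} k}

/-- Composition of homomorphisms (`g` after `f`). -/
def comp (g : Hom H J) (f : Hom G H) : Hom G J where
  app A _ _ := (g.app A).comp (f.app A)
  naturality φ x := by simp [f.naturality, g.naturality]

/-- A homomorphism of group functors is a closed immersion if it identifies `G` with a closed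
subfunctor of `H`: it is injective on points, and for every point `x : Spec A → H` the locus in
`Spec A` where `x` lies in `G` is cut out by an ideal of `A`. -/
def IsClosedImmersion (f : Hom G H) : Prop :=
  (∀ (A : Type v) [CommRing A] [Algebra k A], Function.Injective (f.app A)) ∧
  ∀ (A : Type v) [CommRing A] [Algebra k A] (x : H.obj A), ∃ I : Ideal A,
    ∀ (B : Type v) [CommRing B] [Algebra k B] (φ : A →ₐ[k] B),
      H.map φ x ∈ (f.app B).range ↔ ∀ a ∈ I, φ a = 0

end Hom

namespace GroupFunctor

variable {k : Type v} [Field k]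

/-! ### Base change -/

/-- A homomorphism of `L`-algebras, regarded as a homomorphism of `k`-algebras
along `f : k → L`. -/
def restrictAlgHom {L : Type v} [Field L] (f : k →+* L) {A B : Type v} [CommRing A] [Algebra L A]
    [CommRing B] [Algebra L B] (φ : A →ₐ[L] B) :
    letI : Algebra k A := ((algebraMap L A).comp f).toAlgebra
    letI : Algebra k B := ((algebraMap L B).comp f).toAlgebra
    A →ₐ[k] B :=
  letI : Algebra k A := ((algebraMap L A).comp f).toAlgebra
  letI : Algebra k B := ((algebraMap L B).comp f).toAlgebra
  { φ.toRingHom with commutes' := fun r => φ.commutes (f r) }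

/-- The base change of a `k`-group functor along `f : k → L`: on an `L`-algebra `A` it takes the
value of `G` on `A` regarded as a `k`-algebra. -/
def baseChange (G : GroupFunctor.{v, w} k) {L : Type v} [Field L] (f : k →+* L) :
    GroupFunctor.{v, w} L where
  obj A _ _ := letI : Algebra k A := ((algebraMap L A).comp f).toAlgebra; G.obj A
  group A _ _ := letI : Algebra k A := ((algebraMap L A).comp f).toAlgebra; G.group A
  map {A B} _ _ _ _ φ :=
    letI : Algebra k A := ((algebraMap L A).comp f).toAlgebra
    letI : Algebra k B := ((algebraMap L B).comp f).toAlgebra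
    G.map (restrictAlgHom f φ)
  map_id A _ _ x :=
    letI : Algebra k A := ((algebraMap L A).comp f).toAlgebra
    G.map_id A x
  map_comp {A B C} _ _ _ _ _ _ φ ψ x :=
    letI : Algebra k A := ((algebraMap L A).comp f).toAlgebra
    letI : Algebra k B := ((algebraMap L B).comp f).toAlgebra
    letI : Algebra k C := ((algebraMap L C).comp f).toAlgebra
    G.map_comp (restrictAlgHom f φ) (restrictAlgHom f ψ) x

/-- The map `G(k) → G_L(L)`. -/
def extendPoint (G : GroupFunctor.{v, w} k) {L : Type v} [Field L] (f : k →+* L) :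
    G.obj k →* (G.baseChange f).obj L :=
  letI : Algebra k L := ((algebraMap L L).comp f).toAlgebra
  G.map (Algebra.ofId k L)

end GroupFunctor

/-- The base change of a homomorphism. -/
def Hom.baseChange {k : Type v} [Field k] {G : GroupFunctor.{v, w} k} {H : GroupFunctor.{v, w'} k}
    (h : Hom G H) {L : Type v} [Field L] (f : k →+* L) :
    Hom (G.baseChange f) (H.baseChange f) where
  app A _ _ := letI : Algebra k A := ((algebraMap L A).comp f).toAlgebra; h.app A
  naturality {A B} _ _ _ _ φ x :=
    letI : Algebra k A := ((algebraMap L A).comp f).toAlgebra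
    letI : Algebra k B := ((algebraMap L B).comp f).toAlgebra
    h.naturality (GroupFunctor.restrictAlgHom f φ) x

/-- The canonical identification of `G_M` with `(G_L)_M` for `k → L → M`; it is the identity
on points. -/
def GroupFunctor.baseChangeTrans {k L M : Type v} [Field k] [Field L] [Field M]
    (G : GroupFunctor.{v, w} k) (f : k →+* L) (g : L →+* M) (h : k →+* M) (e : h = g.comp f) :
    Iso (G.baseChange h) ((G.baseChange f).baseChange g) where
  app A _ _ := by subst e; exact MulEquiv.refl _
  naturality φ x := by subst e; rfl

namespace GroupFunctor

variable {k : Type v} [Field k]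

/-! ### Subgroups and Zariski closure -/

/-- A subgroup functor of `G`. -/
structure SubgroupFunctor (G : GroupFunctor.{v, w} k) where
  carrier (A : Type v) [CommRing A] [Algebra k A] : Subgroup (G.obj A)
  map_mem {A B : Type v} [CommRing A] [Algebra k A] [CommRing B] [Algebra k B] (φ : A →ₐ[k] B)
    {x : G.obj A} : x ∈ carrier A → G.map φ x ∈ carrier B

namespace SubgroupFunctor

variable {G : GroupFunctor.{v, w} k}

/-- A subgroup functor, as a group functor. -/
def toGroupFunctor (U : SubgroupFunctor G) : GroupFunctor.{v, w} k where
  obj A _ _ := U.carrier A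
  map {A B} _ _ _ _ φ := ((G.map φ).comp (U.carrier A).subtype).codRestrict (U.carrier B)
    fun x => U.map_mem φ x.2
  map_id A _ _ x := Subtype.ext (G.map_id A x.1)
  map_comp φ ψ x := Subtype.ext (G.map_comp φ ψ x.1)

/-- The inclusion of a subgroup functor. -/
def incl (U : SubgroupFunctor G) : Hom U.toGroupFunctor G where
  app A _ _ := (U.carrier A).subtype
  naturality _ _ := rfl

/-- Normal subgroup functors. -/
def IsNormal (U : SubgroupFunctor G) : Prop :=
  ∀ (A : Type v) [CommRing A] [Algebra k A], (U.carrier A).Normal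

/-- The trivial subgroup. -/
def IsTrivial (U : SubgroupFunctor G) : Prop :=
  ∀ (A : Type v) [CommRing A] [Algebra k A], U.carrier A = ⊥

end SubgroupFunctor

/-- Regular functions on `G`: morphisms of functors from `G` to the affine line. -/
structure RegularFunction (G : GroupFunctor.{v, w} k) where
  toFun (A : Type v) [CommRing A] [Algebra k A] : G.obj A → A
  naturality {A B : Type v} [CommRing A] [Algebra k A] [CommRing B] [Algebra k B]
    (φ : A →ₐ[k] B) (x : G.obj A) : toFun B (G.map φ x) = φ (toFun A x)

namespace RegularFunction

variable {G : GroupFunctor.{v, w} k}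

/-- `f` vanishes on a set of `k`-points. -/
def VanishesOn (f : RegularFunction G) (Γ : Subgroup (G.obj k)) : Prop :=
  ∀ γ ∈ Γ, f.toFun k γ = 0

/-- The regular function `x ↦ f (x⁻¹)`. -/
def inv (f : RegularFunction G) : RegularFunction G where
  toFun A _ _ x := f.toFun A x⁻¹
  naturality φ x := by rw [← map_inv, f.naturality]

/-- The regular function `x ↦ f (γ x)`, for a `k`-point `γ`. -/
def leftTranslate (f : RegularFunction G) (γ : G.obj k) : RegularFunction G where
  toFun A _ _ x := f.toFun A (G.map (Algebra.ofId k A) γ * x)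
  naturality {A B} _ _ _ _ φ x := by
    have h : φ.comp (Algebra.ofId k A) = Algebra.ofId k B := Subsingleton.elim _ _
    rw [← f.naturality, map_mul, ← G.map_comp, h]

/-- For a point `u ∈ G(A)` and a `k`-linear form `c` on `A`, the regular function
`x ↦ c (f (x u))`, with `c` extended linearly to `A ⊗ B → B` for `x ∈ G(B)`. -/
def rightSlice (f : RegularFunction G) {A : Type v} [CommRing A] [Algebra k A] (u : G.obj A)
    (c : A →ₗ[k] k) : RegularFunction G where
  toFun B _ _ x := TensorProduct.lid k B (c.rTensor B (f.toFun (A ⊗[k] B)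
    (G.map Algebra.TensorProduct.includeRight x * G.map Algebra.TensorProduct.includeLeft u)))
  naturality {B C} _ _ _ _ φ x := by
    have h1 : G.map (Algebra.TensorProduct.includeRight : C →ₐ[k] A ⊗[k] C) (G.map φ x)
        * G.map (Algebra.TensorProduct.includeLeft : A →ₐ[k] A ⊗[k] C) u
        = G.map (Algebra.TensorProduct.map (AlgHom.id k A) φ)
          (G.map Algebra.TensorProduct.includeRight x *
            G.map Algebra.TensorProduct.includeLeft u) := by
      rw [map_mul, ← G.map_comp, ← G.map_comp, ← G.map_comp]
      congr 2
      congr 1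
      ext a
      simp
    rw [h1, f.naturality]
    generalize f.toFun (A ⊗[k] B) _ = z
    induction z with
    | zero => simp
    | tmul a b => simp
    | add a b ha hb => simp only [map_add, ha, hb]

end RegularFunction

/-- An element of `A ⊗ B` that is killed by all linear forms on `A` is zero. -/
theorem eq_zero_of_forall_rTensor {A B : Type v} [CommRing A] [Algebra k A] [CommRing B]
    [Algebra k B] (z : A ⊗[k] B) (h : ∀ c : A →ₗ[k] k, TensorProduct.lid k B (c.rTensor B z) = 0) :
    z = 0 := by
  classical
  let b := Module.Basis.ofVectorSpace k A
  apply (TensorProduct.equivFinsuppOfBasisLeft (N := B) b).injective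
  rw [map_zero]
  ext i
  have key : ∀ w : A ⊗[k] B, TensorProduct.equivFinsuppOfBasisLeft b w i =
      TensorProduct.lid k B ((b.coord i).rTensor B w) := fun w => by
    induction w with
    | zero => simp
    | add x y hx hy => simp only [map_add, Finsupp.add_apply, hx, hy]
    | tmul x y => simp
  rw [key, h, Finsupp.zero_apply]

/-- The Zariski closure in `G` of a group `Γ` of `k`-points: the common zero locus of all regular
functions on `G` that vanish on `Γ`. -/
def zariskiClosure (G : GroupFunctor.{v, w} k) (Γ : Subgroup (G.obj k)) : SubgroupFunctor G where
  carrier A _ _ :=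
    { carrier := {x | ∀ f : RegularFunction G, f.VanishesOn Γ → f.toFun A x = 0}
      one_mem' := fun f hf => by
        have := f.naturality (Algebra.ofId k A) 1
        rw [map_one] at this
        rw [this, hf 1 Γ.one_mem, map_zero]
      inv_mem' := fun {x} hx f hf => hx f.inv fun γ hγ => hf _ (Γ.inv_mem hγ)
      mul_mem' := fun {x y} hx hy f hf => by
        have key : f.toFun (A ⊗[k] A) (G.map Algebra.TensorProduct.includeRight x *
            G.map Algebra.TensorProduct.includeLeft y) = 0 := by
          refine eq_zero_of_forall_rTensor _ fun c => hx (f.rightSlice y c) fun γ hγ => ?_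
          have h1 : G.map (Algebra.TensorProduct.includeRight : k →ₐ[k] A ⊗[k] k) γ
              * G.map (Algebra.TensorProduct.includeLeft : A →ₐ[k] A ⊗[k] k) y
              = G.map (Algebra.TensorProduct.includeLeft : A →ₐ[k] A ⊗[k] k)
                (G.map (Algebra.ofId k A) γ * y) := by
            have h : (Algebra.TensorProduct.includeLeft : A →ₐ[k] A ⊗[k] k).comp
                (Algebra.ofId k A) = Algebra.TensorProduct.includeRight := Subsingleton.elim _ _
            rw [map_mul, ← G.map_comp, h]
          have h2 : f.toFun A (G.map (Algebra.ofId k A) γ * y) = 0 :=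
            hy (f.leftTranslate γ) fun δ hδ => by
              have : (Algebra.ofId k k) = AlgHom.id k k := Subsingleton.elim _ _
              simp only [RegularFunction.leftTranslate, this, G.map_id]
              exact hf _ (Γ.mul_mem hγ hδ)
          simp only [RegularFunction.rightSlice]
          rw [h1, f.naturality, h2]
          simp
        have h3 := f.naturality (Algebra.TensorProduct.lmul' k (S := A))
          (G.map Algebra.TensorProduct.includeRight x *
            G.map Algebra.TensorProduct.includeLeft y)
        rw [key, map_zero, map_mul, ← G.map_comp, ← G.map_comp,
          Algebra.TensorProduct.lmul'_comp_includeRight,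
          Algebra.TensorProduct.lmul'_comp_includeLeft, G.map_id, G.map_id] at h3
        exact h3 }
  map_mem {_ _} _ _ _ _ φ _ hx f hf := by rw [f.naturality, hx f hf, map_zero]

/-- The Zariski closure of the image of a homomorphism `φ : Γ → G(k)`. -/
def imageClosure (G : GroupFunctor.{v, w} k) {Γ : Type u} [Group Γ] (φ : Γ →* G.obj k) :
    GroupFunctor.{v, w} k :=
  (G.zariskiClosure φ.range).toGroupFunctor

/-- The homomorphism from `Γ` to the `k`-points of the Zariski closure of its image. -/
def toImageClosure (G : GroupFunctor.{v, w} k) {Γ : Type u} [Group Γ] (φ : Γ →* G.obj k) :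
    Γ →* (G.imageClosure φ).obj k :=
  φ.codRestrict ((G.zariskiClosure φ.range).carrier k) fun g _ hf => hf _ ⟨g, rfl⟩

/-! ### Coordinate rings and geometric properties -/

/-- `(R, x)` is a coordinate ring of `G`: `G` is represented by the `k`-algebra `R`, with universal
point `x ∈ G(R)`. -/
def IsCoordinateRing (G : GroupFunctor.{v, w} k) (R : Type v) [CommRing R] [Algebra k R]
    (x : G.obj R) : Prop :=
  ∀ (A : Type v) [CommRing A] [Algebra k A], Function.Bijective fun φ : R →ₐ[k] A => G.map φ x

/-- `G` is an affine algebraic group scheme: represented by a finitely generated `k`-algebra. -/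
def IsAffineAlgebraic (G : GroupFunctor.{v, w} k) : Prop :=
  ∃ (R : Type v) (_ : CommRing R) (_ : Algebra k R) (x : G.obj R),
    G.IsCoordinateRing R x ∧ Algebra.FiniteType k R

/-- `G` is affine and geometrically reduced (for group schemes of finite type over a field, this is
the same as smoothness). -/
def IsGeometricallyReduced (G : GroupFunctor.{v, w} k) : Prop :=
  ∃ (R : Type v) (_ : CommRing R) (_ : Algebra k R) (x : G.obj R),
    G.IsCoordinateRing R x ∧ Algebra.IsGeometricallyReduced k R

/-- `G` is affine and connected. -/
def IsConnected (G : GroupFunctor.{v, w} k) : Prop :=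
  ∃ (R : Type v) (_ : CommRing R) (_ : Algebra k R) (x : G.obj R),
    G.IsCoordinateRing R x ∧ ConnectedSpace (PrimeSpectrum R)

/-- `G` is an étale (hence finite étale) group scheme over `k`. -/
def IsEtale (G : GroupFunctor.{v, w} k) : Prop :=
  ∃ (R : Type v) (_ : CommRing R) (_ : Algebra k R) (x : G.obj R),
    G.IsCoordinateRing R x ∧ Algebra.Etale k R

end GroupFunctor

/-- The general linear group scheme `GL_n` over `k`. -/
def GLn (k : Type v) [Field k] (n : ℕ) : GroupFunctor.{v, v} k where
  obj A _ _ := GeneralLinearGroup (Fin n) A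
  map φ := GeneralLinearGroup.map φ.toRingHom
  map_id _ _ _ _ := by ext; rfl
  map_comp _ _ _ := by ext; rfl

namespace GroupFunctor

variable {k : Type v} [Field k]

/-- Unipotence, for smooth affine algebraic groups over an algebraically closed field: every
`k`-point acts by a unipotent matrix in every finite-dimensional representation. -/
def IsUnipotent (U : GroupFunctor.{v, w} k) : Prop :=
  ∀ (m : ℕ) (r : Hom U (GLn k m)) (u : U.obj k),
    IsNilpotent ((r.app k u : GeneralLinearGroup (Fin m) k).val - 1)

/-- Reductive groups, not necessarily connected: smooth affine algebraic groups `G` over `k` such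
that over an algebraic closure of `k` every smooth connected unipotent closed normal subgroup
is trivial. -/
def IsReductive (G : GroupFunctor.{v, w} k) : Prop :=
  G.IsAffineAlgebraic ∧ G.IsGeometricallyReduced ∧
  ∀ U : SubgroupFunctor (G.baseChange (algebraMap k (AlgebraicClosure k))),
    U.incl.IsClosedImmersion → U.IsNormal → U.toGroupFunctor.IsGeometricallyReduced →
    U.toGroupFunctor.IsConnected → U.toGroupFunctor.IsUnipotent → U.IsTrivial

/-- `p : G → P` exhibits `P` as the component group scheme `π₀(G)`: the universal homomorphism
from `G` to an étale group scheme. -/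
def IsComponentGroup {G : GroupFunctor.{v, w} k} {P : GroupFunctor.{v, v} k} (p : Hom G P) : Prop :=
  P.IsEtale ∧ ∀ Q : GroupFunctor.{v, v} k, Q.IsEtale → ∀ f : Hom G Q, ∃! h : Hom P Q, h.comp p = f

end GroupFunctor

/-- The unit group `A ↦ (A ⊗ S)ˣ` of a `k`-algebra `S`. -/
def unitGroup (k : Type v) [Field k] (S : Type u) [Ring S] [Algebra k S] :
    GroupFunctor.{v, max u v} k where
  obj A _ _ := (A ⊗[k] S)ˣ
  map φ := Units.map (Algebra.TensorProduct.map φ (AlgHom.id k S)).toMonoidHom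
  map_id _ _ _ x := by ext; simp
  map_comp φ ψ x := by
    ext
    change Algebra.TensorProduct.map (ψ.comp φ) (AlgHom.id k S) x.val = _
    rw [← AlgHom.comp_id (AlgHom.id k S), Algebra.TensorProduct.map_comp]
    rfl

/-! ## Determinant laws -/

/-- A `k`-valued determinant law of dimension `d` on a `k`-algebra `R`: a multiplicative polynomial
law `R → k`, homogeneous of degree `d`. -/
structure DeterminantLaw (k : Type v) [CommRing k] (R : Type w) [Ring R] [Algebra k R] (d : ℕ)
    extends PolynomialLaw k R k where
  map_one (B : Type v) [CommSemiring B] [Algebra k B] : toFun' B 1 = 1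
  map_mul (B : Type v) [CommSemiring B] [Algebra k B] (x y : B ⊗[k] R) :
    toFun' B (x * y) = toFun' B x * toFun' B y
  map_smul (B : Type v) [CommSemiring B] [Algebra k B] (b : B) (x : B ⊗[k] R) :
    toFun' B (b • x) = b ^ d • toFun' B x

namespace DeterminantLaw

/-- The determinant law given by a natural family of multiplicative maps `B ⊗ R → B` that are
homogeneous of degree `d`, for commutative rings `B` over `k`. -/
def ofMaps {k : Type v} [CommRing k] {R : Type w} [Ring R] [Algebra k R] (d : ℕ)
    (D : ∀ (B : Type v) [CommRing B] [Algebra k B], B ⊗[k] R → B)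
    (natural : ∀ (B C : Type v) [CommRing B] [Algebra k B] [CommRing C] [Algebra k C]
      (φ : B →ₐ[k] C) (x : B ⊗[k] R), φ (D B x) = D C (φ.toLinearMap.rTensor R x))
    (one : ∀ (B : Type v) [CommRing B] [Algebra k B], D B 1 = 1)
    (mul : ∀ (B : Type v) [CommRing B] [Algebra k B] (x y : B ⊗[k] R),
      D B (x * y) = D B x * D B y)
    (smul : ∀ (B : Type v) [CommRing B] [Algebra k B] (b : B) (x : B ⊗[k] R),
      D B (b • x) = b ^ d * D B x) :
    DeterminantLaw k R d where
  toFun' B _ a x :=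
    letI : CommRing B := (algebraMap k B).commSemiringToCommRing
    @D B this a x ⊗ₜ[k] (1 : k)
  isCompat' {B _ a C _ c} φ := by
    let iB : CommRing B := (algebraMap k B).commSemiringToCommRing
    let iC : CommRing C := (algebraMap k C).commSemiringToCommRing
    ext x
    exact congrArg (fun z : C => z ⊗ₜ[k] (1 : k)) (@natural B C iB a iC c φ x)
  map_one B _ a := by
    let iB : CommRing B := (algebraMap k B).commSemiringToCommRing
    exact congrArg (fun z : B => z ⊗ₜ[k] (1 : k)) (@one B iB a)
  map_mul B _ a x y := by
    let iB : CommRing B := (algebraMap k B).commSemiringToCommRing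
    rw [Algebra.TensorProduct.tmul_mul_tmul, mul_one]
    exact congrArg (fun z : B => z ⊗ₜ[k] (1 : k)) (@mul B iB a x y)
  map_smul B _ a b x := by
    let iB : CommRing B := (algebraMap k B).commSemiringToCommRing
    rw [TensorProduct.smul_tmul']
    exact congrArg (fun z : B => z ⊗ₜ[k] (1 : k)) (@smul B iB a b x)

variable {k : Type v} [Field k] {R : Type w} [Ring R] [Algebra k R] {d : ℕ}

/-- The value of a determinant law on `B ⊗ R`, as an element of `B`. -/
def eval (D : DeterminantLaw k R d) (B : Type v) [CommRing B] [Algebra k B] (x : B ⊗[k] R) : B :=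
  Algebra.TensorProduct.rid k B B (D.toFun' B x)

theorem eval_ofMaps (D : ∀ (B : Type v) [CommRing B] [Algebra k B], B ⊗[k] R → B)
    (natural : ∀ (B C : Type v) [CommRing B] [Algebra k B] [CommRing C] [Algebra k C]
      (φ : B →ₐ[k] C) (x : B ⊗[k] R), φ (D B x) = D C (φ.toLinearMap.rTensor R x))
    (one mul smul) (B : Type v) [iB : CommRing B] [a : Algebra k B] (x : B ⊗[k] R) :
    (ofMaps d D natural one mul smul).eval B x = D B x := by
  let i : CommRing B := (algebraMap k B).commSemiringToCommRing
  have h := @natural B B i a iB a (AlgHom.id k B) x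
  have h0 : (AlgHom.id k B).toLinearMap.rTensor R x = x := by simp
  have h1 : (ofMaps d D natural one mul smul).eval B x = @D B i a x :=
    (Algebra.TensorProduct.rid_tmul (R := k) (S := B) (A := B) (1 : k) (@D B i a x)).trans
      (one_smul k _)
  exact h1.trans (h.trans (congrArg (@D B iB a) h0))

/-- `D` factors, as a polynomial law, through the quotient of `R` by the two-sided ideal `J`. -/
def FactorsThroughQuotient (D : DeterminantLaw k R d) (J : TwoSidedIdeal R) : Prop :=
  ∃ D' : PolynomialLaw k J.ringCon.Quotient k, ∀ (B : Type v) [CommRing B] [Algebra k B]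
    (x : B ⊗[k] R), D.toFun' B x = D'.toFun' B ((J.ringCon.mkₐ (α := k)).toLinearMap.lTensor B x)

/-- The kernel of `D`: the biggest two-sided ideal such that `D` factors through the quotient. -/
def ker (D : DeterminantLaw k R d) : TwoSidedIdeal R :=
  sSup {J | D.FactorsThroughQuotient J}

/-- The quotient algebra `S = R / ker D`. -/
abbrev quotientAlgebra (D : DeterminantLaw k R d) : Type w :=
  D.ker.ringCon.Quotient

end DeterminantLaw

/-! ## The determinant law of a representation and the algebraic monodromy group -/

variable {Γ : Type u} [Group Γ]

/-- The `B`-linear extension `B ⊗ L[Γ] → M_n(B)` of a representation `ρ : Γ → GL_n(L)`. -/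
def linearization {L : Type v} [Field L] {n : ℕ} (ρ : Γ →* GeneralLinearGroup (Fin n) L)
    (B : Type v) [CommRing B] [Algebra L B] :
    B ⊗[L] MonoidAlgebra L Γ →ₐ[B] Matrix (Fin n) (Fin n) B :=
  Algebra.TensorProduct.lift (Algebra.ofId B _)
    (MonoidAlgebra.lift L (Matrix (Fin n) (Fin n) B) Γ
      ((Units.coeHom _).comp ((GeneralLinearGroup.map (algebraMap L B)).comp ρ)))
    fun b _ => Algebra.commutes b _

theorem linearization_tmul_single {L : Type v} [Field L] {n : ℕ}
    (ρ : Γ →* GeneralLinearGroup (Fin n) L) (B : Type v) [CommRing B] [Algebra L B]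
    (b : B) (g : Γ) (c : L) :
    linearization ρ B (b ⊗ₜ MonoidAlgebra.single g c) =
      (b * algebraMap L B c) • (ρ g).val.map (algebraMap L B) := by
  have h : linearization ρ B (b ⊗ₜ MonoidAlgebra.single g c) =
      Algebra.ofId B (Matrix (Fin n) (Fin n) B) b *
        MonoidAlgebra.lift L (Matrix (Fin n) (Fin n) B) Γ
          ((Units.coeHom _).comp ((GeneralLinearGroup.map (algebraMap L B)).comp ρ))
          (MonoidAlgebra.single g c) := Algebra.TensorProduct.lift_tmul _ _ _ _ _
  rw [h, MonoidAlgebra.lift_single, Algebra.ofId_apply, ← Algebra.smul_def, mul_smul,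
    algebraMap_smul]
  rfl

/-- The determinant law `L[Γ] → M_n(L) → L` of a representation `ρ : Γ → GL_n(L)`. -/
def detLaw {L : Type v} [Field L] {n : ℕ} (ρ : Γ →* GeneralLinearGroup (Fin n) L) :
    DeterminantLaw L (MonoidAlgebra L Γ) n :=
  DeterminantLaw.ofMaps n (fun B _ _ x => (linearization ρ B x).det)
    (fun B C _ _ _ _ φ x => by
      have h : (linearization ρ C) (φ.toLinearMap.rTensor _ x) =
          φ.mapMatrix (linearization ρ B x) := by
        induction x with
        | zero => simp
        | add x y hx hy => simp only [map_add, hx, hy]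
        | tmul b p =>
          induction p using MonoidAlgebra.induction_linear with
          | zero => simp
          | add p q hp hq => simp only [TensorProduct.tmul_add, map_add, hp, hq]
          | single g c =>
            rw [LinearMap.rTensor_tmul, linearization_tmul_single, linearization_tmul_single]
            ext i j
            simp
      rw [h]
      exact AlgHom.map_det φ _)
    (fun B _ _ => by simp)
    (fun B _ _ x y => by simp)
    (fun B _ _ b x => by simp)

/-- The value of a determinant law on `k[Γ]` at the element `∑ y_g g` of `B[Γ] = B ⊗ k[Γ]`. -/
def DeterminantLaw.evalGroupAlgebra {k : Type v} [Field k] {d : ℕ}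
    (D : DeterminantLaw k (MonoidAlgebra k Γ) d) (B : Type v) [CommRing B] [Algebra k B]
    (y : Γ →₀ B) : B :=
  D.eval B (y.sum fun g b => b ⊗ₜ[k] MonoidAlgebra.single g (1 : k))

theorem detLaw_eval {L : Type v} [Field L] {n : ℕ} (ρ : Γ →* GeneralLinearGroup (Fin n) L)
    (B : Type v) [CommRing B] [Algebra L B] (x : B ⊗[L] MonoidAlgebra L Γ) :
    (detLaw ρ).eval B x = (linearization ρ B x).det :=
  DeterminantLaw.eval_ofMaps ..

/-- The `L`-valued determinant law `D` on `L[Γ]` factors through the `k`-valued determinant law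
`D'` on `k[Γ]`, along `f : k → L`: the two laws agree on `B[Γ]` for every `L`-algebra `B`. -/
def DeterminantLaw.FactorsThrough {k L : Type v} [Field k] [Field L] (f : k →+* L) {d : ℕ}
    (D : DeterminantLaw L (MonoidAlgebra L Γ) d) (D' : DeterminantLaw k (MonoidAlgebra k Γ) d) :
    Prop :=
  ∀ (B : Type v) [CommRing B] [Algebra L B] (y : Γ →₀ B),
    letI : Algebra k B := ((algebraMap L B).comp f).toAlgebra
    D.evalGroupAlgebra B y = D'.evalGroupAlgebra B y

/-- The homomorphism `Γ → S_D^×(k)` to the `k`-points of the unit group of the quotient algebra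
`S_D = k[Γ] / ker D`. -/
def toUnitGroup {k : Type v} [Field k] {d : ℕ} (D : DeterminantLaw k (MonoidAlgebra k Γ) d) :
    Γ →* (unitGroup k D.quotientAlgebra).obj k :=
  (Units.map (Algebra.TensorProduct.includeRight :
      D.quotientAlgebra →ₐ[k] k ⊗[k] D.quotientAlgebra).toMonoidHom).comp
    ((D.ker.ringCon.mk'.toMonoidHom.comp (MonoidAlgebra.of k Γ)).toHomUnits)

/-- The algebraic monodromy group over `k` of a `k`-valued determinant law `D` on `k[Γ]`: the
Zariski closure of the image of `Γ` in the unit group of `S_D = k[Γ] / ker D`. -/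
def monodromyGroup {k : Type v} [Field k] {d : ℕ} (D : DeterminantLaw k (MonoidAlgebra k Γ) d) :
    GroupFunctor.{v, max u v} k :=
  (unitGroup k D.quotientAlgebra).imageClosure (toUnitGroup D)

/-- The homomorphism `π : Γ → G(k)` to the algebraic monodromy group. -/
def toMonodromyGroup {k : Type v} [Field k] {d : ℕ}
    (D : DeterminantLaw k (MonoidAlgebra k Γ) d) : Γ →* (monodromyGroup D).obj k :=
  (unitGroup k D.quotientAlgebra).toImageClosure (toUnitGroup D)

/-- The usual algebraic monodromy group of `ρ : Γ → GL_n(k)`: the Zariski closure of its image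
in `GL_n` over `k`. -/
def linearMonodromyGroup {k : Type v} [Field k] {n : ℕ}
    (ρ : Γ →* GeneralLinearGroup (Fin n) k) : GroupFunctor.{v, v} k :=
  (GLn k n).imageClosure ρ

/-- The homomorphism from `Γ` to the `k`-points of the usual algebraic monodromy group. -/
def toLinearMonodromyGroup {k : Type v} [Field k] {n : ℕ}
    (ρ : Γ →* GeneralLinearGroup (Fin n) k) : Γ →* (linearMonodromyGroup ρ).obj k :=
  (GLn k n).toImageClosure ρ

/-- `ρ`, as a representation on the column space. -/
def toRepresentation {k : Type v} [Field k] {n : ℕ} (ρ : Γ →* GeneralLinearGroup (Fin n) k) :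
    Representation k Γ (Fin n → k) :=
  (Matrix.toLinAlgEquiv' : Matrix (Fin n) (Fin n) k ≃ₐ[k] _).toAlgHom.toMonoidHom.comp
    ((Units.coeHom _).comp ρ)

/-- The polynomials `det (ρ g - T)`, for `g ∈ Γ`, have coefficients in the image of `f : k → L`. -/
def HasCharpolyOver {k L : Type v} [Field k] [Field L] (f : k →+* L) {n : ℕ}
    (ρ : Γ →* GeneralLinearGroup (Fin n) L) : Prop :=
  ∀ g, (ρ g).val.charpoly ∈ Polynomial.lifts f

end Monodromy

end

open Monodromy

open scoped TensorProduct
open Matrix (GeneralLinearGroup)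

noncomputable section

namespace Monodromy

universe u v w w' w''

/-! ## Traces, determinants and semisimple matrix algebras -/

section Traces

open Polynomial

variable {n : ℕ}

/-! Everything rests on one fact: in characteristic zero the trace form on the algebra A spanned
over L by a semisimple ρ(Γ) is nondegenerate (`eq_zero_of_trace_mul_eq_zero`). If x lies in the
radical of the form, every yx with y in A is nilpotent, because the traces of its powers vanish;
this is incompatible with x acting nontrivially on a minimal stable subspace.

Let the characteristic polynomials of ρ have coefficients in a subfield k. Choose a basis of A among
the ρ(γ). Its Gram matrix has entries in k and is invertible, so every ρ(γ) has coordinates in k: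
the k-span of ρ(Γ) is a k-form of A, although it need not embed into M_n(k). By Newton's identities
the determinant is k-valued on this form, hence a polynomial over k in the coordinates
(`exists_frame`), and that polynomial is the descended law. The kernel of the law is the kernel of
k[Γ] → M_n(L) (`Frame.mem_ker_law_iff`): if the law factors modulo J and y is in J, then det(1 +
Xρ(y)) = 1, so ρ(y) has trace zero, and nondegeneracy finishes. Thus S_k is the k-form, and S_k ⊗ L
is A inside M_n(L).

On unit groups this gives a closed embedding of the base change of S_k^× into GL_n. A polynomial
over L that vanishes at k-rational points is an L-combination of polynomials over k that vanish
there, so density of Γ survives extension of the field (`HasDenseImage.baseChange`), and the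
monodromy group over k becomes the Zariski closure of ρ(Γ) over L. Homomorphisms are determined by
their values on the dense subgroup Γ, which gives every uniqueness and compatibility statement.

Reductivity is a variant of the trace argument: a normal unipotent subgroup lies in A and all its
elements have trace n, which forces it to act trivially (`eq_one_of_unipotent_of_normalized`). For
the component group, only finitely many idempotent functions on Γ come from regular functions; Γ
permutes them through a finite quotient P, and the constant group on P is the universal étale
quotient. Over L no new idempotents appear, because an idempotent takes the values 0 and 1 on Γ. -/

theorem derivative_det {R : Type*} [CommRing R] (A : Matrix (Fin n) (Fin n) R[X]) :
    derivative A.det = (A.adjugate * A.map derivative).trace := by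
  -- Cramer's rule: each diagonal entry of the product is the determinant with one column
  -- differentiated, which is what the product rule yields.
  have h : ∀ j, ∑ i, A.adjugate j i * derivative (A i j) =
      (A.updateCol j fun i => derivative (A i j)).det := fun j => by
    rw [← Matrix.cramer_apply, Matrix.cramer_eq_adjugate_mulVec]
    rfl
  simp only [Matrix.trace, Matrix.diag, Matrix.mul_apply, Matrix.map_apply, h]
  simp only [Matrix.det_apply, Polynomial.derivative_sum, Polynomial.derivative_smul]
  rw [Finset.sum_comm]
  refine Finset.sum_congr rfl fun σ _ => ?_
  rw [← Finset.smul_sum, Polynomial.derivative_prod_finset]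
  congr 1
  refine Finset.sum_congr rfl fun j _ => ?_
  rw [← Finset.mul_prod_erase Finset.univ _ (Finset.mem_univ j), mul_comm]
  simp only [Matrix.updateCol_self]
  congr 1
  refine Finset.prod_congr rfl fun i hi => ?_
  rw [Matrix.updateCol_ne (Finset.ne_of_mem_erase hi)]

/-- Newton's identities for the reversed characteristic polynomial of a matrix. -/
theorem coeff_charpolyRev_succ {R : Type*} [CommRing R] (M : Matrix (Fin n) (Fin n) R) (i : ℕ) :
    M.charpolyRev.coeff (i + 1) * (i + 1) =
      -∑ j ∈ Finset.range (i + 1), M.charpolyRev.coeff j * (M ^ (i - j + 1)).trace := by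
  set B : Matrix (Fin n) (Fin n) R[X] := 1 - (X : R[X]) • M.map C with hB
  set N : ℕ → Matrix (Fin n) (Fin n) R := fun i => B.adjugate.map fun p => p.coeff i with hN
  have h0 : ∀ a b, (B.adjugate * B) a b = B.adjugate a b - X * (B.adjugate * M.map C) a b :=
    fun a b => by
      rw [hB, mul_sub, mul_one, Matrix.mul_smul, Matrix.sub_apply, Matrix.smul_apply, smul_eq_mul]
  have hc : ∀ i a b, ((B.adjugate * M.map C) a b).coeff i = (N i * M) a b := fun i a b => by
    simp [Matrix.mul_apply, hN]
  have h1 : ∀ a b, (B.adjugate * B) a b = Polynomial.C ((1 : Matrix (Fin n) (Fin n) R) a b) *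
      M.charpolyRev := fun a b => by
    rw [Matrix.adjugate_mul, Matrix.smul_apply, Matrix.charpolyRev, smul_eq_mul, mul_comm]
    congr 1
    by_cases hab : a = b <;> simp [Matrix.one_apply, hab]
  -- With B = 1 - XM, comparing coefficients in adj(B) B = det(B) expresses the coefficients `N i`
  -- of the adjugate recursively through those of det(B).
  have hN0 : N 0 = M.charpolyRev.coeff 0 • 1 := by
    ext a b
    have := congrArg (fun p => p.coeff 0) ((h0 a b).symm.trans (h1 a b))
    simp only [coeff_sub, coeff_X_mul_zero, sub_zero, coeff_C_mul] at this
    simp [hN, this, mul_comm]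
  have hNs : ∀ i, N (i + 1) = N i * M + M.charpolyRev.coeff (i + 1) • 1 := fun i => by
    ext a b
    have := congrArg (fun p => p.coeff (i + 1)) ((h0 a b).symm.trans (h1 a b))
    simp only [coeff_sub, coeff_X_mul, hc, coeff_C_mul, sub_eq_iff_eq_add] at this
    simp only [hN, Matrix.map_apply, this, Matrix.add_apply, Matrix.smul_apply, smul_eq_mul]
    ring
  have hNe : ∀ i, N i = ∑ j ∈ Finset.range (i + 1), M.charpolyRev.coeff j • M ^ (i - j) :=
      fun i => by
    induction i with
    | zero => simp [hN0]
    | succ i ih =>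
      rw [hNs, ih, Finset.sum_range_succ _ (i + 1), Finset.sum_mul]
      congr 1
      · refine Finset.sum_congr rfl fun j hj => ?_
        rw [smul_mul_assoc, ← pow_succ, Nat.succ_sub (Nat.lt_succ_iff.mp (Finset.mem_range.mp hj))]
      · simp
  -- Jacobi's formula applied to B, whose derivative is -M; reading off the coefficient of X^i gives
  -- the identity.
  have hd : derivative M.charpolyRev = -(B.adjugate * M.map C).trace := by
    rw [Matrix.charpolyRev, derivative_det, ← hB]
    have : B.map derivative = -(M.map C) := by
      ext1 a b
      by_cases hab : a = b <;> simp [hB, hab]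
    rw [this, Matrix.mul_neg, Matrix.trace_neg]
  have := congrArg (fun p => p.coeff i) hd
  simp only [coeff_derivative, coeff_neg, Matrix.trace, Matrix.diag, finsetSum_coeff, hc] at this
  rw [this]
  change -(N i * M).trace = _
  rw [hNe, Finset.sum_mul, Matrix.trace_sum]
  simp only [smul_mul_assoc, ← pow_succ, Matrix.trace_smul, smul_eq_mul]

variable {L : Type*} [Field L]

theorem charpoly_coeff_eq {R : Type*} [CommRing R] [Nontrivial R] (M : Matrix (Fin n) (Fin n) R)
    {i : ℕ} (hi : i ≤ n) : M.charpoly.coeff i = M.charpolyRev.coeff (n - i) := by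
  have h : M.charpoly.natDegree = n := by simp
  rw [← Matrix.reverse_charpoly, coeff_reverse, h, revAt_le (Nat.sub_le n i), Nat.sub_sub_self hi]

/-- In characteristic zero, the determinant of a matrix lies in every subfield that contains the
traces of its powers. -/
theorem det_mem_of_trace_pow_mem [CharZero L] (K : Subfield L) (M : Matrix (Fin n) (Fin n) L)
    (h : ∀ j, (M ^ (j + 1)).trace ∈ K) : M.det ∈ K := by
  have hc : ∀ i, M.charpolyRev.coeff i ∈ K := fun i => by
    induction i using Nat.strong_induction_on with
    | _ i ih =>
      cases i with
      | zero => rw [coeff_zero_eq_eval_zero, Matrix.eval_charpolyRev]; exact K.one_mem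
      | succ i =>
        have h0 : (i + 1 : L) ≠ 0 := by exact_mod_cast Nat.succ_ne_zero i
        rw [← mul_div_cancel_right₀ (M.charpolyRev.coeff (i + 1)) h0, coeff_charpolyRev_succ]
        refine K.div_mem (K.neg_mem (K.sum_mem fun j hj => K.mul_mem (ih j ?_) (h _))) ?_
        · exact Finset.mem_range.mp hj
        · exact_mod_cast natCast_mem K (i + 1)
  rw [Matrix.det_eq_sign_charpoly_coeff, charpoly_coeff_eq M (Nat.zero_le _)]
  exact K.mul_mem (K.pow_mem (K.neg_mem K.one_mem) _) (hc _)

/-- Newton's identities kill all nonconstant coefficients of the reversed characteristic polynomial,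
since i + 1 is invertible. The characteristic polynomial is then X ^ n, and Cayley–Hamilton applies.
-/
theorem isNilpotent_of_trace_pow_eq_zero [CharZero L] (M : Matrix (Fin n) (Fin n) L)
    (h : ∀ j, (M ^ (j + 1)).trace = 0) : IsNilpotent M := by
  have hc : ∀ i, M.charpolyRev.coeff (i + 1) = 0 := fun i => by
    have h0 : (i + 1 : L) ≠ 0 := by exact_mod_cast Nat.succ_ne_zero i
    have := coeff_charpolyRev_succ M i
    rw [Finset.sum_eq_zero fun j _ => by rw [h, mul_zero], neg_zero] at this
    exact (mul_eq_zero.mp this).resolve_right h0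
  have hX : M.charpoly = X ^ n := by
    ext i
    rw [coeff_X_pow]
    split_ifs with hi
    · rw [charpoly_coeff_eq M hi.le, hi, Nat.sub_self, coeff_zero_eq_eval_zero,
        Matrix.eval_charpolyRev]
    · rcases lt_or_gt_of_ne hi with hi | hi
      · rw [charpoly_coeff_eq M hi.le]
        obtain ⟨m, hm⟩ := Nat.exists_eq_succ_of_ne_zero (Nat.sub_ne_zero_of_lt hi)
        rw [hm, hc]
      · exact coeff_eq_zero_of_natDegree_lt (by simpa using hi)
  refine ⟨n, ?_⟩
  have := M.aeval_self_charpoly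
  rwa [hX, map_pow, aeval_X] at this

/-- A subspace of `L ^ n` stable under a set of matrices. -/
def IsStable (A : Set (Matrix (Fin n) (Fin n) L)) (W : Submodule L (Fin n → L)) : Prop :=
  ∀ a ∈ A, ∀ w ∈ W, a.mulVec w ∈ W

/-- An element of a matrix algebra that is orthogonal to the algebra for the trace form kills
every minimal stable subspace. -/
theorem mulVec_eq_zero_of_trace_mul_eq_zero [CharZero L]
    (A : Subalgebra L (Matrix (Fin n) (Fin n) L)) {x : Matrix (Fin n) (Fin n) L} (hx : x ∈ A)
    (h : ∀ y ∈ A, (x * y).trace = 0) {W : Submodule L (Fin n → L)} (hW : IsStable A W)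
    (hmin : ∀ W' : Submodule L (Fin n → L), IsStable A W' → W' ≤ W → W' ≠ ⊥ → W' = W)
    {w : Fin n → L} (hw : w ∈ W) : x.mulVec w = 0 := by
  by_contra h0
  -- The subspace A x w is stable, lies in W and contains x w, which is nonzero; minimality gives A
  -- x w = W, so y x w = w for some y in A.
  let W' : Submodule L (Fin n → L) :=
    { carrier := {z | ∃ y ∈ A, y.mulVec (x.mulVec w) = z}
      add_mem' := by
        rintro _ _ ⟨y, hy, rfl⟩ ⟨z, hz, rfl⟩
        exact ⟨y + z, A.add_mem hy hz, Matrix.add_mulVec _ _ _⟩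
      zero_mem' := ⟨0, A.zero_mem, Matrix.zero_mulVec _⟩
      smul_mem' := by
        rintro c _ ⟨y, hy, rfl⟩
        exact ⟨c • y, A.smul_mem hy c, Matrix.smul_mulVec _ _ _⟩ }
  have hW' : W' = W := by
    refine hmin W' ?_ ?_ ?_
    · rintro a ha _ ⟨y, hy, rfl⟩
      exact ⟨a * y, A.mul_mem ha hy, (Matrix.mulVec_mulVec _ _ _).symm⟩
    · rintro _ ⟨y, hy, rfl⟩
      exact hW y hy _ (hW x hx w hw)
    · refine fun hb => h0 ?_
      rw [← Submodule.mem_bot L, ← hb]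
      exact ⟨1, A.one_mem, Matrix.one_mulVec _⟩
  obtain ⟨y, hy, hyw⟩ : w ∈ W' := hW' ▸ hw
  -- By cyclicity of the trace, the trace of a power of y x is the trace of x times an element of A.
  -- A nilpotent matrix cannot fix the nonzero vector w.
  have hnil : IsNilpotent (y * x) := by
    refine isNilpotent_of_trace_pow_eq_zero _ fun j => ?_
    rw [pow_succ', mul_assoc, Matrix.trace_mul_comm, mul_assoc]
    exact h _ (A.mul_mem (A.pow_mem (A.mul_mem hy hx) j) hy)
  obtain ⟨m, hm⟩ := hnil
  have hfix : ∀ m, ((y * x) ^ m).mulVec w = w := fun m => by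
    induction m with
    | zero => simp
    | succ m ih => rw [pow_succ, ← Matrix.mulVec_mulVec, ← Matrix.mulVec_mulVec, hyw, ih]
  have := hfix m
  rw [hm, Matrix.zero_mulVec] at this
  exact h0 (by rw [← this, Matrix.mulVec_zero])

theorem exists_minimal_stable (A : Set (Matrix (Fin n) (Fin n) L))
    {W : Submodule L (Fin n → L)} (hW : IsStable A W) (h0 : W ≠ ⊥) :
    ∃ W₀ ≤ W, IsStable A W₀ ∧ W₀ ≠ ⊥ ∧
      ∀ W' : Submodule L (Fin n → L), IsStable A W' → W' ≤ W₀ → W' ≠ ⊥ → W' = W₀ := by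
  obtain ⟨W₀, ⟨h1, h2, h3⟩, h4⟩ := WellFounded.has_min
    (wellFounded_lt (α := Submodule L (Fin n → L)))
    {W' | W' ≤ W ∧ IsStable A W' ∧ W' ≠ ⊥} ⟨W, le_rfl, hW, h0⟩
  exact ⟨W₀, h1, h2, h3, fun W' h5 h6 h7 =>
    h6.eq_or_lt.resolve_right (h4 W' ⟨h6.trans h1, h5, h7⟩)⟩

/-- Every stable subspace has a stable complement. -/
def HasStableComplements (A : Set (Matrix (Fin n) (Fin n) L)) : Prop :=
  ∀ W : Submodule L (Fin n → L), IsStable A W → ∃ W', IsStable A W' ∧ IsCompl W W'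

/-- The trace form of a semisimple matrix algebra in characteristic zero is nondegenerate. -/
theorem eq_zero_of_trace_mul_eq_zero [CharZero L] (A : Subalgebra L (Matrix (Fin n) (Fin n) L))
    (hA : HasStableComplements (A : Set (Matrix (Fin n) (Fin n) L)))
    {x : Matrix (Fin n) (Fin n) L} (hx : x ∈ A)
    (h : ∀ y ∈ A, (x * y).trace = 0) : x = 0 := by
  -- The common kernel of the radical of the trace form. It contains every minimal stable subspace,
  -- so a stable complement has none and must be zero.
  let K : Submodule L (Fin n → L) :=
    { carrier := {v | ∀ z ∈ A, (∀ y ∈ A, (z * y).trace = 0) → z.mulVec v = 0}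
      add_mem' := fun {a b} ha hb z hz hy => by
        rw [Matrix.mulVec_add, ha z hz hy, hb z hz hy, add_zero]
      zero_mem' := fun z _ _ => Matrix.mulVec_zero _
      smul_mem' := fun c a ha z hz hy => by rw [Matrix.mulVec_smul, ha z hz hy, smul_zero] }
  have hK : IsStable (A : Set (Matrix (Fin n) (Fin n) L)) K := fun a ha v hv z hz hy => by
    rw [Matrix.mulVec_mulVec]
    exact hv _ (A.mul_mem hz ha) fun y hy' => by rw [mul_assoc]; exact hy _ (A.mul_mem ha hy')
  obtain ⟨W, hW, hc⟩ := hA K hK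
  have hW0 : W = ⊥ := by
    by_contra h0
    obtain ⟨W₀, h1, h2, h3, h4⟩ := exists_minimal_stable _ hW h0
    refine h3 (le_bot_iff.mp ?_)
    rw [← hc.inf_eq_bot]
    exact le_inf (fun w hw z hz hy => mulVec_eq_zero_of_trace_mul_eq_zero A hz hy h2 h4 hw) h1
  have hK' : K = ⊤ := by simpa [hW0] using hc.sup_eq_top
  refine Matrix.ext_of_mulVec_single fun i => ?_
  rw [Matrix.zero_mulVec]
  have : Pi.single i 1 ∈ K := hK' ▸ Submodule.mem_top
  exact this x hx h

/-- A group of unipotent matrices normalized by a semisimple group is trivial, if it is contained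
in the algebra generated by that group. -/
theorem eq_one_of_unipotent_of_normalized [CharZero L] {Γ : Type*} [Group Γ]
    (ρ : Γ →* GeneralLinearGroup (Fin n) L) (A : Subalgebra L (Matrix (Fin n) (Fin n) L))
    (hA : HasStableComplements (A : Set (Matrix (Fin n) (Fin n) L)))
    (hρ : A = Algebra.adjoin L (Set.range fun g => (ρ g).val))
    (N : Subgroup (GeneralLinearGroup (Fin n) L)) (hNA : ∀ u ∈ N, u.val ∈ A)
    (hN : ∀ g, ∀ u ∈ N, (ρ g)⁻¹ * u * ρ g ∈ N) (hu : ∀ u ∈ N, IsNilpotent (u.val - 1)) :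
    N = ⊥ := by
  -- The vectors fixed by N; they form a stable subspace because ρ normalizes N.
  let K : Submodule L (Fin n → L) :=
    { carrier := {v | ∀ u ∈ N, u.val.mulVec v = v}
      add_mem' := fun {a b} ha hb u hu => by rw [Matrix.mulVec_add, ha u hu, hb u hu]
      zero_mem' := fun u _ => Matrix.mulVec_zero _
      smul_mem' := fun c a ha u hu => by rw [Matrix.mulVec_smul, ha u hu] }
  have hK : IsStable (A : Set (Matrix (Fin n) (Fin n) L)) K := fun a ha v hv => by
    replace ha : a ∈ Algebra.adjoin L (Set.range fun g => (ρ g).val) := hρ ▸ ha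
    induction ha using Algebra.adjoin_induction generalizing v with
    | mem x hx =>
      obtain ⟨g, rfl⟩ := hx
      intro u hu
      have h1 : u.val * (ρ g).val = (ρ g).val * ((ρ g)⁻¹ * u * ρ g).val := by
        rw [← Units.val_mul, ← Units.val_mul]
        congr 1
        group
      change u.val.mulVec ((ρ g).val.mulVec v) = _
      rw [Matrix.mulVec_mulVec, h1, ← Matrix.mulVec_mulVec, hv _ (hN g u hu)]
    | algebraMap r =>
      rw [Algebra.algebraMap_eq_smul_one, Matrix.smul_mulVec, Matrix.one_mulVec]
      exact K.smul_mem r hv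
    | add x y _ _ hx hy =>
      rw [Matrix.add_mulVec]
      exact K.add_mem (hx v hv) (hy v hv)
    | mul x y _ _ hx hy =>
      rw [← Matrix.mulVec_mulVec]
      exact hx _ (hy v hv)
  obtain ⟨W, hW, hc⟩ := hA K hK
  -- The lemma on minimal stable subspaces is applied to the algebra B generated by N, not to A. B
  -- is the linear span of N and every element of N has trace n, so u - 1 is orthogonal to B for the
  -- trace form. A minimal B-stable subspace of W would consist of fixed vectors.
  let B : Subalgebra L (Matrix (Fin n) (Fin n) L) :=
    Algebra.adjoin L (N.toSubmonoid.map (Units.coeHom (Matrix (Fin n) (Fin n) L)) :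
      Set (Matrix (Fin n) (Fin n) L))
  have hBA : B ≤ A := Algebra.adjoin_le (by rintro _ ⟨u, hu, rfl⟩; exact hNA u hu)
  have hNB : ∀ u ∈ N, u.val ∈ B := fun u hu => Algebra.subset_adjoin ⟨u, hu, rfl⟩
  have htr : ∀ u ∈ N, ∀ y ∈ B, ((u.val - 1) * y).trace = 0 := fun u hu' y hy => by
    have hy' : y ∈ Submodule.span L (N.toSubmonoid.map (Units.coeHom (Matrix (Fin n) (Fin n) L)) :
        Set (Matrix (Fin n) (Fin n) L)) := by
      rw [← Submonoid.closure_eq (N.toSubmonoid.map _), ← Algebra.adjoin_eq_span]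
      exact hy
    clear hy
    have htr1 : ∀ u ∈ N, u.val.trace = n := fun u hu' => by
      have := (Matrix.isNilpotent_trace_of_isNilpotent (hu u hu')).eq_zero
      rw [Matrix.trace_sub, Matrix.trace_one, sub_eq_zero] at this
      simpa using this
    induction hy' using Submodule.span_induction with
    | mem x hx =>
      obtain ⟨v, hv, rfl⟩ := hx
      rw [sub_mul, one_mul, Matrix.trace_sub, Units.coeHom_apply, ← Units.val_mul,
        htr1 _ (N.mul_mem hu' hv), htr1 v hv, sub_self]
    | zero => simp
    | add x y _ _ h1 h2 => rw [mul_add, Matrix.trace_add, h1, h2, add_zero]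
    | smul c x _ h1 => rw [mul_smul_comm, Matrix.trace_smul, h1, smul_zero]
  have hW0 : W = ⊥ := by
    by_contra h0
    obtain ⟨W₀, h1, h2, h3, h4⟩ := exists_minimal_stable (B : Set (Matrix (Fin n) (Fin n) L))
      (fun b hb => hW b (hBA hb)) h0
    refine h3 (le_bot_iff.mp ?_)
    rw [← hc.inf_eq_bot]
    refine le_inf (fun w hw u hu' => ?_) h1
    have := mulVec_eq_zero_of_trace_mul_eq_zero B (B.sub_mem (hNB u hu') B.one_mem) (htr u hu')
      h2 h4 hw
    rwa [Matrix.sub_mulVec, Matrix.one_mulVec, sub_eq_zero] at this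
  have hK' : K = ⊤ := by simpa [hW0] using hc.sup_eq_top
  rw [eq_bot_iff]
  refine fun u hu' => Units.ext (Matrix.ext_of_mulVec_single fun i => ?_)
  have : Pi.single i 1 ∈ K := hK' ▸ Submodule.mem_top
  rw [Units.val_one, Matrix.one_mulVec]
  exact this u hu'

end Traces

/-! ## The algebra spanned by a representation -/

section SpanAlgebra

variable {Γ : Type u} [Group Γ] {n : ℕ} {L : Type*} [Field L]

/-- The matrix algebra generated by a representation. -/
def spanAlgebra (ρ : Γ →* GeneralLinearGroup (Fin n) L) :
    Subalgebra L (Matrix (Fin n) (Fin n) L) :=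
  Algebra.adjoin L (Set.range fun g => (ρ g).val)

/-- The image of a group is already closed under products. The scalars may be smaller than L, as is
needed for traces with values in k. -/
theorem adjoin_range_eq_span (k : Type*) [Field k] [Algebra k L]
    (ρ : Γ →* GeneralLinearGroup (Fin n) L) :
    Subalgebra.toSubmodule (Algebra.adjoin k (Set.range fun g => (ρ g).val)) =
      Submodule.span k (Set.range fun g => (ρ g).val) := by
  rw [Algebra.adjoin_eq_span]
  congr 1
  exact congrArg _ (Submonoid.closure_eq (MonoidHom.mrange ((Units.coeHom _).comp ρ)))

theorem mem_spanAlgebra_iff (ρ : Γ →* GeneralLinearGroup (Fin n) L)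
    {x : Matrix (Fin n) (Fin n) L} :
    x ∈ spanAlgebra ρ ↔ x ∈ Submodule.span L (Set.range fun g => (ρ g).val) := by
  rw [← adjoin_range_eq_span]
  rfl

theorem isStable_spanAlgebra_iff (ρ : Γ →* GeneralLinearGroup (Fin n) L)
    (W : Submodule L (Fin n → L)) :
    IsStable (spanAlgebra ρ : Set (Matrix (Fin n) (Fin n) L)) W ↔
      ∀ g, ∀ w ∈ W, (ρ g).val.mulVec w ∈ W := by
  refine ⟨fun h g => h _ (Algebra.subset_adjoin ⟨g, rfl⟩), fun h a ha v hv => ?_⟩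
  replace ha := (mem_spanAlgebra_iff ρ).mp ha
  induction ha using Submodule.span_induction with
  | mem x hx => obtain ⟨g, rfl⟩ := hx; exact h g v hv
  | zero => rw [Matrix.zero_mulVec]; exact W.zero_mem
  | add x y _ _ hx hy => rw [Matrix.add_mulVec]; exact W.add_mem hx hy
  | smul c x _ hx => rw [Matrix.smul_mulVec]; exact W.smul_mem c hx

/-- The only place where semisimplicity of the representation is unpacked; later arguments use
stable complements in the column space. -/
theorem hasStableComplements_of_isSemisimple (ρ : Γ →* GeneralLinearGroup (Fin n) L)
    (h : (toRepresentation ρ).IsSemisimpleRepresentation) :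
    HasStableComplements (spanAlgebra ρ : Set (Matrix (Fin n) (Fin n) L)) := fun W hW => by
  rw [isStable_spanAlgebra_iff] at hW
  obtain ⟨W', hW'⟩ := h.exists_isCompl (⟨W, fun g w hw => hW g w hw⟩ : Subrepresentation _)
  refine ⟨W'.toSubmodule, (isStable_spanAlgebra_iff ρ _).mpr fun g w hw =>
    W'.apply_mem_toSubmodule g hw, ?_⟩
  refine ⟨disjoint_iff.mpr ?_, codisjoint_iff.mpr ?_⟩
  · exact congrArg Subrepresentation.toSubmodule hW'.inf_eq_bot
  · exact congrArg Subrepresentation.toSubmodule hW'.sup_eq_top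

/-- Needed because reductivity is tested over `AlgebraicClosure k`, which is only isomorphic to L.
Stable subspaces correspond under the semilinear bijection that applies σ to each coordinate. -/
theorem HasStableComplements.map_ringEquiv {L' : Type*} [Field L'] (σ : L ≃+* L')
    {ρ : Γ →* GeneralLinearGroup (Fin n) L}
    (h : HasStableComplements (spanAlgebra ρ : Set (Matrix (Fin n) (Fin n) L))) :
    HasStableComplements (spanAlgebra ((GeneralLinearGroup.map (σ : L →+* L')).comp ρ) :
      Set (Matrix (Fin n) (Fin n) L')) := fun W hW => by
  rw [isStable_spanAlgebra_iff] at hW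
  have := RingHomInvPair.of_ringEquiv σ
  have := RingHomInvPair.symm (σ : L →+* L') (σ.symm : L' →+* L)
  let e : (Fin n → L) ≃ₛₗ[(σ : L →+* L')] (Fin n → L') :=
    { toFun := fun v i => σ (v i)
      invFun := fun v i => σ.symm (v i)
      map_add' := fun x y => by ext; simp
      map_smul' := fun c x => by ext; simp
      left_inv := fun x => by ext; simp
      right_inv := fun x => by ext; simp }
  have he : ∀ g v, e ((ρ g).val.mulVec v) =
      (((GeneralLinearGroup.map (σ : L →+* L')).comp ρ) g).val.mulVec (e v) := fun g v => by
    ext i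
    simp [e, Matrix.mulVec, dotProduct]
  obtain ⟨V, hV, hc⟩ := h (W.comap e.toLinearMap)
    ((isStable_spanAlgebra_iff ρ _).mpr fun g w hw => by
    rw [Submodule.mem_comap] at hw ⊢
    exact (he g w).symm ▸ hW g _ hw)
  rw [isStable_spanAlgebra_iff] at hV
  refine ⟨V.map e.toLinearMap, (isStable_spanAlgebra_iff _ _).mpr ?_, ?_⟩
  · rintro g _ ⟨w, hw, rfl⟩
    exact ⟨_, hV g w hw, he g w⟩
  · have := hc.map (Submodule.orderIsoMapComap e)
    simpa [Submodule.map_comap_eq_of_surjective e.surjective] using this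

end SpanAlgebra

/-! ## Polynomials over an extension field -/

section MapCoeff

open MvPolynomial

variable {k : Type*} {L : Type*} [Field k] [Field L] [Algebra k L] {τ : Type*}

/-- Apply a linear form to the coefficients of a polynomial. -/
def mapCoeff (c : L →ₗ[k] k) (Q : MvPolynomial τ L) : MvPolynomial τ k :=
  ∑ d ∈ Q.support, monomial d (c (Q.coeff d))

theorem aeval_mapCoeff (c : L →ₗ[k] k) (Q : MvPolynomial τ L) {A : Type*} [CommRing A]
    [Algebra k A] (p : τ → A) :
    aeval p (mapCoeff c Q) =
      ∑ d ∈ Q.support, algebraMap k A (c (Q.coeff d)) * d.prod fun i e => p i ^ e := by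
  simp [mapCoeff, aeval_monomial]

/-- At a k-rational point the monomials take values in k, so the k-linear form passes through them.
Both descent results for polynomials rest on this identity. -/
theorem aeval_mapCoeff_field (c : L →ₗ[k] k) (Q : MvPolynomial τ L) (p : τ → k) :
    aeval p (mapCoeff c Q) = c (aeval (fun i => algebraMap k L (p i)) Q) := by
  rw [aeval_mapCoeff, aeval_def, eval₂_eq, map_sum]
  refine Finset.sum_congr rfl fun d _ => ?_
  have : ∏ i ∈ d.support, algebraMap k L (p i) ^ d i =
      algebraMap k L (d.prod fun i e => p i ^ e) := by
    simp [Finsupp.prod, map_prod]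
  rw [this, Algebra.algebraMap_self_apply, Algebra.algebraMap_self_apply, mul_comm (Q.coeff d),
    ← Algebra.smul_def, map_smul, smul_eq_mul, mul_comm]

/-- A polynomial over `L` that vanishes on a set of `k`-rational points also vanishes at every
point at which the polynomials over `k` vanishing on that set vanish. -/
theorem aeval_eq_zero_of_forall_rational {V : Set (τ → k)} {Q : MvPolynomial τ L}
    (hQ : ∀ p ∈ V, aeval (fun i => algebraMap k L (p i)) Q = 0)
    {A : Type*} [CommRing A] [Algebra k A] [Algebra L A] [IsScalarTower k L A] {x : τ → A}
    (hx : ∀ q : MvPolynomial τ k, (∀ p ∈ V, aeval p q = 0) → aeval x q = 0) :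
    aeval x Q = 0 := by
  classical
  let b := Module.Basis.ofVectorSpace k L
  have h0 : ∀ i, aeval x (mapCoeff (b.coord i) Q) = 0 := fun i =>
    hx _ fun p hp => by rw [aeval_mapCoeff_field, hQ p hp, map_zero]
  -- The finitely many basis vectors of L over k that occur in the coefficients: Q is the sum over
  -- them of b i times a polynomial over k.
  let s := Q.support.biUnion fun d => (b.repr (Q.coeff d)).support
  have hs : ∀ d ∈ Q.support, Q.coeff d = ∑ i ∈ s, b.coord i (Q.coeff d) • b i := fun d hd => by
    conv_lhs => rw [← b.linearCombination_repr (Q.coeff d), Finsupp.linearCombination_apply]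
    refine Finsupp.sum_of_support_subset _ ?_ _ (by simp)
    exact Finset.subset_biUnion_of_mem (fun d => (b.repr (Q.coeff d)).support) hd
  have : aeval x Q = ∑ i ∈ s, algebraMap L A (b i) * aeval x (mapCoeff (b.coord i) Q) := by
    simp only [aeval_mapCoeff, Finset.mul_sum]
    rw [Finset.sum_comm, aeval_def, eval₂_eq]
    refine Finset.sum_congr rfl fun d hd => ?_
    conv_lhs => rw [hs d hd]
    rw [map_sum, Finset.sum_mul]
    refine Finset.sum_congr rfl fun i _ => ?_
    rw [Algebra.smul_def, map_mul, ← IsScalarTower.algebraMap_apply, Finsupp.prod]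
    ring
  rw [this]
  exact Finset.sum_eq_zero fun i _ => by rw [h0, mul_zero]

/-- A polynomial over `L` that takes values in the infinite field `k` at `k`-rational points has
coefficients in `k`. -/
theorem exists_map_eq_of_forall_rational [Infinite k] (Q : MvPolynomial τ L)
    (hQ : ∀ p : τ → k, aeval (fun i => algebraMap k L (p i)) Q ∈ (algebraMap k L).range) :
    ∃ P : MvPolynomial τ k, map (algebraMap k L) P = Q := by
  -- A k-linear retraction of L onto k, applied to the coefficients of Q, gives the candidate. It
  -- agrees with Q at rational points, where Q is k-valued, and these determine a polynomial because
  -- k is infinite.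
  obtain ⟨r, hr⟩ := (Algebra.linearMap k L).exists_leftInverse_of_injective
    (LinearMap.ker_eq_bot.mpr (algebraMap k L).injective)
  refine ⟨mapCoeff r Q, funext_set (fun _ => Set.range (algebraMap k L))
    (fun _ => Set.infinite_range_of_injective (algebraMap k L).injective) fun x hx => ?_⟩
  choose p hp using fun i => hx i trivial
  obtain rfl : (fun i => algebraMap k L (p i)) = x := funext hp
  obtain ⟨c, hc⟩ := hQ p
  have h1 : eval (fun i => algebraMap k L (p i)) (map (algebraMap k L) (mapCoeff r Q)) =
      algebraMap k L (aeval p (mapCoeff r Q)) := by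
    rw [eval_map, aeval_def, Algebra.algebraMap_self, ← coe_eval₂Hom, ← coe_eval₂Hom,
      ← RingHom.comp_apply (algebraMap k L), comp_eval₂Hom]
    rfl
  rw [h1, aeval_mapCoeff_field, ← hc]
  have h2 : r (algebraMap k L c) = c := LinearMap.congr_fun hr c
  rw [h2, hc]
  rfl

end MapCoeff

/-! ## Extension of linear forms -/

section LinearForms

variable {k : Type v} [Field k] {R : Type w} [AddCommGroup R] [Module k R]

/-- The extension `B ⊗ R → B` of a linear form on `R`. -/
def extendForm (B : Type*) [CommRing B] [Algebra k B] (c : R →ₗ[k] k) : B ⊗[k] R →ₗ[B] B :=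
  (TensorProduct.AlgebraTensorModule.rid k B B).toLinearMap ∘ₗ c.baseChange B

@[simp]
theorem extendForm_tmul (B : Type*) [CommRing B] [Algebra k B] (c : R →ₗ[k] k) (b : B) (x : R) :
    extendForm B c (b ⊗ₜ x) = algebraMap k B (c x) * b := by
  simp [extendForm, Algebra.smul_def]

theorem extendForm_rTensor {B C : Type*} [CommRing B] [Algebra k B] [CommRing C] [Algebra k C]
    (φ : B →ₐ[k] C) (c : R →ₗ[k] k) (z : B ⊗[k] R) :
    extendForm C c (φ.toLinearMap.rTensor R z) = φ (extendForm B c z) := by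
  induction z with
  | zero => simp
  | add x y hx hy => simp only [map_add, hx, hy]
  | tmul b x => simp

theorem extendForm_lTensor {R' : Type*} [AddCommGroup R'] [Module k R'] {B : Type*} [CommRing B]
    [Algebra k B] (s : R →ₗ[k] R') (c : R' →ₗ[k] k) (z : B ⊗[k] R) :
    extendForm B c (s.lTensor B z) = extendForm B (c ∘ₗ s) z := by
  induction z with
  | zero => simp
  | add x y hx hy => simp only [map_add, hx, hy]
  | tmul b x => simp

end LinearForms

/-! ## Descent of the determinant law -/

section Frame

variable {Γ : Type u} [Group Γ] {n : ℕ} {k L : Type v} [Field k] [Field L] [Algebra k L]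

/-- A basis of the algebra spanned by `ρ` consisting of elements `ρ (g i)`, such that all `ρ γ` have
coordinates in `k`, and the determinant is a polynomial with coefficients in `k` in the
coordinates. -/
structure Frame (k : Type v) [Field k] [Algebra k L] (ρ : Γ →* GeneralLinearGroup (Fin n) L)
    (m : ℕ) where
  g : Fin m → Γ
  linearIndependent : LinearIndependent L fun i => (ρ (g i)).val
  coord : Γ → Fin m → k
  eq_sum : ∀ γ, (ρ γ).val = ∑ i, algebraMap k L (coord γ i) • (ρ (g i)).val
  det : MvPolynomial (Fin m) k
  map_det : MvPolynomial.map (algebraMap k L) det =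
    (∑ i, (MvPolynomial.X i : MvPolynomial (Fin m) L) • (ρ (g i)).val.map MvPolynomial.C).det

theorem trace_mem_of_hasCharpolyOver {ρ : Γ →* GeneralLinearGroup (Fin n) L}
    (h : HasCharpolyOver (algebraMap k L) ρ) (g : Γ) :
    (ρ g).val.trace ∈ (algebraMap k L).fieldRange := by
  rcases isEmpty_or_nonempty (Fin n) with _ | _
  · simp [Matrix.trace]
  · rw [Matrix.trace_eq_neg_charpoly_coeff]
    obtain ⟨q, hq⟩ := Polynomial.mem_lifts _ |>.mp (h g)
    rw [← hq, Polynomial.coeff_map]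
    exact neg_mem ⟨_, rfl⟩

omit [Algebra k L] in
theorem exists_basis_of_spanAlgebra (ρ : Γ →* GeneralLinearGroup (Fin n) L) :
    ∃ (m : ℕ) (g : Fin m → Γ), LinearIndependent L (fun i => (ρ (g i)).val) ∧
      Submodule.span L (Set.range fun i => (ρ (g i)).val) =
        Submodule.span L (Set.range fun g => (ρ g).val) := by
  obtain ⟨f, hf, hspan, hli⟩ := Submodule.exists_fun_fin_finrank_span_eq L
    (Set.range fun g => (ρ g).val)
  choose g hg using hf
  have : f = fun i => (ρ (g i)).val := funext fun i => (hg i).symm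
  exact ⟨_, g, this ▸ hli, this ▸ hspan⟩

/-- The Gram matrix of the trace form in a basis taken from ρ(Γ) has entries in k and is invertible
by nondegeneracy, so the coordinates of each ρ(γ) solve a linear system over k. The determinant of
the generic combination has k-rational values at k-rational points, hence coefficients in the
infinite field k. -/
theorem exists_frame [CharZero L] {ρ : Γ →* GeneralLinearGroup (Fin n) L}
    (hs : HasStableComplements (spanAlgebra ρ : Set (Matrix (Fin n) (Fin n) L)))
    (hρ : HasCharpolyOver (algebraMap k L) ρ) : ∃ m, Nonempty (Frame k ρ m) := by
  obtain ⟨m, g, hli, hspan⟩ := exists_basis_of_spanAlgebra ρ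
  have htr := trace_mem_of_hasCharpolyOver hρ
  choose t ht using htr
  let G₀ : Matrix (Fin m) (Fin m) k := Matrix.of fun i j => t (g i * g j)
  let G : Matrix (Fin m) (Fin m) L := Matrix.of fun i j => ((ρ (g i)).val * (ρ (g j)).val).trace
  have hG : G = G₀.map (algebraMap k L) := by
    ext i j
    simp [G, G₀, ht]
  have hvec : ∀ (v : Fin m → L) (j : Fin m), Matrix.vecMul v G j =
      ((∑ i, v i • (ρ (g i)).val) * (ρ (g j)).val).trace := fun v j => by
    simp [Matrix.vecMul, dotProduct, G, Finset.sum_mul, Matrix.trace_sum]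
  have hinj : ∀ v : Fin m → L, Matrix.vecMul v G = 0 → v = 0 := fun v hv => by
    have h0 : ∑ i, v i • (ρ (g i)).val = 0 := by
      refine eq_zero_of_trace_mul_eq_zero (spanAlgebra ρ) hs
        (Subalgebra.sum_mem _ fun i _ => Subalgebra.smul_mem _
          (Algebra.subset_adjoin (Set.mem_range_self (f := fun g => (ρ g).val) (g i))) _)
        fun y hy => ?_
      rw [mem_spanAlgebra_iff, ← hspan] at hy
      induction hy using Submodule.span_induction with
      | mem x hx =>
        obtain ⟨j, rfl⟩ := hx
        rw [← hvec, hv]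
        rfl
      | zero => simp
      | add x y _ _ h1 h2 => rw [mul_add, Matrix.trace_add, h1, h2, add_zero]
      | smul c x _ h1 => rw [mul_smul_comm, Matrix.trace_smul, h1, smul_zero]
    exact funext (Fintype.linearIndependent_iff.mp hli v h0)
  have hdet : G₀.det ≠ 0 := fun h0 => by
    have : G.det = 0 := by
      rw [hG]
      exact ((algebraMap k L).map_det G₀).symm.trans (by rw [h0, map_zero])
    obtain ⟨v, hv, hv'⟩ := Matrix.exists_vecMul_eq_zero_iff.mpr this
    exact hv (hinj v hv')
  -- The coordinates of ρ(γ) are recovered from its trace pairings with the basis.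
  let a : Γ → Fin m → k := fun γ => Matrix.vecMul (fun j => t (γ * g j)) G₀⁻¹
  have ha : ∀ γ, (ρ γ).val = ∑ i, algebraMap k L (a γ i) • (ρ (g i)).val := fun γ => by
    have hγ : (ρ γ).val ∈ Submodule.span L (Set.range fun i => (ρ (g i)).val) :=
      hspan ▸ Submodule.subset_span ⟨γ, rfl⟩
    obtain ⟨v, hv⟩ := (Submodule.mem_span_range_iff_exists_fun L).mp hγ
    have h1 : Matrix.vecMul (fun i => algebraMap k L (a γ i)) G = Matrix.vecMul v G := by
      funext j
      rw [hvec v, hv, ← Units.val_mul, ← map_mul, ← ht, hG]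
      have : Matrix.vecMul (a γ) G₀ = fun j => t (γ * g j) := by
        rw [Matrix.vecMul_vecMul, Matrix.nonsing_inv_mul _ (Ne.isUnit hdet), Matrix.vecMul_one]
      rw [← congrFun this j]
      exact (RingHom.map_vecMul (algebraMap k L) G₀ (a γ) j).symm
    have h2 := hinj (v - fun i => algebraMap k L (a γ i)) (by rw [Matrix.sub_vecMul, h1, sub_self])
    rw [← hv, sub_eq_zero.mp h2]
  have : CharZero k := (algebraMap k L).charZero_iff (algebraMap k L).injective |>.mpr inferInstance
  obtain ⟨P, hP⟩ := exists_map_eq_of_forall_rational (k := k)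
    (∑ i, (MvPolynomial.X i : MvPolynomial (Fin m) L) • (ρ (g i)).val.map MvPolynomial.C).det
    fun p => by
      have h1 : MvPolynomial.aeval (fun i => algebraMap k L (p i))
          (∑ i, (MvPolynomial.X i : MvPolynomial (Fin m) L) •
            (ρ (g i)).val.map MvPolynomial.C).det =
          (∑ i, p i • (ρ (g i)).val).det := by
        rw [AlgHom.map_det]
        congr 1
        ext a b
        simp [Matrix.sum_apply, (Algebra.smul_def : ∀ (r : k) (x : L), r • x = _)]
      rw [h1]
      -- A power of a k-combination of group elements is again such a combination, so its trace is
      -- in k; Newton's identities then handle the determinant.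
      refine det_mem_of_trace_pow_mem (algebraMap k L).fieldRange _ fun j => ?_
      have h2 : ∑ i, p i • (ρ (g i)).val ∈ Algebra.adjoin k (Set.range fun g => (ρ g).val) :=
        Subalgebra.sum_mem _ fun i _ => Subalgebra.smul_mem _
          (Algebra.subset_adjoin (Set.mem_range_self (f := fun g => (ρ g).val) (g i))) _
      have h3 := Subalgebra.pow_mem _ h2 (j + 1)
      generalize (∑ i, p i • (ρ (g i)).val) ^ (j + 1) = y at h3 ⊢
      rw [← Subalgebra.mem_toSubmodule, adjoin_range_eq_span] at h3
      induction h3 using Submodule.span_induction with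
      | mem x hx => obtain ⟨γ, rfl⟩ := hx; exact trace_mem_of_hasCharpolyOver hρ γ
      | zero => simp
      | add x y _ _ h1 h2 => rw [Matrix.trace_add]; exact add_mem h1 h2
      | smul c x _ h1 =>
        rw [Matrix.trace_smul, Algebra.smul_def]
        exact mul_mem ⟨c, rfl⟩ h1
  exact ⟨m, ⟨g, hli, a, ha, P, hP⟩⟩

/-- The homomorphism `B ⊗ k[Γ] → M_n(C)` attached to `ρ` and a homomorphism `B → C` to an
`L`-algebra. -/
def linearizationAlong (ρ : Γ →* GeneralLinearGroup (Fin n) L) {B C : Type*} [CommRing B]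
    [Algebra k B] [CommRing C] [Algebra k C] [Algebra L C] (ψ : B →ₐ[k] C) :
    B ⊗[k] MonoidAlgebra k Γ →ₐ[k] Matrix (Fin n) (Fin n) C :=
  Algebra.TensorProduct.lift ((Algebra.ofId C _).restrictScalars k |>.comp ψ)
    (MonoidAlgebra.lift k (Matrix (Fin n) (Fin n) C) Γ
      ((Units.coeHom _).comp ((GeneralLinearGroup.map (algebraMap L C)).comp ρ)))
    fun b _ => Algebra.commutes (ψ b) _

omit [Algebra k L] in
theorem linearizationAlong_tmul_single (ρ : Γ →* GeneralLinearGroup (Fin n) L) {B C : Type*}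
    [CommRing B] [Algebra k B] [CommRing C] [Algebra k C] [Algebra L C] (ψ : B →ₐ[k] C)
    (b : B) (g : Γ) (c : k) :
    linearizationAlong ρ ψ (b ⊗ₜ MonoidAlgebra.single g c) =
      (ψ b * algebraMap k C c) • (ρ g).val.map (algebraMap L C) := by
  have h : linearizationAlong ρ ψ (b ⊗ₜ MonoidAlgebra.single g c) =
      Algebra.ofId C (Matrix (Fin n) (Fin n) C) (ψ b) *
        MonoidAlgebra.lift k (Matrix (Fin n) (Fin n) C) Γ
          ((Units.coeHom _).comp ((GeneralLinearGroup.map (algebraMap L C)).comp ρ))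
          (MonoidAlgebra.single g c) := Algebra.TensorProduct.lift_tmul _ _ _ _ _
  rw [h, MonoidAlgebra.lift_single, Algebra.ofId_apply, ← Algebra.smul_def, mul_smul,
    algebraMap_smul]
  rfl

namespace Frame

variable {ρ : Γ →* GeneralLinearGroup (Fin n) L} {m : ℕ} (F : Frame k ρ m)

/-- The coordinates as linear forms on the group algebra. -/
def coordForm (i : Fin m) : MonoidAlgebra k Γ →ₗ[k] k :=
  Finsupp.linearCombination k (fun γ => F.coord γ i) ∘ₗ
    (MonoidAlgebra.coeffLinearEquiv k).toLinearMap

@[simp]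
theorem coordForm_single (i : Fin m) (γ : Γ) (c : k) :
    F.coordForm i (MonoidAlgebra.single γ c) = c * F.coord γ i := by
  simp [coordForm]

/-- The values of the descended determinant law. -/
def lawMap (B : Type*) [CommRing B] [Algebra k B] (x : B ⊗[k] MonoidAlgebra k Γ) : B :=
  MvPolynomial.aeval (fun i => extendForm B (F.coordForm i) x) F.det

theorem lawMap_rTensor {B C : Type*} [CommRing B] [Algebra k B] [CommRing C] [Algebra k C]
    (φ : B →ₐ[k] C) (x : B ⊗[k] MonoidAlgebra k Γ) :
    φ (F.lawMap B x) = F.lawMap C (φ.toLinearMap.rTensor _ x) := by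
  simp only [lawMap, extendForm_rTensor]
  exact (MvPolynomial.comp_aeval_apply _ φ _)

variable {B C : Type*} [CommRing B] [Algebra k B] [CommRing C] [Algebra k C] [Algebra L C]
  [IsScalarTower k L C] (ψ : B →ₐ[k] C)

theorem linearizationAlong_eq_sum (x : B ⊗[k] MonoidAlgebra k Γ) :
    linearizationAlong ρ ψ x = ∑ i, ψ (extendForm B (F.coordForm i) x) •
      (ρ (F.g i)).val.map (algebraMap L C) := by
  induction x with
  | zero => simp
  | add x y hx hy => simp only [map_add, hx, hy, add_smul, Finset.sum_add_distrib]
  | tmul b p =>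
    induction p using MonoidAlgebra.induction_linear with
    | zero => simp
    | add p q hp hq =>
      simp only [TensorProduct.tmul_add, map_add, hp, hq, add_smul, Finset.sum_add_distrib]
    | single g c =>
      rw [linearizationAlong_tmul_single]
      conv_lhs => rw [F.eq_sum g]
      ext i j
      simp [Matrix.sum_apply, Finset.mul_sum,
        (Algebra.smul_def : ∀ (r : k) (x : L), r • x = _), ← IsScalarTower.algebraMap_apply]
      refine Finset.sum_congr rfl fun _ _ => ?_
      ring

/-- Over an L-algebra the descended law is an honest determinant: `F.det` becomes the determinant of
the generic combination of the basis, evaluated at the coordinates of x. -/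
theorem det_linearizationAlong (x : B ⊗[k] MonoidAlgebra k Γ) :
    (linearizationAlong ρ ψ x).det = ψ (F.lawMap B x) := by
  rw [F.linearizationAlong_eq_sum, lawMap]
  rw [MvPolynomial.comp_aeval_apply, ← MvPolynomial.aeval_map_algebraMap L, F.map_det,
    AlgHom.map_det]
  congr 1
  ext a b
  simp [Matrix.sum_apply]

end Frame

end Frame

/-! ## Determinant laws on group algebras -/

namespace DeterminantLaw

section Naturality

variable {k : Type v} [Field k] {R : Type w} [Ring R] [Algebra k R] {d : ℕ}

theorem eval_rTensor (D : DeterminantLaw k R d) {B C : Type v} [CommRing B] [Algebra k B]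
    [CommRing C] [Algebra k C] (φ : B →ₐ[k] C) (x : B ⊗[k] R) :
    D.eval C (φ.toLinearMap.rTensor R x) = φ (D.eval B x) := by
  have h := congrFun (D.isCompat' φ) x
  simp only [Function.comp_apply] at h
  rw [eval, ← h, eval]
  generalize D.toFun' B x = z
  induction z with
  | zero => simp
  | add x y hx hy => simp only [map_add, hx, hy]
  | tmul b c => simp

theorem toFun'_eq_eval_tmul (D : DeterminantLaw k R d) {B : Type v} [CommRing B] [Algebra k B]
    (x : B ⊗[k] R) : D.toFun' B x = D.eval B x ⊗ₜ 1 := by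
  rw [eval]
  generalize D.toFun' B x = z
  induction z with
  | zero => simp
  | add x y hx hy => simp only [map_add, TensorProduct.add_tmul, ← hx, ← hy]
  | tmul b c => simp [TensorProduct.smul_tmul]

theorem eval_one (D : DeterminantLaw k R d) (B : Type v) [CommRing B] [Algebra k B] :
    D.eval B 1 = 1 := by
  rw [eval]
  exact (congrArg _ (D.map_one B)).trans (_root_.map_one (Algebra.TensorProduct.rid k B B))

theorem ext_of_eval {D D' : DeterminantLaw k R d}
    (h : ∀ (B : Type v) [CommRing B] [Algebra k B] (x : B ⊗[k] R), D.eval B x = D'.eval B x) :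
    D = D' := by
  have : D.toPolynomialLaw = D'.toPolynomialLaw := by
    ext B _ _ x
    -- Polynomial laws range over commutative semirings, but an algebra over a field inherits
    -- negatives from the scalars, so values on commutative rings suffice.
    let iB : CommRing B := (algebraMap k B).commSemiringToCommRing
    exact (toFun'_eq_eval_tmul D (B := B) x).trans
      ((congrArg (fun z : B => z ⊗ₜ[k] (1 : k)) (h B x)).trans
        (toFun'_eq_eval_tmul D' (B := B) x).symm)
  cases D
  cases D'
  congr

end Naturality

variable {Γ : Type u} [Group Γ] {k L : Type v} [Field k] [Field L] [Algebra k L] {d : ℕ}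

omit [Group Γ] in
theorem exists_eq_sum {B : Type v} [CommRing B] [Algebra k B] (x : B ⊗[k] MonoidAlgebra k Γ) :
    ∃ y : Γ →₀ B, x = y.sum fun g b => b ⊗ₜ[k] MonoidAlgebra.single g (1 : k) := by
  classical
  induction x with
  | zero => exact ⟨0, by simp⟩
  | add x y hx hy =>
    obtain ⟨x', rfl⟩ := hx
    obtain ⟨y', rfl⟩ := hy
    exact ⟨x' + y', (Finsupp.sum_add_index' (by simp) (by simp [TensorProduct.add_tmul])).symm⟩
  | tmul b p =>
    induction p using MonoidAlgebra.induction_linear with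
    | zero => exact ⟨0, by simp⟩
    | add p q hp hq =>
      obtain ⟨x', hx⟩ := hp
      obtain ⟨y', hy⟩ := hq
      refine ⟨x' + y', ?_⟩
      rw [TensorProduct.tmul_add, hx, hy,
        Finsupp.sum_add_index' (by simp) (by simp [TensorProduct.add_tmul])]
    | single g c =>
      refine ⟨Finsupp.single g (c • b), ?_⟩
      rw [Finsupp.sum_single_index (by simp), TensorProduct.smul_tmul]
      simp

/-- Identities in a k-algebra B may be checked in L ⊗ B, where the descended law is a determinant of
matrices. Its multiplicativity, homogeneity and uniqueness all follow this way. -/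
theorem exists_injective_algHom (k L : Type v) [Field k] [Field L] [Algebra k L] (B : Type v)
    [CommRing B] [Algebra k B] : ∃ (C : Type v) (_ : CommRing C) (_ : Algebra k C)
      (_ : Algebra L C) (_ : IsScalarTower k L C) (ψ : B →ₐ[k] C), Function.Injective ψ :=
  ⟨L ⊗[k] B, inferInstance, inferInstance, inferInstance, inferInstance,
    Algebra.TensorProduct.includeRight,
    Algebra.TensorProduct.includeRight_injective (algebraMap k L).injective⟩

/-- A determinant law over `k` is determined by its values over `L`-algebras. -/
theorem eq_of_factorsThrough {D : DeterminantLaw L (MonoidAlgebra L Γ) d}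
    {D₁ D₂ : DeterminantLaw k (MonoidAlgebra k Γ) d}
    (h₁ : D.FactorsThrough (algebraMap k L) D₁) (h₂ : D.FactorsThrough (algebraMap k L) D₂) :
    D₁ = D₂ := by
  refine ext_of_eval fun B _ _ x => ?_
  obtain ⟨y, rfl⟩ := exists_eq_sum x
  -- The k-structure of C is discarded and rebuilt as the composite k → L → C, the instance used in
  -- the definition of `FactorsThrough`.
  obtain ⟨C, _, _, ψ', hψ, hφ⟩ : ∃ (C : Type v) (_ : CommRing C) (_ : Algebra L C) (ψ' : B →+* C),
      (∀ r, ψ' (algebraMap k B r) = algebraMap L C (algebraMap k L r)) ∧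
        Function.Injective ψ' := by
    obtain ⟨C, _, _, _, _, ψ, hψ⟩ := exists_injective_algHom k L B
    exact ⟨C, inferInstance, inferInstance, ψ,
      fun r => (ψ.commutes r).trans (IsScalarTower.algebraMap_apply k L C r), hψ⟩
  let iC : Algebra k C := ((algebraMap L C).comp (algebraMap k L)).toAlgebra
  let φ : B →ₐ[k] C := { ψ' with commutes' := hψ }
  replace hφ : Function.Injective φ := hφ
  apply hφ
  rw [← eval_rTensor, ← eval_rTensor]
  have h := (h₁ C (y.mapRange φ (map_zero φ))).symm.trans (h₂ C (y.mapRange φ (map_zero φ)))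
  have hsum : φ.toLinearMap.rTensor (MonoidAlgebra k Γ)
      (y.sum fun g b => b ⊗ₜ[k] MonoidAlgebra.single g (1 : k)) =
      (y.mapRange φ (map_zero φ)).sum fun g b => b ⊗ₜ[k] MonoidAlgebra.single g (1 : k) := by
    rw [Finsupp.sum_mapRange_index (by simp), Finsupp.sum, map_sum]
    rfl
  rw [hsum]
  exact h

end DeterminantLaw

namespace Frame

variable {Γ : Type u} [Group Γ] {n : ℕ} {k L : Type v} [Field k] [Field L] [Algebra k L]
  {ρ : Γ →* GeneralLinearGroup (Fin n) L} {m : ℕ} (F : Frame k ρ m)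

theorem lawMap_one (B : Type v) [CommRing B] [Algebra k B] : F.lawMap B 1 = 1 := by
  obtain ⟨C, _, _, _, _, ψ, hψ⟩ := DeterminantLaw.exists_injective_algHom k L B
  apply hψ
  rw [← F.det_linearizationAlong, map_one, map_one, Matrix.det_one]

theorem lawMap_mul (B : Type v) [CommRing B] [Algebra k B] (x y : B ⊗[k] MonoidAlgebra k Γ) :
    F.lawMap B (x * y) = F.lawMap B x * F.lawMap B y := by
  obtain ⟨C, _, _, _, _, ψ, hψ⟩ := DeterminantLaw.exists_injective_algHom k L B
  apply hψ
  rw [map_mul, ← F.det_linearizationAlong, ← F.det_linearizationAlong, ← F.det_linearizationAlong,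
    map_mul, Matrix.det_mul]

theorem lawMap_smul (B : Type v) [CommRing B] [Algebra k B] (b : B)
    (x : B ⊗[k] MonoidAlgebra k Γ) : F.lawMap B (b • x) = b ^ n * F.lawMap B x := by
  obtain ⟨C, _, _, _, _, ψ, hψ⟩ := DeterminantLaw.exists_injective_algHom k L B
  apply hψ
  have h : linearizationAlong ρ ψ (b • x) = ψ b • linearizationAlong ρ ψ x := by
    simp only [F.linearizationAlong_eq_sum, map_smul, smul_eq_mul, map_mul, mul_smul,
      Finset.smul_sum]
  rw [map_mul, map_pow, ← F.det_linearizationAlong, ← F.det_linearizationAlong, h,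
    Matrix.det_smul, Fintype.card_fin]

/-- The descended determinant law. -/
def law : DeterminantLaw k (MonoidAlgebra k Γ) n :=
  DeterminantLaw.ofMaps n (fun B _ _ x => F.lawMap B x)
    (fun _ _ _ _ _ _ φ x => F.lawMap_rTensor φ x) (fun B _ _ => F.lawMap_one B)
    (fun B _ _ x y => F.lawMap_mul B x y) (fun B _ _ b x => F.lawMap_smul B b x)

theorem eval_law (B : Type v) [CommRing B] [Algebra k B] (x : B ⊗[k] MonoidAlgebra k Γ) :
    F.law.eval B x = F.lawMap B x :=
  DeterminantLaw.eval_ofMaps ..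

theorem factorsThrough_law : (detLaw ρ).FactorsThrough (algebraMap k L) F.law := by
  intro B _ _ y
  let iB : Algebra k B := ((algebraMap L B).comp (algebraMap k L)).toAlgebra
  have : IsScalarTower k L B := IsScalarTower.of_algebraMap_eq fun _ => rfl
  change (detLaw ρ).eval B _ = F.law.eval B _
  rw [detLaw_eval, F.eval_law]
  have := F.det_linearizationAlong (AlgHom.id k B)
    (y.sum fun g b => b ⊗ₜ[k] MonoidAlgebra.single g (1 : k))
  rw [AlgHom.id_apply] at this
  rw [← this]
  congr 1
  rw [Finsupp.sum, Finsupp.sum, map_sum, map_sum]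
  refine Finset.sum_congr rfl fun g _ => ?_
  rw [linearization_tmul_single, linearizationAlong_tmul_single]
  simp

end Frame

/-! ## The kernel of the descended law -/

section Kernel

variable {Γ : Type u} [Group Γ] {n : ℕ} {k L : Type v} [Field k] [Field L] [Algebra k L]

/-- The `k`-linear extension `k[Γ] → M_n(L)` of a representation. -/
def groupAlgebraHom (k : Type v) [Field k] [Algebra k L] (ρ : Γ →* GeneralLinearGroup (Fin n) L) :
    MonoidAlgebra k Γ →ₐ[k] Matrix (Fin n) (Fin n) L :=
  MonoidAlgebra.lift k (Matrix (Fin n) (Fin n) L) Γ ((Units.coeHom _).comp ρ)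

@[simp]
theorem groupAlgebraHom_single (ρ : Γ →* GeneralLinearGroup (Fin n) L) (γ : Γ) (c : k) :
    groupAlgebraHom k ρ (MonoidAlgebra.single γ c) = c • (ρ γ).val :=
  MonoidAlgebra.lift_single _ _ _

variable {ρ : Γ →* GeneralLinearGroup (Fin n) L} {m : ℕ}

theorem linearizationAlong_tmul {B C : Type*} [CommRing B] [Algebra k B] [CommRing C] [Algebra k C]
    [Algebra L C] [IsScalarTower k L C] (ψ : B →ₐ[k] C) (b : B) (x : MonoidAlgebra k Γ) :
    linearizationAlong ρ ψ (b ⊗ₜ x) =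
      ψ b • (groupAlgebraHom k ρ x).map (algebraMap L C) := by
  induction x using MonoidAlgebra.induction_linear with
  | zero => ext; simp
  | add p q hp hq =>
    rw [TensorProduct.tmul_add, map_add, hp, hq, map_add, ← smul_add]
    congr 1
    ext
    simp
  | single g c =>
    rw [linearizationAlong_tmul_single, groupAlgebraHom_single]
    ext i j
    simp [(Algebra.smul_def : ∀ (r : k) (x : L), r • x = _), ← IsScalarTower.algebraMap_apply,
      mul_assoc]

namespace Frame

variable (F : Frame k ρ m)

theorem groupAlgebraHom_eq_sum (x : MonoidAlgebra k Γ) :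
    groupAlgebraHom k ρ x = ∑ i, algebraMap k L (F.coordForm i x) • (ρ (F.g i)).val := by
  induction x using MonoidAlgebra.induction_linear with
  | zero => simp
  | add p q hp hq => simp only [map_add, hp, hq, add_smul, Finset.sum_add_distrib]
  | single g c =>
    rw [groupAlgebraHom_single]
    conv_lhs => rw [F.eq_sum g]
    simp only [coordForm_single, Finset.smul_sum, map_mul, mul_smul, algebraMap_smul]

theorem groupAlgebraHom_eq_zero_iff (x : MonoidAlgebra k Γ) :
    groupAlgebraHom k ρ x = 0 ↔ ∀ i, F.coordForm i x = 0 := by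
  rw [F.groupAlgebraHom_eq_sum]
  refine ⟨fun h i => ?_, fun h => by simp [h]⟩
  have := Fintype.linearIndependent_iff.mp F.linearIndependent _ h i
  exact (map_eq_zero _).mp this

/-- For y in J, the elements 1 + Xy and 1 agree modulo J, so det(1 + Xρ(y)) = 1 and the linear
coefficient shows that ρ(y) has trace zero. Applied to y = xγ for all γ, this makes ρ(x) orthogonal
to the whole algebra. -/
theorem groupAlgebraHom_eq_zero_of_factorsThroughQuotient [CharZero L]
    (hs : HasStableComplements (spanAlgebra ρ : Set (Matrix (Fin n) (Fin n) L)))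
    {J : TwoSidedIdeal (MonoidAlgebra k Γ)} (hJ : F.law.FactorsThroughQuotient J)
    {x : MonoidAlgebra k Γ} (hx : x ∈ J) : groupAlgebraHom k ρ x = 0 := by
  obtain ⟨D', hD'⟩ := hJ
  have h1 : ∀ y ∈ J, (groupAlgebraHom k ρ y).trace = 0 := fun y hy => by
    have hy0 : J.ringCon.mkₐ (α := k) y = 0 := (RingCon.eq _).mpr (J.mem_iff y |>.mp hy)
    let z : Polynomial k ⊗[k] MonoidAlgebra k Γ := 1 + Polynomial.X ⊗ₜ y
    have hz : F.law.eval (Polynomial k) z = 1 := by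
      rw [← F.law.eval_one, DeterminantLaw.eval, DeterminantLaw.eval, hD', hD']
      congr 2
      rw [map_add, LinearMap.lTensor_tmul, AlgHom.toLinearMap_apply, hy0, TensorProduct.tmul_zero,
        add_zero]
    rw [F.eval_law] at hz
    -- The passage from k[X] to L[X] turns the value of the law into a determinant.
    have hdet := F.det_linearizationAlong (Polynomial.mapAlgHom (Algebra.ofId k L)) z
    rw [hz, map_one, map_add, map_one, linearizationAlong_tmul] at hdet
    have hX : Polynomial.mapAlgHom (Algebra.ofId k L) Polynomial.X = Polynomial.X :=
      Polynomial.map_X _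
    rw [hX] at hdet
    rw [← Matrix.derivative_det_one_add_X_smul, ← Polynomial.algebraMap_eq, hdet]
    simp
  refine eq_zero_of_trace_mul_eq_zero (spanAlgebra ρ) hs ?_ fun y hy => ?_
  · rw [F.groupAlgebraHom_eq_sum]
    exact Subalgebra.sum_mem _ fun i _ => Subalgebra.smul_mem _ (Algebra.subset_adjoin
      (Set.mem_range_self (f := fun g => (ρ g).val) (F.g i))) _
  · rw [mem_spanAlgebra_iff] at hy
    induction hy using Submodule.span_induction with
    | mem y hy =>
      obtain ⟨g, rfl⟩ := hy
      have := h1 (x * MonoidAlgebra.single g 1) (J.mul_mem_right _ _ hx)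
      rwa [map_mul, groupAlgebraHom_single, one_smul] at this
    | zero => simp
    | add x y _ _ h1 h2 => rw [mul_add, Matrix.trace_add, h1, h2, add_zero]
    | smul c x _ h1 => rw [mul_smul_comm, Matrix.trace_smul, h1, smul_zero]

/-- The law is a polynomial in coordinates that vanish on this kernel. A linear section of the
quotient map induces the law on the quotient; it need not be multiplicative, since only a polynomial
law is required there. -/
theorem factorsThroughQuotient_ker :
    F.law.FactorsThroughQuotient (TwoSidedIdeal.ker (groupAlgebraHom k ρ)) := by
  set J := TwoSidedIdeal.ker (groupAlgebraHom k ρ)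
  obtain ⟨s, hs⟩ := (J.ringCon.mkₐ (α := k)).toLinearMap.exists_rightInverse_of_surjective
    (LinearMap.range_eq_top.mpr J.ringCon.mk'_surjective)
  have hc : ∀ i, F.coordForm i ∘ₗ s ∘ₗ (J.ringCon.mkₐ (α := k)).toLinearMap = F.coordForm i :=
    fun i => LinearMap.ext fun x => by
      have h1 : J.ringCon.mkₐ (α := k) (s (J.ringCon.mkₐ (α := k) x)) = J.ringCon.mkₐ (α := k) x :=
        LinearMap.congr_fun hs _
      have h2 : groupAlgebraHom k ρ (s (J.ringCon.mkₐ (α := k) x)) = groupAlgebraHom k ρ x :=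
        (RingCon.eq _).mp h1
      have h3 := (F.groupAlgebraHom_eq_zero_iff (s (J.ringCon.mkₐ (α := k) x) - x)).mp
        (by rw [map_sub, h2, sub_self]) i
      rwa [map_sub, sub_eq_zero] at h3
  refine ⟨⟨fun B _ _ z => F.law.toFun' B (s.lTensor B z), ?_⟩, ?_⟩
  · intro B _ _ C _ _ φ
    funext z
    have := congrFun (F.law.isCompat' φ) (s.lTensor B z)
    simp only [Function.comp_apply] at this ⊢
    rw [this, ← LinearMap.comp_apply, ← LinearMap.comp_apply, LinearMap.rTensor_comp_lTensor,
      LinearMap.lTensor_comp_rTensor]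
  · intro B _ _ x
    change F.law.toFun' B x = F.law.toFun' B (s.lTensor B (LinearMap.lTensor B _ x))
    rw [DeterminantLaw.toFun'_eq_eval_tmul, DeterminantLaw.toFun'_eq_eval_tmul, F.eval_law,
      F.eval_law, ← LinearMap.comp_apply, ← LinearMap.lTensor_comp]
    simp only [lawMap, extendForm_lTensor, hc]

/-- The kernel of ρ on k[Γ] is itself admissible and contains every admissible ideal, so the
supremum defining `ker` is attained. This identifies the quotient algebra with the k-span of ρ(Γ).
-/
theorem mem_ker_law_iff [CharZero L]
    (hs : HasStableComplements (spanAlgebra ρ : Set (Matrix (Fin n) (Fin n) L)))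
    (x : MonoidAlgebra k Γ) : x ∈ F.law.ker ↔ groupAlgebraHom k ρ x = 0 := by
  refine ⟨fun hx => ?_, fun hx => ?_⟩
  · have : F.law.ker ≤ TwoSidedIdeal.ker (groupAlgebraHom k ρ) :=
      sSup_le fun J hJ y hy => TwoSidedIdeal.mem_ker _ |>.mpr
        (F.groupAlgebraHom_eq_zero_of_factorsThroughQuotient hs hJ hy)
    exact TwoSidedIdeal.mem_ker _ |>.mp (this hx)
  · have : TwoSidedIdeal.ker (groupAlgebraHom k ρ) ≤ F.law.ker :=
      le_sSup F.factorsThroughQuotient_ker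
    exact this (TwoSidedIdeal.mem_ker _ |>.mpr hx)

end Frame

end Kernel

/-! ## The quotient algebra of the descended law -/

section ExtendScalars

variable {k k' : Type*} [Field k] [Field k'] [Algebra k k'] {S T : Type*} [Ring S] [Algebra k S]
  [Ring T] [Algebra k T] [Algebra k' T] [IsScalarTower k k' T]

/-- The extension of a homomorphism of `k`-algebras `S → T` to `k' ⊗ S`. -/
def extendScalars (k' : Type*) [Field k'] [Algebra k k'] [Algebra k' T] [IsScalarTower k k' T]
    (s : S →ₐ[k] T) : k' ⊗[k] S →ₐ[k'] T :=
  Algebra.TensorProduct.lift (Algebra.ofId k' T) s fun c _ => Algebra.commutes c _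

@[simp]
theorem extendScalars_tmul (s : S →ₐ[k] T) (c : k') (x : S) :
    extendScalars k' s (c ⊗ₜ x) = c • s x :=
  (Algebra.TensorProduct.lift_tmul _ _ _ _ _).trans (Algebra.smul_def _ _).symm

theorem extendScalars_injective {ι : Type*} [Fintype ι] (b : Module.Basis ι k S) (s : S →ₐ[k] T)
    (h : LinearIndependent k' fun i => s (b i)) : Function.Injective (extendScalars k' s) := by
  refine (injective_iff_map_eq_zero _).mpr fun z hz => ?_
  rw [← (b.baseChange k').sum_repr z, map_sum] at hz
  simp only [map_smul, Module.Basis.baseChange_apply, extendScalars_tmul, one_smul] at hz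
  rw [← (b.baseChange k').sum_repr z]
  exact Finset.sum_eq_zero fun i _ => by
    rw [Fintype.linearIndependent_iff.mp h _ hz i, zero_smul]

end ExtendScalars

namespace Frame

variable {Γ : Type u} [Group Γ] {n : ℕ} {k L : Type v} [Field k] [Field L] [Algebra k L]
  {ρ : Γ →* GeneralLinearGroup (Fin n) L} {m : ℕ} (F : Frame k ρ m)

/-- The class of a group element in the quotient algebra. -/
def cls (γ : Γ) : F.law.quotientAlgebra := F.law.ker.ringCon.mk' (MonoidAlgebra.of k Γ γ)

variable [CharZero L]

theorem ringCon_ker_law_iff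
    (hs : HasStableComplements (spanAlgebra ρ : Set (Matrix (Fin n) (Fin n) L)))
    (x y : MonoidAlgebra k Γ) :
    F.law.ker.ringCon x y ↔ groupAlgebraHom k ρ x = groupAlgebraHom k ρ y := by
  rw [TwoSidedIdeal.rel_iff, F.mem_ker_law_iff hs, map_sub, sub_eq_zero]

/-- The embedding of the quotient algebra into the matrix algebra. -/
def quotientHom
    (hs : HasStableComplements (spanAlgebra ρ : Set (Matrix (Fin n) (Fin n) L))) :
    F.law.quotientAlgebra →ₐ[k] Matrix (Fin n) (Fin n) L :=
  F.law.ker.ringCon.liftₐ (groupAlgebraHom k ρ) fun {x y} h => (F.ringCon_ker_law_iff hs x y).mp h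

theorem quotientHom_mk'
    (hs : HasStableComplements (spanAlgebra ρ : Set (Matrix (Fin n) (Fin n) L)))
    (x : MonoidAlgebra k Γ) :
    F.quotientHom hs (F.law.ker.ringCon.mk' x) = groupAlgebraHom k ρ x := rfl

theorem quotientHom_cls
    (hs : HasStableComplements (spanAlgebra ρ : Set (Matrix (Fin n) (Fin n) L)))
    (γ : Γ) : F.quotientHom hs (F.cls γ) = (ρ γ).val := by
  rw [cls, quotientHom_mk', MonoidAlgebra.of_apply, groupAlgebraHom_single, one_smul]

theorem quotientHom_injective
    (hs : HasStableComplements (spanAlgebra ρ : Set (Matrix (Fin n) (Fin n) L))) :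
    Function.Injective (F.quotientHom hs) := fun x y h => by
  obtain ⟨x, rfl⟩ := F.law.ker.ringCon.mk'_surjective x
  obtain ⟨y, rfl⟩ := F.law.ker.ringCon.mk'_surjective y
  exact (RingCon.eq _).mpr ((F.ringCon_ker_law_iff hs x y).mpr h)

/-- The basis of the quotient algebra given by a frame. -/
def basis
    (hs : HasStableComplements (spanAlgebra ρ : Set (Matrix (Fin n) (Fin n) L))) :
    Module.Basis (Fin m) k F.law.quotientAlgebra :=
  Module.Basis.mk (v := fun i => F.cls (F.g i))
    (by
      have h1 : LinearIndependent k fun i => (ρ (F.g i)).val :=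
        F.linearIndependent.restrict_scalars (by
          intro a b hab
          simpa [Algebra.smul_def] using hab)
      have h2 : (fun i => (ρ (F.g i)).val) =
          (F.quotientHom hs).toLinearMap ∘ fun i => F.cls (F.g i) := by
        funext i
        exact (F.quotientHom_cls hs _).symm
      rw [h2] at h1
      exact h1.of_comp _)
    (by
      rintro x -
      have : x = ∑ i, (F.coordForm i (F.law.ker.ringCon.mk'_surjective x).choose) •
          F.cls (F.g i) := by
        apply F.quotientHom_injective hs
        conv_lhs => rw [← (F.law.ker.ringCon.mk'_surjective x).choose_spec]
        rw [quotientHom_mk', F.groupAlgebraHom_eq_sum]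
        simp only [map_sum, map_smul, quotientHom_cls, algebraMap_smul]
      rw [this]
      exact Submodule.sum_mem _ fun i _ =>
        Submodule.smul_mem _ _ (Submodule.subset_span ⟨i, rfl⟩))

theorem basis_apply
    (hs : HasStableComplements (spanAlgebra ρ : Set (Matrix (Fin n) (Fin n) L)))
    (i : Fin m) : F.basis hs i = F.cls (F.g i) :=
  Module.Basis.mk_apply _ _ _

omit [CharZero L] in
theorem toUnitGroup_val (γ : Γ) :
    Units.val (α := k ⊗[k] F.law.quotientAlgebra) (toUnitGroup F.law γ) = 1 ⊗ₜ F.cls γ := rfl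

instance {k' : Type v} [Field k'] [Algebra k k'] {d : ℕ}
    (D : DeterminantLaw k' (MonoidAlgebra k' Γ) d) : IsScalarTower k k' D.quotientAlgebra :=
  IsScalarTower.of_algebraMap_eq fun _ => rfl

/-- Both quotient algebras embed into M_n(L) compatibly with Γ, so the map exists. Its extension to
k' is injective because the frame's basis is independent even over L. -/
theorem exists_quotientAlgebra_hom
    (hs : HasStableComplements (spanAlgebra ρ : Set (Matrix (Fin n) (Fin n) L)))
    {k' : Type v} [Field k'] [Algebra k k'] [Algebra k' L]
    [IsScalarTower k k' L] {m' : ℕ} (F' : Frame k' ρ m') :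
    ∃ s : F.law.quotientAlgebra →ₐ[k] F'.law.quotientAlgebra, (∀ γ, s (F.cls γ) = F'.cls γ) ∧
      Function.Injective (extendScalars k' s) := by
  let t : MonoidAlgebra k Γ →ₐ[k] F'.law.quotientAlgebra :=
    MonoidAlgebra.lift k _ Γ (F'.law.ker.ringCon.mk'.toMonoidHom.comp (MonoidAlgebra.of k' Γ))
  have ht : ∀ x, F'.quotientHom hs (t x) = groupAlgebraHom k ρ x := fun x => by
    induction x using MonoidAlgebra.induction_linear with
    | zero => simp
    | add p q hp hq => simp only [map_add, hp, hq]
    | single g c =>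
      have : t (MonoidAlgebra.single g c) = c • F'.cls g := MonoidAlgebra.lift_single _ _ _
      rw [this, groupAlgebraHom_single, ← algebraMap_smul k' c, map_smul, quotientHom_cls,
        algebraMap_smul]
  let s : F.law.quotientAlgebra →ₐ[k] F'.law.quotientAlgebra :=
    F.law.ker.ringCon.liftₐ t fun {x y} h => F'.quotientHom_injective hs (by
      change F'.quotientHom hs (t x) = F'.quotientHom hs (t y)
      rw [ht, ht]
      exact (F.ringCon_ker_law_iff hs x y).mp h)
  have hscls : ∀ γ, s (F.cls γ) = F'.cls γ := fun γ =>
    (MonoidAlgebra.lift_single _ _ _).trans (one_smul k _)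
  refine ⟨s, hscls, extendScalars_injective (F.basis hs) s ?_⟩
  have h1 : LinearIndependent k' fun i => (ρ (F.g i)).val :=
    F.linearIndependent.restrict_scalars (by
      intro a b hab
      simpa [Algebra.smul_def] using hab)
  have h2 : (fun i => (ρ (F.g i)).val) =
      (F'.quotientHom hs).toLinearMap ∘ fun i => s (F.basis hs i) := by
    funext i
    simp only [Function.comp_apply, basis_apply, hscls]
    exact (F'.quotientHom_cls hs _).symm
  rw [h2] at h1
  exact h1.of_comp _

theorem extendScalars_quotientHom_injective
    (hs : HasStableComplements (spanAlgebra ρ : Set (Matrix (Fin n) (Fin n) L)))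
    :
    Function.Injective (extendScalars L (F.quotientHom hs)) :=
  extendScalars_injective (F.basis hs) _ (by
    simpa only [basis_apply, quotientHom_cls] using F.linearIndependent)

end Frame

/-! ## Regular functions, charts and closed embeddings -/

namespace GroupFunctor

namespace RegularFunction

variable {k : Type v} [Field k] {G : GroupFunctor.{v, w} k} {H : GroupFunctor.{v, w'} k}

/-- The pullback of a regular function. -/
def comp (f : RegularFunction H) (e : Hom G H) : RegularFunction G where
  toFun A _ _ x := f.toFun A (e.app A x)
  naturality φ x := by rw [e.naturality, f.naturality]

/-- The base change of a regular function. -/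
def baseChange (f : RegularFunction G) {L : Type v} [Field L] (σ : k →+* L) :
    RegularFunction (G.baseChange σ) where
  toFun A _ _ x := letI : Algebra k A := ((algebraMap L A).comp σ).toAlgebra; f.toFun A x
  naturality {A B} _ _ _ _ φ x :=
    letI : Algebra k A := ((algebraMap L A).comp σ).toAlgebra
    letI : Algebra k B := ((algebraMap L B).comp σ).toAlgebra
    f.naturality (restrictAlgHom σ φ) x

/-- A polynomial in regular functions. -/
def polynomial {τ : Type*} (Q : MvPolynomial τ k) (c : τ → RegularFunction G) :
    RegularFunction G where
  toFun A _ _ x := MvPolynomial.aeval (fun i => (c i).toFun A x) Q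
  naturality φ x := by
    simp only [(c _).naturality]
    exact (MvPolynomial.comp_aeval_apply _ φ Q).symm

end RegularFunction

/-- Affine coordinates on a group functor: regular functions that identify it with the zero
locus of an ideal of polynomials. -/
structure Chart {k : Type v} [Field k] (G : GroupFunctor.{v, w} k) (τ : Type v) where
  coord : τ → RegularFunction G
  ideal : Ideal (MvPolynomial τ k)
  injective (A : Type v) [CommRing A] [Algebra k A] {x y : G.obj A}
    (h : ∀ i, (coord i).toFun A x = (coord i).toFun A y) : x = y
  exists_point (A : Type v) [CommRing A] [Algebra k A] (p : τ → A)
    (h : ∀ q ∈ ideal, MvPolynomial.aeval p q = 0) : ∃ x : G.obj A, ∀ i, (coord i).toFun A x = p i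
  aeval_coord (A : Type v) [CommRing A] [Algebra k A] (x : G.obj A)
    {q : MvPolynomial τ k} (hq : q ∈ ideal) :
    MvPolynomial.aeval (fun i => (coord i).toFun A x) q = 0

namespace Chart

variable {k : Type v} [Field k] {G : GroupFunctor.{v, w} k} {τ : Type v} (C : Chart G τ)

theorem exists_universal_point : ∃ x : G.obj (MvPolynomial τ k ⧸ C.ideal),
    ∀ i, (C.coord i).toFun _ x = Ideal.Quotient.mk C.ideal (MvPolynomial.X i) :=
  C.exists_point _ _ fun q hq => by
    have := MvPolynomial.comp_aeval_apply (R := k) MvPolynomial.X (Ideal.Quotient.mkₐ k C.ideal) q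
    rw [MvPolynomial.aeval_X_left_apply] at this
    rw [← Ideal.Quotient.eq_zero_iff_mem] at hq
    exact this.symm.trans hq

/-- The universal point. -/
def point : G.obj (MvPolynomial τ k ⧸ C.ideal) := C.exists_universal_point.choose

theorem coord_point (i : τ) :
    (C.coord i).toFun _ C.point = Ideal.Quotient.mk C.ideal (MvPolynomial.X i) :=
  C.exists_universal_point.choose_spec i

/-- The homomorphism from the coordinate ring attached to a point. -/
def evalPoint {A : Type v} [CommRing A] [Algebra k A] (x : G.obj A) :
    (MvPolynomial τ k ⧸ C.ideal) →ₐ[k] A :=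
  Ideal.Quotient.liftₐ C.ideal (MvPolynomial.aeval fun i => (C.coord i).toFun A x)
    fun _ hq => C.aeval_coord A x hq

theorem evalPoint_mk {A : Type v} [CommRing A] [Algebra k A] (x : G.obj A)
    (q : MvPolynomial τ k) : C.evalPoint x (Ideal.Quotient.mk C.ideal q) =
      MvPolynomial.aeval (fun i => (C.coord i).toFun A x) q := rfl

theorem map_evalPoint {A : Type v} [CommRing A] [Algebra k A] (x : G.obj A) :
    G.map (C.evalPoint x) C.point = x :=
  C.injective A fun i => by
    rw [(C.coord i).naturality, coord_point, evalPoint_mk, MvPolynomial.aeval_X]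

theorem isCoordinateRing : G.IsCoordinateRing (MvPolynomial τ k ⧸ C.ideal) C.point := by
  refine fun A _ _ => ⟨fun φ ψ h => ?_, fun x => ⟨C.evalPoint x, C.map_evalPoint x⟩⟩
  refine Ideal.Quotient.algHom_ext _ (MvPolynomial.algHom_ext fun i => ?_)
  have h' := congrArg ((C.coord i).toFun A) h
  simp only [(C.coord i).naturality, coord_point] at h'
  exact h'

theorem isAffineAlgebraic (C : Chart G τ) [Finite τ] : G.IsAffineAlgebraic :=
  ⟨_, inferInstance, inferInstance, C.point, C.isCoordinateRing, inferInstance⟩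

/-- Yoneda: a regular function is determined by its value at the universal point, and that value
lifts to a polynomial. -/
theorem exists_polynomial (f : RegularFunction G) : ∃ Q : MvPolynomial τ k,
    ∀ (A : Type v) [CommRing A] [Algebra k A] (x : G.obj A),
      f.toFun A x = MvPolynomial.aeval (fun i => (C.coord i).toFun A x) Q := by
  obtain ⟨Q, hQ⟩ := Ideal.Quotient.mk_surjective (f.toFun _ C.point)
  refine ⟨Q, fun A _ _ x => ?_⟩
  conv_lhs => rw [← C.map_evalPoint x, f.naturality, ← hQ]
  rfl

/-- The chart of a base change. -/
def baseChange {L : Type v} [Field L] (σ : k →+* L) : Chart (G.baseChange σ) τ where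
  coord i := (C.coord i).baseChange σ
  ideal := C.ideal.map (MvPolynomial.map σ)
  injective A _ _ {x y} h :=
    letI : Algebra k A := ((algebraMap L A).comp σ).toAlgebra; C.injective A h
  exists_point A _ _ p h := by
    let _ : Algebra k A := ((algebraMap L A).comp σ).toAlgebra
    exact C.exists_point A p fun q hq =>
      (MvPolynomial.eval₂_map σ p (algebraMap L A) q).symm.trans
        (h _ (Ideal.mem_map_of_mem _ hq))
  aeval_coord A _ _ x {q} hq := by
    let _ : Algebra k A := ((algebraMap L A).comp σ).toAlgebra
    have : C.ideal.map (MvPolynomial.map σ) ≤ RingHom.ker (MvPolynomial.aeval (R := L)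
        fun i => ((C.coord i).baseChange σ).toFun A x) := Ideal.map_le_iff_le_comap.mpr fun q hq =>
      (MvPolynomial.eval₂_map σ _ (algebraMap L A) q).trans (C.aeval_coord A x hq)
    exact this hq

/-- The chart of a Zariski closure. -/
def zariskiClosure (Γ : Subgroup (G.obj k)) : Chart (G.zariskiClosure Γ).toGroupFunctor τ where
  coord i := (C.coord i).comp (G.zariskiClosure Γ).incl
  ideal :=
    { carrier := {q | ∀ γ ∈ Γ, MvPolynomial.aeval (fun i => (C.coord i).toFun k γ) q = 0}
      add_mem' := fun ha hb γ hγ => by rw [map_add, ha γ hγ, hb γ hγ, add_zero]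
      zero_mem' := fun _ _ => map_zero _
      smul_mem' := fun c q hq γ hγ => by rw [smul_eq_mul, map_mul, hq γ hγ, mul_zero] }
  injective A _ _ {x y} h := Subtype.ext (C.injective A h)
  -- The equations of G hold on Γ, so they belong to the new ideal and p comes from a point of G. A
  -- regular function vanishing on Γ is a polynomial in that ideal, so it vanishes at this point.
  exists_point A _ _ p h := by
    obtain ⟨x, hx⟩ := C.exists_point A p fun q hq => h q fun γ _ => C.aeval_coord k γ hq
    refine ⟨⟨x, fun f hf => ?_⟩, hx⟩
    obtain ⟨Q, hQ⟩ := C.exists_polynomial f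
    rw [hQ, funext hx]
    exact h Q fun γ hγ => by rw [← hQ, hf γ hγ]
  aeval_coord A _ _ x {q} hq := x.2 (RegularFunction.polynomial q C.coord) hq

end Chart

/-! ### Closed embeddings and their composition -/

section Embedding

variable {k : Type v} [Field k] {G : GroupFunctor.{v, w} k} {H : GroupFunctor.{v, w'} k}
  {J : GroupFunctor.{v, w''} k}

/-- A homomorphism that identifies the source with the zero locus of regular functions on the
target, such that all regular functions extend. -/
structure IsClosedEmbedding (e : Hom G H) : Prop where
  injective (A : Type v) [CommRing A] [Algebra k A] : Function.Injective (e.app A)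
  exists_extension (f : RegularFunction G) : ∃ h : RegularFunction H,
    ∀ (A : Type v) [CommRing A] [Algebra k A] (x : G.obj A), h.toFun A (e.app A x) = f.toFun A x
  mem_range (A : Type v) [CommRing A] [Algebra k A] (y : H.obj A)
    (hy : ∀ z : RegularFunction H, (∀ (B : Type v) [CommRing B] [Algebra k B] (x : G.obj B),
      z.toFun B (e.app B x) = 0) → z.toFun A y = 0) : ∃ x, e.app A x = y

/-- The extension property is what makes closedness compose: equations of G inside H extend to
functions on J. -/
theorem IsClosedEmbedding.comp {e' : Hom H J} {e : Hom G H} (h' : IsClosedEmbedding e')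
    (h : IsClosedEmbedding e) : IsClosedEmbedding (e'.comp e) where
  injective A _ _ := (h'.injective A).comp (h.injective A)
  exists_extension f := by
    obtain ⟨g, hg⟩ := h.exists_extension f
    obtain ⟨g', hg'⟩ := h'.exists_extension g
    exact ⟨g', fun A _ _ x => (hg' A _).trans (hg A x)⟩
  mem_range A _ _ y hy := by
    obtain ⟨y, rfl⟩ := h'.mem_range A y fun z hz => hy z fun B _ _ x => hz B _
    obtain ⟨x, rfl⟩ := h.mem_range A y fun z hz => by
      obtain ⟨g, hg⟩ := h'.exists_extension z
      rw [← hg]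
      exact hy g fun B _ _ x => (hg B _).trans (hz B x)
    exact ⟨x, rfl⟩

/-- The inverse of an isomorphism. -/
def _root_.Monodromy.Iso.symm (e : Iso G H) : Iso H G where
  app A _ _ := (e.app A).symm
  naturality {A B} _ _ _ _ φ x := by
    rw [MulEquiv.symm_apply_eq, e.naturality, MulEquiv.apply_symm_apply]

theorem isClosedEmbedding_iso (e : Iso G H) : IsClosedEmbedding e.toHom where
  injective A _ _ := (e.app A).injective
  exists_extension f := ⟨f.comp e.symm.toHom, fun A _ _ x =>
    congrArg (f.toFun A) ((e.app A).symm_apply_apply x)⟩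
  mem_range A _ _ y _ := (e.app A).surjective y

/-- The ideal is generated by the values at the given point of all regular functions that vanish on
the source. -/
theorem IsClosedEmbedding.isClosedImmersion {e : Hom G H} (h : IsClosedEmbedding e) :
    e.IsClosedImmersion := by
  refine ⟨fun A _ _ => h.injective A, fun A _ _ y => ⟨Ideal.span {a | ∃ z : RegularFunction H,
    (∀ (B : Type v) [CommRing B] [Algebra k B] (x : G.obj B), z.toFun B (e.app B x) = 0) ∧
      z.toFun A y = a}, fun B _ _ φ => ⟨?_, fun hI => ?_⟩⟩⟩
  · rintro ⟨x, hx⟩ a ha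
    have : Ideal.span {a | ∃ z : RegularFunction H, (∀ (B : Type v) [CommRing B] [Algebra k B]
        (x : G.obj B), z.toFun B (e.app B x) = 0) ∧ z.toFun A y = a} ≤ RingHom.ker φ := by
      rw [Ideal.span_le]
      rintro _ ⟨z, hz, rfl⟩
      exact (z.naturality φ y).symm.trans (hx ▸ hz B x)
    exact this ha
  · exact h.mem_range B _ fun z hz => by
      rw [z.naturality]
      exact hI _ (Ideal.subset_span ⟨z, hz, rfl⟩)

theorem isClosedEmbedding_of_chart {τ : Type v} (C : Chart G τ) (e : Hom G H)
    (inj : ∀ (A : Type v) [CommRing A] [Algebra k A], Function.Injective (e.app A))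
    (ext : ∀ i, ∃ h : RegularFunction H, ∀ (A : Type v) [CommRing A] [Algebra k A] (x : G.obj A),
      h.toFun A (e.app A x) = (C.coord i).toFun A x)
    (mem : ∀ (A : Type v) [CommRing A] [Algebra k A] (y : H.obj A),
      (∀ z : RegularFunction H, (∀ (B : Type v) [CommRing B] [Algebra k B] (x : G.obj B),
        z.toFun B (e.app B x) = 0) → z.toFun A y = 0) → ∃ x, e.app A x = y) :
    IsClosedEmbedding e where
  injective := inj
  exists_extension f := by
    obtain ⟨Q, hQ⟩ := C.exists_polynomial f
    choose h hh using ext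
    refine ⟨RegularFunction.polynomial Q h, fun A _ _ x => ?_⟩
    rw [hQ]
    simp only [RegularFunction.polynomial, hh]
  mem_range := mem

theorem isClosedEmbedding_incl {τ : Type v} (C : Chart G τ) (Γ : Subgroup (G.obj k)) :
    IsClosedEmbedding (G.zariskiClosure Γ).incl :=
  isClosedEmbedding_of_chart (C.zariskiClosure Γ) _ (fun _ _ _ => Subtype.val_injective)
    (fun i => ⟨C.coord i, fun _ _ _ _ => rfl⟩)
    fun _ _ _ y hy => ⟨⟨y, fun f hf => hy f fun _ _ _ x => x.2 f hf⟩, rfl⟩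

/-- Points of the base change are still tested by the functions over k that vanish on Γ, base
changed to L. -/
theorem isClosedEmbedding_incl_baseChange {τ : Type v} (C : Chart G τ) (Γ : Subgroup (G.obj k))
    {L : Type v} [Field L] (σ : k →+* L) :
    IsClosedEmbedding ((G.zariskiClosure Γ).incl.baseChange σ) :=
  isClosedEmbedding_of_chart ((C.zariskiClosure Γ).baseChange σ) _
    (fun _ _ _ => Subtype.val_injective)
    (fun i => ⟨(C.coord i).baseChange σ, fun _ _ _ _ => rfl⟩)
    fun _ _ _ y hy => ⟨⟨y, fun f hf => hy (f.baseChange σ) fun _ _ _ x => x.2 f hf⟩, rfl⟩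

end Embedding

/-! ### Dense subgroups of rational points -/

section Dense

variable {k : Type v} [Field k] {G : GroupFunctor.{v, w} k} {H : GroupFunctor.{v, w'} k}
  {Γ : Type u} [Group Γ]

/-- A homomorphism to the `k`-points has dense image if regular functions are determined by their
values on the image. -/
def HasDenseImage (φ : Γ →* G.obj k) : Prop :=
  ∀ f : RegularFunction G, (∀ g, f.toFun k (φ g) = 0) →
    ∀ (A : Type v) [CommRing A] [Algebra k A] (x : G.obj A), f.toFun A x = 0

theorem hasDenseImage_toImageClosure {τ : Type v} (C : Chart G τ) (φ : Γ →* G.obj k) :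
    HasDenseImage (G := G.imageClosure φ) (G.toImageClosure φ) := fun f hf A _ _ x => by
  obtain ⟨h, hh⟩ := (isClosedEmbedding_incl C φ.range).exists_extension f
  refine (hh A x).symm.trans (x.2 h ?_)
  rintro _ ⟨g, rfl⟩
  exact (hh k (G.toImageClosure φ g)).trans (hf g)

/-- An equation over L that holds at k-rational points is an L-combination of equations over k that
hold there. This is why Zariski closure commutes with extension of the field. -/
theorem HasDenseImage.baseChange {τ : Type v} (C : Chart G τ) {φ : Γ →* G.obj k}
    (hφ : HasDenseImage φ) {L : Type v} [Field L] (σ : k →+* L) :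
    HasDenseImage (G := G.baseChange σ) ((G.extendPoint σ).comp φ) := fun f hf A _ _ x => by
  obtain ⟨Q, hQ⟩ := (C.baseChange σ).exists_polynomial f
  rw [hQ]
  let _ : Algebra k L := σ.toAlgebra
  let _ : Algebra k A := ((algebraMap L A).comp σ).toAlgebra
  have : IsScalarTower k L A := IsScalarTower.of_algebraMap_eq fun _ => rfl
  refine aeval_eq_zero_of_forall_rational (k := k)
    (V := Set.range fun g i => (C.coord i).toFun k (φ g)) ?_ fun q hq => ?_
  · rintro _ ⟨g, rfl⟩
    refine Eq.trans ?_ ((hQ L ((G.extendPoint σ).comp φ g)).symm.trans (hf g))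
    congr 2
    funext i
    let _ : Algebra k L := ((algebraMap L L).comp σ).toAlgebra
    exact ((C.coord i).naturality (Algebra.ofId k L) (φ g)).symm
  · exact hφ (RegularFunction.polynomial q C.coord) (fun g => hq _ ⟨g, rfl⟩) A x

theorem HasDenseImage.eq_of_forall {φ : Γ →* G.obj k} (hφ : HasDenseImage φ)
    (f f' : RegularFunction G) (h : ∀ g, f.toFun k (φ g) = f'.toFun k (φ g)) (A : Type v)
    [CommRing A] [Algebra k A] (x : G.obj A) : f.toFun A x = f'.toFun A x := by
  have := hφ ⟨fun A _ _ x => f.toFun A x - f'.toFun A x, fun φ x => by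
    rw [f.naturality, f'.naturality, map_sub]⟩ (fun g => sub_eq_zero.mpr (h g)) A x
  exact sub_eq_zero.mp this

/-- Homomorphisms that agree on a dense subgroup are equal. -/
theorem HasDenseImage.hom_ext {τ : Type v} (C : Chart H τ) {φ : Γ →* G.obj k}
    (hφ : HasDenseImage φ) {e e' : Hom G H} (h : ∀ g, e.app k (φ g) = e'.app k (φ g)) : e = e' := by
  ext A _ _ x
  exact C.injective A fun i => hφ.eq_of_forall ((C.coord i).comp e) ((C.coord i).comp e')
    (fun g => congrArg ((C.coord i).toFun k) (h g)) A x

/-- A closed embedding identifies a group in which `Γ` is dense with the Zariski closure of the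
image of `Γ`. -/
theorem exists_iso_imageClosure {e : Hom G H} (he : IsClosedEmbedding e) {φ : Γ →* G.obj k}
    (hφ : HasDenseImage φ) {ψ : Γ →* H.obj k} (h : ∀ g, e.app k (φ g) = ψ g) :
    ∃ θ : Iso G (H.imageClosure ψ), (H.zariskiClosure ψ.range).incl.comp θ.toHom = e ∧
      ∀ g, θ.app k (φ g) = H.toImageClosure ψ g := by
  have hmem : ∀ (A : Type v) [CommRing A] [Algebra k A] (x : G.obj A),
      e.app A x ∈ (H.zariskiClosure ψ.range).carrier A := fun A _ _ x f hf =>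
    hφ (f.comp e) (fun g => (congrArg (f.toFun k) (h g)).trans (hf _ ⟨g, rfl⟩)) A x
  let m : ∀ (A : Type v) [CommRing A] [Algebra k A], G.obj A →* (H.imageClosure ψ).obj A :=
    fun A _ _ => (e.app A).codRestrict ((H.zariskiClosure ψ.range).carrier A) (hmem A)
  have hbij : ∀ (A : Type v) [CommRing A] [Algebra k A], Function.Bijective (m A) := by
    intro A _ _
    refine ⟨fun x y hxy => he.injective A (congrArg Subtype.val hxy), fun y => ?_⟩
    obtain ⟨x, hx⟩ := he.mem_range A y.1 fun z hz => y.2 z (by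
      rintro _ ⟨g, rfl⟩
      rw [← h]
      exact hz k _)
    exact ⟨x, Subtype.ext hx⟩
  refine ⟨⟨fun A _ _ => MulEquiv.ofBijective (m A) (hbij A), fun φ x =>
    Subtype.ext (e.naturality φ x)⟩, rfl, fun g => Subtype.ext (h g)⟩

end Dense

end GroupFunctor

/-! ## Unit groups -/

section UnitGroup

open GroupFunctor

variable {k : Type v} [Field k] {S : Type u} [Ring S] [Algebra k S]

theorem eq_zero_of_extendForm {R : Type*} [AddCommGroup R] [Module k R] {B : Type*} [CommRing B]
    [Algebra k B] (z : B ⊗[k] R) (h : ∀ c : R →ₗ[k] k, extendForm B c z = 0) : z = 0 := by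
  let b := Module.Basis.ofVectorSpace k R
  apply (b.baseChange B).repr.injective
  ext i
  have key : ∀ w : B ⊗[k] R, (b.baseChange B).repr w i = extendForm B (b.coord i) w := fun w => by
    induction w with
    | zero => simp
    | add x y hx hy => simp only [map_add, Finsupp.add_apply, hx, hy]
    | tmul x y => simp [Algebra.smul_def]
  rw [key, h, map_zero, Finsupp.zero_apply]

theorem sum_extendForm_coord {ι : Type*} [Fintype ι] (b : Module.Basis ι k S) {A : Type*}
    [CommRing A] [Algebra k A] (z : A ⊗[k] S) :
    ∑ i, extendForm A (b.coord i) z ⊗ₜ[k] b i = z := by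
  induction z with
  | zero => simp
  | add x y hx hy =>
    simp only [map_add, TensorProduct.add_tmul, Finset.sum_add_distrib]
    rw [hx, hy]
  | tmul a s =>
    simp only [extendForm_tmul, ← Algebra.smul_def, TensorProduct.smul_tmul]
    rw [← TensorProduct.tmul_sum]
    congr 1
    exact b.sum_repr s

theorem extendForm_map {A B : Type*} [CommRing A] [Algebra k A] [CommRing B] [Algebra k B]
    (φ : A →ₐ[k] B) (c : S →ₗ[k] k) (z : A ⊗[k] S) :
    extendForm B c (Algebra.TensorProduct.map φ (AlgHom.id k S) z) = φ (extendForm A c z) := by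
  rw [← extendForm_rTensor]
  rfl

/-- The regular function on the unit group attached to a linear form. -/
def unitForm (c : S →ₗ[k] k) : RegularFunction (unitGroup k S) where
  toFun A _ _ x := extendForm A c (Units.val (α := A ⊗[k] S) x)
  naturality φ x := extendForm_map φ c (Units.val (α := _ ⊗[k] S) x)

/-- The generic element of `S` with coordinates the variables `f i`. -/
def genericElement {ι τ : Type*} [Fintype ι] (b : Module.Basis ι k S) (f : ι → τ) :
    MvPolynomial τ k ⊗[k] S :=
  ∑ i, MvPolynomial.X (f i) ⊗ₜ b i

theorem map_genericElement {ι τ : Type*} [Fintype ι] (b : Module.Basis ι k S) (f : ι → τ)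
    {A : Type*} [CommRing A] [Algebra k A] (p : τ → A) :
    Algebra.TensorProduct.map (MvPolynomial.aeval p) (AlgHom.id k S) (genericElement b f) =
      ∑ i, p (f i) ⊗ₜ b i := by
  simp [genericElement]

/-- The coordinates of a unit and of its inverse. -/
def unitChart {ι : Type v} [Fintype ι] (b : Module.Basis ι k S) :
    Chart (unitGroup k S) (ι ⊕ ι) where
  coord := Sum.elim (fun i => unitForm (b.coord i)) (fun i => (unitForm (b.coord i)).inv)
  -- The two generic elements are inverse to each other; both orders are imposed because S need not
  -- be commutative.
  ideal := Ideal.span (Set.range fun l => extendForm _ (b.coord l)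
      (genericElement b Sum.inl * genericElement b Sum.inr - 1)) ⊔
    Ideal.span (Set.range fun l => extendForm _ (b.coord l)
      (genericElement b Sum.inr * genericElement b Sum.inl - 1))
  injective A _ _ {x y} h := Units.ext (by
    rw [← sum_extendForm_coord b (Units.val (α := A ⊗[k] S) x),
      ← sum_extendForm_coord b (Units.val (α := A ⊗[k] S) y)]
    exact Finset.sum_congr rfl fun i _ => congrArg (· ⊗ₜ[k] b i) (h (Sum.inl i)))
  exists_point A _ _ p h := by
    have key : ∀ z : MvPolynomial (ι ⊕ ι) k ⊗[k] S,
        (∀ l, MvPolynomial.aeval p (extendForm _ (b.coord l) z) = 0) →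
        Algebra.TensorProduct.map (MvPolynomial.aeval p) (AlgHom.id k S) z = 0 := fun z hz => by
      rw [← sum_extendForm_coord b (Algebra.TensorProduct.map _ _ z)]
      refine Finset.sum_eq_zero fun l _ => ?_
      rw [extendForm_map, hz, TensorProduct.zero_tmul]
    have h1 := key _ fun l => h _ (Ideal.mem_sup_left (Ideal.subset_span ⟨l, rfl⟩))
    have h2 := key _ fun l => h _ (Ideal.mem_sup_right (Ideal.subset_span ⟨l, rfl⟩))
    rw [map_sub, map_mul, map_one, sub_eq_zero] at h1 h2
    have hc : ∀ (f : ι → ι ⊕ ι) (i : ι), extendForm A (b.coord i)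
        (Algebra.TensorProduct.map (MvPolynomial.aeval p) (AlgHom.id k S)
          (genericElement b f)) = p (f i) := fun f i => by
      classical
      rw [map_genericElement, map_sum, Finset.sum_eq_single i]
      · simp
      · intro j _ hj
        simp [Finsupp.single_eq_of_ne hj.symm]
      · simp
    refine ⟨(⟨_, _, h1, h2⟩ : (A ⊗[k] S)ˣ), ?_⟩
    rintro (i | i)
    · exact hc Sum.inl i
    · exact hc Sum.inr i
  aeval_coord A _ _ x {q} hq := by
    let x' : (A ⊗[k] S)ˣ := x
    let p : ι ⊕ ι → A := fun i => (Sum.elim (fun i => unitForm (b.coord i))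
      (fun i => (unitForm (b.coord i)).inv) i : RegularFunction (unitGroup k S)).toFun A x
    have h1 : Algebra.TensorProduct.map (MvPolynomial.aeval p) (AlgHom.id k S)
        (genericElement b Sum.inl) = x'.val := by
      rw [map_genericElement]
      exact sum_extendForm_coord b x'.val
    have h2 : Algebra.TensorProduct.map (MvPolynomial.aeval p) (AlgHom.id k S)
        (genericElement b Sum.inr) = x'⁻¹.val := by
      rw [map_genericElement]
      exact sum_extendForm_coord b x'⁻¹.val
    refine (show _ ≤ RingHom.ker (MvPolynomial.aeval (R := k) p) from
      sup_le (Ideal.span_le.mpr ?_) (Ideal.span_le.mpr ?_)) hq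
    · rintro _ ⟨l, rfl⟩
      change MvPolynomial.aeval p _ = 0
      rw [← extendForm_map, map_sub, map_mul, h1, h2, Units.mul_inv, map_one, sub_self, map_zero]
    · rintro _ ⟨l, rfl⟩
      change MvPolynomial.aeval p _ = 0
      rw [← extendForm_map, map_sub, map_mul, h1, h2, Units.inv_mul, map_one, sub_self, map_zero]

variable {T : Type w} [Ring T] [Algebra k T]

/-- Functoriality of the unit group. -/
def unitGroupMap (s : S →ₐ[k] T) : Hom (unitGroup k S) (unitGroup k T) where
  app A _ _ := Units.map (Algebra.TensorProduct.map (AlgHom.id k A) s).toMonoidHom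
  naturality {A B} _ _ _ _ φ x := Units.ext (by
    change (Algebra.TensorProduct.map (AlgHom.id k B) s) ((Algebra.TensorProduct.map φ _) _) =
      (Algebra.TensorProduct.map φ (AlgHom.id k T)) ((Algebra.TensorProduct.map _ s) _)
    rw [← AlgHom.comp_apply, ← AlgHom.comp_apply, ← Algebra.TensorProduct.map_comp,
      ← Algebra.TensorProduct.map_comp]
    rfl)

/-- With a linear retraction r of s, the element z comes from S as soon as id - s ∘ r kills it. This
is detected by linear forms, and those composed with id - s ∘ r vanish on S. -/
theorem mem_range_of_extendForm {s : S →ₐ[k] T} (hs : Function.Injective s) {A : Type*}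
    [CommRing A] [Algebra k A] (z : A ⊗[k] T)
    (hz : ∀ c : T →ₗ[k] k, c ∘ₗ s.toLinearMap = 0 → extendForm A c z = 0) :
    ∃ x, Algebra.TensorProduct.map (AlgHom.id k A) s x = z := by
  obtain ⟨r, hr⟩ := s.toLinearMap.exists_leftInverse_of_injective (LinearMap.ker_eq_bot.mpr hs)
  refine ⟨r.lTensor A z, ?_⟩
  have h0 : (LinearMap.id - s.toLinearMap ∘ₗ r).lTensor A z = 0 := by
    refine eq_zero_of_extendForm _ fun c => ?_
    rw [extendForm_lTensor]
    refine hz _ ?_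
    rw [LinearMap.comp_assoc, LinearMap.sub_comp, LinearMap.comp_assoc, hr, LinearMap.comp_id,
      LinearMap.id_comp, sub_self, LinearMap.comp_zero]
  rw [LinearMap.lTensor_sub, LinearMap.lTensor_id, LinearMap.sub_apply, LinearMap.lTensor_comp,
    sub_eq_zero] at h0
  exact h0.symm

theorem tensorMap_injective {s : S →ₐ[k] T} (hs : Function.Injective s) (A : Type*)
    [CommRing A] [Algebra k A] :
    Function.Injective (Algebra.TensorProduct.map (AlgHom.id k A) s) :=
  Module.Flat.lTensor_preserves_injective_linearMap (M := A) s.toLinearMap hs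

/-- Membership in S is a system of linear conditions, imposed on a unit of T and on its inverse so
that the preimage is again a unit. The coordinates extend along a linear retraction of T onto S. -/
theorem isClosedEmbedding_unitGroupMap {ι : Type v} [Fintype ι] (b : Module.Basis ι k S)
    {s : S →ₐ[k] T} (hs : Function.Injective s) : IsClosedEmbedding (unitGroupMap s) := by
  refine isClosedEmbedding_of_chart (unitChart b) _
    (fun A _ _ => Units.map_injective (tensorMap_injective hs A)) ?_ ?_
  · obtain ⟨r, hr⟩ := s.toLinearMap.exists_leftInverse_of_injective (LinearMap.ker_eq_bot.mpr hs)
    have key : ∀ (i : ι) (A : Type v) [CommRing A] [Algebra k A] (x : A ⊗[k] S),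
        extendForm A (b.coord i ∘ₗ r) (Algebra.TensorProduct.map (AlgHom.id k A) s x) =
          extendForm A (b.coord i) x := fun i A _ _ x => by
      refine (extendForm_lTensor s.toLinearMap _ x).trans ?_
      rw [LinearMap.comp_assoc, hr, LinearMap.comp_id]
    rintro (i | i)
    · exact ⟨unitForm (b.coord i ∘ₗ r), fun A _ _ x => key i A (Units.val (α := A ⊗[k] S) x)⟩
    · exact ⟨(unitForm (b.coord i ∘ₗ r)).inv, fun A _ _ x =>
        (congrArg ((unitForm (b.coord i ∘ₗ r)).toFun A) (map_inv _ x).symm).trans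
          (key i A (Units.val (α := A ⊗[k] S) x⁻¹))⟩
  · intro A _ _ y hy
    let y' : (A ⊗[k] T)ˣ := y
    have key : ∀ (B : Type v) [CommRing B] [Algebra k B] (c : T →ₗ[k] k) (x : B ⊗[k] S),
        c ∘ₗ s.toLinearMap = 0 →
        extendForm B c (Algebra.TensorProduct.map (AlgHom.id k B) s x) = 0 :=
      fun B _ _ c x hc => by
        refine (extendForm_lTensor s.toLinearMap _ x).trans ?_
        rw [hc]
        exact LinearMap.congr_fun (show extendForm B (0 : S →ₗ[k] k) = 0 by ext; simp) x
    obtain ⟨x, hx⟩ := mem_range_of_extendForm hs y'.val fun c hc =>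
      hy (unitForm c) fun B _ _ x => key B c (Units.val (α := B ⊗[k] S) x) hc
    obtain ⟨x', hx'⟩ := mem_range_of_extendForm hs y'⁻¹.val fun c hc =>
      hy (unitForm c).inv fun B _ _ x =>
        (congrArg ((unitForm c).toFun B) (map_inv _ x).symm).trans
          (key B c (Units.val (α := B ⊗[k] S) x⁻¹) hc)
    refine ⟨(⟨x, x', tensorMap_injective hs A ?_, tensorMap_injective hs A ?_⟩ : (A ⊗[k] S)ˣ),
      Units.ext hx⟩
    · rw [map_mul, hx, hx', Units.mul_inv, map_one]
    · rw [map_mul, hx, hx', Units.inv_mul, map_one]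

/-- The unit group of a matrix algebra is the general linear group. -/
def unitGroupMatrixIso (k : Type v) [Field k] (n : ℕ) :
    Iso (unitGroup k (Matrix (Fin n) (Fin n) k)) (GLn k n) where
  app A _ _ := Units.mapEquiv (matrixEquivTensor (Fin n) k A).symm.toRingEquiv.toMulEquiv
  naturality {A B} _ _ _ _ φ x := Units.ext (by
    change (matrixEquivTensor (Fin n) k B).symm (Algebra.TensorProduct.map φ (AlgHom.id k _) _) =
      ((matrixEquivTensor (Fin n) k A).symm _).map φ
    generalize Units.val (α := A ⊗[k] Matrix (Fin n) (Fin n) k) x = z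
    induction z with
    | zero => ext; simp
    | add x y hx hy =>
      rw [map_add, map_add, hx, hy, map_add]
      ext
      simp
    | tmul a M => ext; simp)

/-- Transitivity of base change, for algebras that need not be commutative. -/
def tensorTransEquiv (k L : Type v) [Field k] [Field L] [Algebra k L] (A : Type v) [CommRing A]
    [Algebra k A] [Algebra L A] [IsScalarTower k L A] (S : Type u) [Ring S] [Algebra k S] :
    A ⊗[k] S ≃ₐ[k] A ⊗[L] (L ⊗[k] S) :=
  AlgEquiv.ofLinearEquiv
    ((TensorProduct.AlgebraTensorModule.cancelBaseChange k L A A S).symm.restrictScalars k)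
    (by simp [Algebra.TensorProduct.one_def])
    (LinearMap.map_mul_of_map_mul_tmul fun _ _ _ _ => by simp)

/-- Base change of unit groups. -/
def unitGroupBaseChangeIso (k L : Type v) [Field k] [Field L] [Algebra k L] (S : Type u) [Ring S]
    [Algebra k S] :
    Iso ((unitGroup k S).baseChange (algebraMap k L)) (unitGroup L (L ⊗[k] S)) where
  app A _ _ :=
    letI : Algebra k A := ((algebraMap L A).comp (algebraMap k L)).toAlgebra
    haveI : IsScalarTower k L A := IsScalarTower.of_algebraMap_eq fun _ => rfl
    Units.mapEquiv (tensorTransEquiv k L A S).toRingEquiv.toMulEquiv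
  naturality {A B} _ _ _ _ φ x := by
    let _ : Algebra k A := ((algebraMap L A).comp (algebraMap k L)).toAlgebra
    have : IsScalarTower k L A := IsScalarTower.of_algebraMap_eq fun _ => rfl
    let _ : Algebra k B := ((algebraMap L B).comp (algebraMap k L)).toAlgebra
    have : IsScalarTower k L B := IsScalarTower.of_algebraMap_eq fun _ => rfl
    refine Units.ext ?_
    change tensorTransEquiv k L B S
      (Algebra.TensorProduct.map (restrictAlgHom (algebraMap k L) φ) (AlgHom.id k S) _) =
      Algebra.TensorProduct.map φ (AlgHom.id L _)
        (tensorTransEquiv k L A S _)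
    generalize Units.val (α := A ⊗[k] S) x = z
    induction z with
    | zero => simp
    | add x y hx hy => simp only [map_add, hx, hy]
    | tmul a s => rfl

/-- The k-structure on A is left arbitrary so that the composite structure built into `extendPoint`
can be supplied explicitly. -/
theorem tensorTransEquiv_map {k L : Type v} [Field k] [Field L] [Algebra k L] {A : Type v}
    [CommRing A] [Algebra k A] [Algebra L A] [IsScalarTower k L A] {S : Type u} [Ring S]
    [Algebra k S] (z : k ⊗[k] S) (a : S) (hz : z = 1 ⊗ₜ a) :
    tensorTransEquiv k L A S (Algebra.TensorProduct.map (Algebra.ofId k A) (AlgHom.id k S) z) =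
      1 ⊗ₜ (1 ⊗ₜ a) := by
  rw [hz, Algebra.TensorProduct.map_tmul, map_one]
  rfl

theorem unitGroupBaseChangeIso_extendPoint {L : Type v} [Field L] [Algebra k L]
    (x : (unitGroup k S).obj k) (a : S) (hx : Units.val (α := k ⊗[k] S) x = 1 ⊗ₜ a) :
    Units.val (α := L ⊗[L] (L ⊗[k] S)) ((unitGroupBaseChangeIso k L S).app L
      ((unitGroup k S).extendPoint (algebraMap k L) x)) = 1 ⊗ₜ (1 ⊗ₜ a) :=
  @tensorTransEquiv_map k L _ _ _ L _ ((algebraMap L L).comp (algebraMap k L)).toAlgebra _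
    (@IsScalarTower.of_algebraMap_eq k L L _ _ _ _ _
      ((algebraMap L L).comp (algebraMap k L)).toAlgebra fun _ => rfl) S _ _ _ a hx

theorem exists_closedEmbedding_baseChange {L : Type v} [Field L] [Algebra k L] {ι : Type v}
    [Fintype ι] (b : Module.Basis ι k S) [Algebra L T] [IsScalarTower k L T] (s : S →ₐ[k] T)
    (hs : Function.Injective (extendScalars L s)) :
    ∃ e : Hom ((unitGroup k S).baseChange (algebraMap k L)) (unitGroup L T),
      IsClosedEmbedding e ∧ ∀ (x : (unitGroup k S).obj k) (a : S),
        Units.val (α := k ⊗[k] S) x = 1 ⊗ₜ a →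
        Units.val (α := L ⊗[L] T) (e.app L ((unitGroup k S).extendPoint (algebraMap k L) x)) =
          1 ⊗ₜ s a := by
  refine ⟨(unitGroupMap (extendScalars L s)).comp (unitGroupBaseChangeIso k L S).toHom,
    (isClosedEmbedding_unitGroupMap (b.baseChange L) hs).comp (isClosedEmbedding_iso _),
    fun x a hx => ?_⟩
  change Algebra.TensorProduct.map (AlgHom.id L L) (extendScalars L s)
    (Units.val (α := L ⊗[L] (L ⊗[k] S)) ((unitGroupBaseChangeIso k L S).app L
      ((unitGroup k S).extendPoint (algebraMap k L) x))) = _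
  rw [unitGroupBaseChangeIso_extendPoint x a hx, Algebra.TensorProduct.map_tmul,
    extendScalars_tmul, one_smul]
  rfl

theorem unitGroupMatrixIso_apply {n : ℕ} (x : (unitGroup k (Matrix (Fin n) (Fin n) k)).obj k)
    (M : Matrix (Fin n) (Fin n) k)
    (hx : Units.val (α := k ⊗[k] Matrix (Fin n) (Fin n) k) x = 1 ⊗ₜ M) :
    Units.val (α := Matrix (Fin n) (Fin n) k) ((unitGroupMatrixIso k n).app k x) = M := by
  change (matrixEquivTensor (Fin n) k k).symm (Units.val (α := k ⊗[k] _) x) = M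
  rw [hx]
  ext
  simp

end UnitGroup

/-! ## Constant groups -/

/-- A family of orthogonal elements with sum `1`. -/
@[ext]
structure IdempotentPartition (P : Type u) [Fintype P] (A : Type v) [CommRing A] where
  coeff : P → A
  mul_eq_zero : ∀ i j, i ≠ j → coeff i * coeff j = 0
  sum_eq_one : ∑ i, coeff i = 1

namespace IdempotentPartition

section

variable {P : Type u} [Fintype P] {A : Type v} [CommRing A] {B : Type w} [CommRing B]

theorem mul_self (a : IdempotentPartition P A) (i : P) : a.coeff i * a.coeff i = a.coeff i := by
  conv_rhs => rw [← mul_one (a.coeff i), ← a.sum_eq_one, Finset.mul_sum]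
  rw [Finset.sum_eq_single i (fun l _ hl => a.mul_eq_zero _ _ hl.symm) (by simp)]

open Classical in
/-- The family supported on one index. -/
def single (A : Type v) [CommRing A] (i : P) : IdempotentPartition P A where
  coeff := Pi.single i 1
  mul_eq_zero l j hij := by
    by_cases hi : l = i
    · rw [Pi.single_eq_of_ne (fun h => hij (hi.trans h.symm)), mul_zero]
    · rw [Pi.single_eq_of_ne hi, zero_mul]
  sum_eq_one := by simp

theorem single_same (i : P) : (single A i).coeff i = 1 := by
  simp [single]

theorem single_ne {i j : P} (h : j ≠ i) : (single A i).coeff j = 0 := by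
  simp [single, h]

/-- The image of an orthogonal family. -/
def map (φ : A →+* B) (a : IdempotentPartition P A) : IdempotentPartition P B where
  coeff i := φ (a.coeff i)
  mul_eq_zero i j hij := by rw [← map_mul, a.mul_eq_zero i j hij, map_zero]
  sum_eq_one := by rw [← map_sum, a.sum_eq_one, map_one]

theorem map_single (φ : A →+* B) (i : P) : map φ (single A i) = single B i := by
  ext j
  change φ _ = _
  by_cases hj : j = i
  · rw [hj, single_same, single_same, map_one]
  · rw [single_ne hj, single_ne hj, map_zero]

theorem exists_eq_single {K : Type v} [Field K] (a : IdempotentPartition P K) :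
    ∃ i, single K i = a := by
  obtain ⟨i, hi⟩ : ∃ i, a.coeff i ≠ 0 := by
    by_contra! h
    exact zero_ne_one ((Finset.sum_eq_zero fun i _ => h i).symm.trans a.sum_eq_one)
  have h0 : ∀ j, j ≠ i → a.coeff j = 0 := fun j hj =>
    (_root_.mul_eq_zero.mp (a.mul_eq_zero i j hj.symm)).resolve_left hi
  refine ⟨i, IdempotentPartition.ext (funext fun j => ?_)⟩
  by_cases hj : j = i
  · subst hj
    rw [single_same, ← a.sum_eq_one, Finset.sum_eq_single j (fun l _ hl => h0 l hl) (by simp)]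
  · rw [h0 j hj, single_ne hj]

theorem single_injective [Nontrivial A] :
    Function.Injective (single A : P → IdempotentPartition P A) := fun i j h => by
  by_contra hij
  have h1 : (single A j).coeff i = 1 := h ▸ single_same i
  rw [single_ne hij] at h1
  exact zero_ne_one h1

end

variable {P : Type u} [Group P] [Fintype P] {A : Type v} [CommRing A] {B : Type w} [CommRing B]

/-- A partition is a locally constant function from Spec A to P, its coefficients being the
indicators of the fibres. Pointwise multiplication of such functions is convolution of the
coefficients. -/
instance : Mul (IdempotentPartition P A) :=
  ⟨fun a b =>
    { coeff := fun i => ∑ j, a.coeff j * b.coeff (j⁻¹ * i)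
      mul_eq_zero := fun i i' hi => by
        rw [Finset.sum_mul_sum]
        refine Finset.sum_eq_zero fun j _ => Finset.sum_eq_zero fun j' _ => ?_
        by_cases hj : j = j'
        · subst hj
          rw [mul_mul_mul_comm, b.mul_eq_zero _ _ fun h => hi (mul_left_cancel h), mul_zero]
        · rw [mul_mul_mul_comm, a.mul_eq_zero _ _ hj, zero_mul]
      sum_eq_one := by
        rw [Finset.sum_comm]
        refine Eq.trans (Finset.sum_congr rfl fun j _ => ?_) a.sum_eq_one
        rw [← Finset.mul_sum]
        exact (congrArg _ ((Equiv.sum_comp (Equiv.mulLeft j⁻¹) b.coeff).trans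
          b.sum_eq_one)).trans (mul_one _) }⟩

theorem coeff_mul (a b : IdempotentPartition P A) (i : P) :
    (a * b).coeff i = ∑ j, a.coeff j * b.coeff (j⁻¹ * i) := rfl

instance : One (IdempotentPartition P A) := ⟨single A 1⟩

instance : Inv (IdempotentPartition P A) :=
  ⟨fun a =>
    { coeff := fun i => a.coeff i⁻¹
      mul_eq_zero := fun _ _ hij => a.mul_eq_zero _ _ fun h => hij (inv_injective h)
      sum_eq_one := (Equiv.sum_comp (Equiv.inv P) a.coeff).trans a.sum_eq_one }⟩

theorem single_mul (i : P) (a : IdempotentPartition P A) (l : P) :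
    (single A i * a).coeff l = a.coeff (i⁻¹ * l) := by
  rw [coeff_mul, Finset.sum_eq_single i (fun m _ hm => by rw [single_ne hm, zero_mul]) (by simp),
    single_same, one_mul]

instance : Group (IdempotentPartition P A) :=
  Group.ofLeftAxioms
    (fun a b c => IdempotentPartition.ext <| funext fun i => by
      simp only [coeff_mul, Finset.sum_mul, Finset.mul_sum]
      rw [Finset.sum_comm]
      refine Finset.sum_congr rfl fun j _ => ?_
      rw [← Equiv.sum_comp (Equiv.mulLeft j)]
      refine Finset.sum_congr rfl fun l _ => ?_
      simp [mul_assoc])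
    (fun a => IdempotentPartition.ext <| funext fun i => by
      refine (single_mul 1 a i).trans ?_
      rw [inv_one, one_mul])
    (fun a => IdempotentPartition.ext <| funext fun i => by
      change ∑ j, a.coeff j⁻¹ * a.coeff (j⁻¹ * i) = (single A 1).coeff i
      by_cases hi : i = 1
      · subst hi
        rw [single_same, ← a.sum_eq_one, ← Equiv.sum_comp (Equiv.inv P) a.coeff]
        exact Finset.sum_congr rfl fun j _ => by rw [mul_one, a.mul_self, Equiv.inv_apply]
      · rw [single_ne hi]
        exact Finset.sum_eq_zero fun j _ => a.mul_eq_zero _ _ fun h => hi (mul_eq_left.mp h.symm))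

theorem single_mul_single (i j : P) : single A i * single A j = single A (i * j) := by
  ext l
  rw [single_mul]
  by_cases hl : l = i * j
  · rw [hl, single_same, inv_mul_cancel_left, single_same]
  · rw [single_ne hl, single_ne fun h => hl (by rw [← h, mul_inv_cancel_left])]

/-- The image of orthogonal families is compatible with the group structure. -/
def mapHom (φ : A →+* B) : IdempotentPartition P A →* IdempotentPartition P B :=
  MonoidHom.mk' (map φ) fun a b => IdempotentPartition.ext <| funext fun i => by
    rw [coeff_mul]
    exact (map_sum φ _ _).trans (Finset.sum_congr rfl fun j _ => map_mul φ _ _)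

end IdempotentPartition

/-- The constant group functor attached to a finite group `P`. -/
def constGroup (k : Type v) [Field k] (P : Type v) [Group P] [Fintype P] :
    GroupFunctor.{v, v} k where
  obj A _ _ := IdempotentPartition P A
  map φ := IdempotentPartition.mapHom φ.toRingHom
  map_id _ _ _ _ := rfl
  map_comp _ _ _ := rfl

section ConstGroup

open GroupFunctor IdempotentPartition

variable {k : Type v} [Field k] {P : Type v} [Group P] [Fintype P]

/-- The constant points. -/
def constHom (k : Type v) [Field k] (P : Type v) [Group P] [Fintype P] :
    P →* (constGroup k P).obj k :=
  MonoidHom.mk' (single k : P → IdempotentPartition P k) fun i j => (single_mul_single i j).symm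

/-- A partition over a field is supported on one index. Hence the constant group has the same points
over k and over L. -/
theorem constHom_bijective : Function.Bijective (constHom k P) :=
  ⟨single_injective, exists_eq_single⟩

/-- The homomorphism from the algebra of functions on the group attached to a point. -/
def constEval {A : Type v} [CommRing A] [Algebra k A] (a : IdempotentPartition P A) :
    (P → k) →ₐ[k] A :=
  AlgHom.ofLinearMap (∑ i, (LinearMap.toSpanSingleton k A (a.coeff i)) ∘ₗ LinearMap.proj i)
    (by simpa using a.sum_eq_one)
    (fun x y => by
      simp only [LinearMap.sum_apply, LinearMap.comp_apply, LinearMap.proj_apply,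
        LinearMap.toSpanSingleton_apply, Pi.mul_apply, Finset.sum_mul_sum]
      refine Finset.sum_congr rfl fun i _ => ?_
      have h : ∀ j ∈ Finset.univ, j ≠ i → x i • a.coeff i * y j • a.coeff j = 0 := fun j _ hj => by
        rw [smul_mul_smul_comm, a.mul_eq_zero i j hj.symm, smul_zero]
      rw [Finset.sum_eq_single i h (by simp), smul_mul_smul_comm, a.mul_self])

omit [Group P] in
theorem constEval_apply {A : Type v} [CommRing A] [Algebra k A] (a : IdempotentPartition P A)
    (x : P → k) : constEval a x = ∑ i, x i • a.coeff i := by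
  change (∑ i, (LinearMap.toSpanSingleton k A (a.coeff i)) ∘ₗ LinearMap.proj i) x = _
  simp

omit [Group P] in
theorem constEval_map {A B : Type v} [CommRing A] [Algebra k A] [CommRing B] [Algebra k B]
    (φ : A →ₐ[k] B) (a : IdempotentPartition P A) :
    constEval (a.map φ.toRingHom) = φ.comp (constEval (k := k) a) := by
  ext x
  rw [constEval_apply, AlgHom.comp_apply, constEval_apply, map_sum]
  exact Finset.sum_congr rfl fun i _ => (map_smul φ _ _).symm

omit [Group P] in
theorem constEval_single (i : P) : constEval (single k i) = Pi.evalAlgHom k _ i := by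
  refine AlgHom.ext fun x => ?_
  rw [constEval_apply, Finset.sum_eq_single i
    (fun j _ hj => by rw [single_ne hj, smul_zero]) (by simp), single_same, smul_eq_mul,
    mul_one]
  rfl

/-- The universal point. -/
def constUniv (k : Type v) [Field k] (P : Type v) [Group P] [Fintype P] :
    IdempotentPartition P (P → k) where
  coeff i l := (single k l).coeff i
  mul_eq_zero i j hij := funext fun l => (single k l).mul_eq_zero i j hij
  sum_eq_one := funext fun l => (Finset.sum_apply _ _ _).trans (single k l).sum_eq_one

theorem map_constEval {A : Type v} [CommRing A] [Algebra k A] (a : IdempotentPartition P A) :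
    (constUniv k P).map (constEval a).toRingHom = a := by
  ext i
  change constEval a _ = _
  rw [constEval_apply, Finset.sum_eq_single i (fun j _ hj => ?_) (by simp)]
  · change (single k i).coeff i • _ = _
    rw [single_same, one_smul]
  · change (single k j).coeff i • _ = _
    rw [single_ne hj.symm, zero_smul]

theorem isCoordinateRing_constGroup :
    (constGroup k P).IsCoordinateRing (P → k) (constUniv k P) := by
  refine fun A _ _ => ⟨fun φ ψ h => ?_, fun a => ⟨constEval a, map_constEval a⟩⟩
  have key : ∀ χ : (P → k) →ₐ[k] A, χ = constEval ((constUniv k P).map χ.toRingHom) :=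
    fun χ => by
      rw [constEval_map]
      refine AlgHom.ext fun x => ?_
      rw [AlgHom.comp_apply]
      congr 1
      rw [constEval_apply]
      funext j
      rw [Finset.sum_apply, Finset.sum_eq_single j (fun l _ hl => ?_) (by simp)]
      · change _ = x j • (single k j).coeff j
        rw [single_same, smul_eq_mul, mul_one]
      · change x l • (single k j).coeff l = 0
        rw [single_ne hl, smul_zero]
  have h' : (constUniv k P).map φ.toRingHom = (constUniv k P).map ψ.toRingHom := h
  rw [key φ, key ψ, h']

theorem isEtale_constGroup : (constGroup k P).IsEtale :=
  ⟨P → k, inferInstance, inferInstance, constUniv k P, isCoordinateRing_constGroup, inferInstance⟩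

theorem hasDenseImage_constHom : HasDenseImage (constHom k P) := fun f hf A _ _ a => by
  have h1 : f.toFun _ (constUniv k P) = 0 := funext fun i => by
    refine (f.naturality (Pi.evalAlgHom k _ i) (constUniv k P)).symm.trans ?_
    rw [← constEval_single]
    exact (congrArg (f.toFun k) (map_constEval (single k i))).trans (hf i)
  have h2 : (constGroup k P).map (constEval a) (constUniv k P) = a := map_constEval a
  exact (congrArg (f.toFun A) h2).symm.trans ((f.naturality _ _).trans (by rw [h1, map_zero]))

end ConstGroup

/-! ## Component groups -/

namespace GroupFunctor

section CoordinateRing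

variable {k : Type v} [Field k] {G : GroupFunctor.{v, w} k} {R : Type v} [CommRing R] [Algebra k R]
  {x : G.obj R}

/-- The homomorphism from the coordinate ring attached to a point. -/
def IsCoordinateRing.hom (h : G.IsCoordinateRing R x) {A : Type v} [CommRing A] [Algebra k A]
    (y : G.obj A) : R →ₐ[k] A :=
  ((h A).2 y).choose

theorem IsCoordinateRing.map_hom (h : G.IsCoordinateRing R x) {A : Type v} [CommRing A]
    [Algebra k A] (y : G.obj A) : G.map (h.hom y) x = y :=
  ((h A).2 y).choose_spec

theorem IsCoordinateRing.hom_map (h : G.IsCoordinateRing R x) {A B : Type v} [CommRing A]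
    [Algebra k A] [CommRing B] [Algebra k B] (φ : A →ₐ[k] B) (y : G.obj A) :
    h.hom (G.map φ y) = φ.comp (h.hom y) :=
  (h B).1 <| by
    change G.map _ x = G.map _ x
    rw [h.map_hom, G.map_comp, h.map_hom]

/-- The regular function given by an element of the coordinate ring. -/
def IsCoordinateRing.function (h : G.IsCoordinateRing R x) (r : R) : RegularFunction G where
  toFun A _ _ y := h.hom y r
  naturality φ y := by rw [h.hom_map]; rfl

/-- All elements of the coordinate ring form a chart. -/
def IsCoordinateRing.chart (h : G.IsCoordinateRing R x) : Chart G R where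
  coord := h.function
  ideal := RingHom.ker (MvPolynomial.aeval (R := k) (id : R → R))
  injective A _ _ {y z} hyz := by
    rw [← h.map_hom y, ← h.map_hom z, AlgHom.ext hyz]
  exists_point A _ _ p hp := by
    have hs : Function.Surjective (MvPolynomial.aeval (R := k) (id : R → R)) := fun r =>
      ⟨MvPolynomial.X r, MvPolynomial.aeval_X _ _⟩
    let ψ : R →ₐ[k] A := (Ideal.Quotient.liftₐ (RingHom.ker (MvPolynomial.aeval (R := k)
      (id : R → R))) (MvPolynomial.aeval p) hp).comp
        (Ideal.quotientKerAlgEquivOfSurjective hs).symm.toAlgHom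
    refine ⟨G.map ψ x, fun r => ?_⟩
    have h1 : h.hom (G.map ψ x) = ψ := (h A).1 (h.map_hom _)
    change h.hom (G.map ψ x) r = _
    rw [h1]
    have h2 : (Ideal.quotientKerAlgEquivOfSurjective hs).symm r =
        Ideal.Quotient.mk _ (MvPolynomial.X r) := by
      rw [AlgEquiv.symm_apply_eq]
      exact (MvPolynomial.aeval_X (R := k) (id : R → R) r).symm
    change Ideal.Quotient.liftₐ (RingHom.ker (MvPolynomial.aeval (R := k) (id : R → R)))
      (MvPolynomial.aeval p) hp ((Ideal.quotientKerAlgEquivOfSurjective hs).symm r) = _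
    rw [h2]
    exact MvPolynomial.aeval_X (R := k) p r
  aeval_coord A _ _ y {q} hq := by
    have : MvPolynomial.aeval (fun i => h.hom y i) q = h.hom y (MvPolynomial.aeval id q) :=
      (MvPolynomial.comp_aeval_apply (R := k) (id : R → R) (h.hom y) q).symm
    exact this.trans (by rw [show MvPolynomial.aeval id q = 0 from hq, map_zero])

end CoordinateRing

/-! ### Extending identities and homomorphisms from a dense subgroup -/

section Multiplicative

variable {k : Type v} [Field k] {G : GroupFunctor.{v, w} k} {H : GroupFunctor.{v, w'} k}
  {Γ : Type u} [Group Γ]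

/-- A regular function in two variables that vanishes on a dense set of pairs vanishes. -/
theorem HasDenseImage.eq_zero_of_forall_pair {φ : Γ →* G.obj k} (hφ : HasDenseImage φ)
    (F : ∀ (A : Type v) [CommRing A] [Algebra k A], G.obj A → G.obj A → A)
    (hF : ∀ {A B : Type v} [CommRing A] [Algebra k A] [CommRing B] [Algebra k B] (ψ : A →ₐ[k] B)
      (x y : G.obj A), F B (G.map ψ x) (G.map ψ y) = ψ (F A x y))
    (h : ∀ g g', F k (φ g) (φ g') = 0) (A : Type v) [CommRing A] [Algebra k A] (x y : G.obj A) :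
    F A x y = 0 := by
  have h1 : ∀ (g : Γ) (A : Type v) [CommRing A] [Algebra k A] (y : G.obj A),
      F A (G.map (Algebra.ofId k A) (φ g)) y = 0 := fun g =>
    hφ ⟨fun A _ _ y => F A (G.map (Algebra.ofId k A) (φ g)) y, fun {A B} _ _ _ _ ψ y => by
      have : ψ.comp (Algebra.ofId k A) = Algebra.ofId k B := Subsingleton.elim _ _
      rw [← hF, ← G.map_comp, this]⟩ fun g' => by
      have : Algebra.ofId k k = AlgHom.id k k := Subsingleton.elim _ _
      change F k (G.map (Algebra.ofId k k) (φ g)) (φ g') = 0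
      rw [this, G.map_id, h]
  -- Over A ⊗ A the two variables live in separate factors. Slicing by linear forms on the first
  -- factor leaves a regular function of x alone, which vanishes on Γ by the case already treated;
  -- multiplication A ⊗ A → A then returns to A.
  have h2 : F (A ⊗[k] A) (G.map Algebra.TensorProduct.includeRight x)
      (G.map Algebra.TensorProduct.includeLeft y) = 0 := by
    refine eq_zero_of_forall_rTensor _ fun c => hφ ⟨fun B _ _ x =>
      TensorProduct.lid k B (c.rTensor B (F (A ⊗[k] B) (G.map Algebra.TensorProduct.includeRight x)
        (G.map Algebra.TensorProduct.includeLeft y))), fun {B C} _ _ _ _ ψ x => ?_⟩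
      (fun g => ?_) A x
    · have e1 : (Algebra.TensorProduct.includeRight : C →ₐ[k] A ⊗[k] C).comp ψ =
          (Algebra.TensorProduct.map (AlgHom.id k A) ψ).comp
            Algebra.TensorProduct.includeRight := by ext; simp
      have e2 : (Algebra.TensorProduct.includeLeft : A →ₐ[k] A ⊗[k] C) =
          (Algebra.TensorProduct.map (AlgHom.id k A) ψ).comp
            Algebra.TensorProduct.includeLeft := by ext; simp
      rw [← G.map_comp, e1, e2, G.map_comp, G.map_comp, hF]
      generalize F (A ⊗[k] B) _ _ = z
      induction z with
      | zero => simp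
      | tmul a b => simp
      | add a b ha hb => simp only [map_add, ha, hb]
    · have e : (Algebra.TensorProduct.includeRight : k →ₐ[k] A ⊗[k] k) =
          (Algebra.TensorProduct.includeLeft : A →ₐ[k] A ⊗[k] k).comp (Algebra.ofId k A) :=
        Subsingleton.elim _ _
      change TensorProduct.lid k k (c.rTensor k (F (A ⊗[k] k)
        (G.map Algebra.TensorProduct.includeRight (φ g)) _)) = 0
      rw [e, G.map_comp, hF, h1, map_zero, map_zero, map_zero]
  have h3 := hF (Algebra.TensorProduct.lmul' k (S := A))
    (G.map Algebra.TensorProduct.includeRight x) (G.map Algebra.TensorProduct.includeLeft y)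
  rw [h2, map_zero, ← G.map_comp, ← G.map_comp, Algebra.TensorProduct.lmul'_comp_includeRight,
    Algebra.TensorProduct.lmul'_comp_includeLeft, G.map_id, G.map_id] at h3
  exact h3

/-- A natural family of maps that is multiplicative on a dense subgroup is a homomorphism. -/
theorem HasDenseImage.exists_hom {φ : Γ →* G.obj k} (hφ : HasDenseImage φ) {τ : Type v}
    (C : Chart H τ) (m : ∀ (A : Type v) [CommRing A] [Algebra k A], G.obj A → H.obj A)
    (hm : ∀ {A B : Type v} [CommRing A] [Algebra k A] [CommRing B] [Algebra k B] (ψ : A →ₐ[k] B)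
      (x : G.obj A), m B (G.map ψ x) = H.map ψ (m A x))
    (h : ∀ g g', m k (φ g * φ g') = m k (φ g) * m k (φ g')) :
    ∃ e : Hom G H, ∀ (A : Type v) [CommRing A] [Algebra k A] (x : G.obj A), e.app A x = m A x :=
  ⟨⟨fun A _ _ => MonoidHom.mk' (m A) fun x y => C.injective A fun i => sub_eq_zero.mp <|
      hφ.eq_zero_of_forall_pair (fun A _ _ x y =>
        (C.coord i).toFun A (m A (x * y)) - (C.coord i).toFun A (m A x * m A y))
        (fun ψ x y => by
          rw [map_sub, ← (C.coord i).naturality, ← (C.coord i).naturality, map_mul, ← hm, ← hm,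
            ← hm, map_mul])
        (fun g g' => sub_eq_zero.mpr (congrArg _ (h g g'))) A x y,
    fun ψ x => hm ψ x⟩, fun _ _ _ _ => rfl⟩

end Multiplicative

/-! ### The universal étale quotient as a constant group -/

section Components

variable {k : Type v} [Field k] {G : GroupFunctor.{v, w} k} {H : GroupFunctor.{v, w'} k}
  {Γ : Type u} [Group Γ]
  {P : Type v} [Group P] [Fintype P]

/-- The fibres of `c : Γ → P` are cut out by regular functions, and idempotent regular functions
are constant on them. -/
structure SeparatesComponents (φ : Γ →* G.obj k) (c : Γ →* P) : Prop where
  surjective : Function.Surjective c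
  exists_indicator (i : P) : ∃ f : RegularFunction G, ∀ g,
    f.toFun k (φ g) = (IdempotentPartition.single k (c g)).coeff i
  eq_of_idempotent (f : RegularFunction G)
    (hf : ∀ g, f.toFun k (φ g) * f.toFun k (φ g) = f.toFun k (φ g)) {g g' : Γ} (h : c g = c g') :
    f.toFun k (φ g) = f.toFun k (φ g')

namespace SeparatesComponents

variable {φ : Γ →* G.obj k} {c : Γ →* P}

/-- The indicators of the fibres are orthogonal with sum 1 on Γ, hence everywhere by density, so
they define points of the constant group. -/
theorem exists_hom (h : SeparatesComponents φ c) (hφ : HasDenseImage φ) :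
    ∃ p : Hom G (constGroup k P), ∀ g, p.app k (φ g) = constHom k P (c g) := by
  choose f hf using h.exists_indicator
  let m : ∀ (A : Type v) [CommRing A] [Algebra k A], G.obj A → (constGroup k P).obj A :=
    fun A _ _ x => (
      { coeff := fun i => (f i).toFun A x
        mul_eq_zero := fun i j hij => hφ ⟨fun A _ _ x => (f i).toFun A x * (f j).toFun A x,
          fun ψ x => by rw [(f i).naturality, (f j).naturality, map_mul]⟩
          (fun g => by
            change (f i).toFun k (φ g) * (f j).toFun k (φ g) = 0
            rw [hf, hf]
            exact IdempotentPartition.mul_eq_zero _ i j hij) A x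
        sum_eq_one := hφ.eq_of_forall ⟨fun A _ _ x => ∑ i, (f i).toFun A x,
          fun ψ x => by simp only [(f _).naturality, map_sum]⟩ ⟨fun A _ _ x => 1, fun ψ x => by
            rw [map_one]⟩
          (fun g => by
            simp only [hf]
            exact IdempotentPartition.sum_eq_one _) A x } : IdempotentPartition P A)
  have hm : ∀ g, m k (φ g) = constHom k P (c g) := fun g =>
    IdempotentPartition.ext (funext fun i => hf i g)
  obtain ⟨p, hp⟩ := hφ.exists_hom isCoordinateRing_constGroup.chart m
    (fun ψ x => IdempotentPartition.ext (funext fun i => (f i).naturality ψ x)) fun g g' => by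
      rw [← map_mul, hm, hm, hm, map_mul, map_mul]
  exact ⟨p, fun g => (hp k _).trans (hm g)⟩

/-- On Γ, a function e pulled back from Q takes values among the roots of its minimal polynomial.
Lagrange interpolation makes the indicator of each level set a regular idempotent, which is constant
on the fibres of c. -/
theorem hom_apply_eq (h : SeparatesComponents φ c) {Q : GroupFunctor.{v, v} k} {E : Type v}
    [CommRing E] [Algebra k E] [Module.Finite k E] {x : Q.obj E} (hx : Q.IsCoordinateRing E x)
    (f : Hom G Q) {g g' : Γ} (hg : c g = c g') : f.app k (φ g) = f.app k (φ g') := by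
  classical
  rw [← hx.map_hom (f.app k (φ g)), ← hx.map_hom (f.app k (φ g'))]
  congr 1
  congr 1
  refine AlgHom.ext fun e => ?_
  have hroot : ∀ g, hx.hom (f.app k (φ g)) e ∈ (minpoly k e).roots.toFinset := fun g => by
    rw [Multiset.mem_toFinset, Polynomial.mem_roots
      (minpoly.ne_zero (Algebra.IsIntegral.isIntegral e)), Polynomial.IsRoot,
      ← Polynomial.coe_aeval_eq_eval, Polynomial.aeval_algHom_apply, minpoly.aeval, map_zero]
  let q := Lagrange.basis (minpoly k e).roots.toFinset id (hx.hom (f.app k (φ g)) e)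
  have hq : ∀ g', ((hx.function (Polynomial.aeval e q)).comp f).toFun k (φ g') =
      if hx.hom (f.app k (φ g')) e = hx.hom (f.app k (φ g)) e then 1 else 0 := fun g' => by
    change hx.hom (f.app k (φ g')) (Polynomial.aeval e q) = _
    rw [← Polynomial.aeval_algHom_apply, Polynomial.coe_aeval_eq_eval]
    split_ifs with heq
    · rw [heq]
      exact Lagrange.eval_basis_self (v := id) Function.injective_id.injOn (hroot g)
    · exact Lagrange.eval_basis_of_ne (v := id) (Ne.symm heq) (hroot g')
  have := h.eq_of_idempotent ((hx.function (Polynomial.aeval e q)).comp f)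
    (fun g => by rw [hq]; split_ifs <;> simp) hg
  rw [hq, hq, if_pos rfl] at this
  by_contra hne
  rw [if_neg (Ne.symm hne)] at this
  exact one_ne_zero this

/-- An étale algebra over a field is finite, so a homomorphism to an étale Q depends on Γ only
through c. The images of representatives assemble into a point of Q over P → k, which defines the
factorization; density gives its multiplicativity, the commutation and uniqueness. -/
theorem isComponentGroup (h : SeparatesComponents φ c) (hφ : HasDenseImage φ)
    {p : Hom G (constGroup k P)} (hp : ∀ g, p.app k (φ g) = constHom k P (c g)) :
    IsComponentGroup p := by
  refine ⟨isEtale_constGroup, fun Q hQ f => ?_⟩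
  obtain ⟨E, _, _, x, hx, _⟩ := hQ
  have : Module.Finite k E := Algebra.FormallyUnramified.finite_of_free k E
  choose s hs using h.surjective
  have key : ∀ g, f.app k (φ (s (c g))) = f.app k (φ g) := fun g => h.hom_apply_eq hx f (hs (c g))
  let y : Q.obj (P → k) := Q.map (AlgHom.pi fun i => hx.hom (f.app k (φ (s i)))) x
  have hy : ∀ i, Q.map (constEval (IdempotentPartition.single k i)) y = f.app k (φ (s i)) :=
    fun i => by
      rw [← Q.map_comp, constEval_single]
      exact hx.map_hom _
  obtain ⟨q, hq⟩ := hasDenseImage_constHom.exists_hom (G := constGroup k P) hx.chart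
    (fun A _ _ (a : IdempotentPartition P A) => Q.map (constEval a) y)
    (fun ψ a => by
      exact (congrArg (fun χ => Q.map χ y) (constEval_map ψ a)).trans (Q.map_comp _ _ y))
    (fun i j => by
      have e1 := hy (i * j)
      have e2 : f.app k (φ (s (i * j))) = f.app k (φ (s i)) * f.app k (φ (s j)) := by
        rw [← map_mul, ← map_mul, ← key (s i * s j), map_mul, hs, hs]
      rw [← map_mul]
      exact e1.trans (e2.trans (congrArg₂ _ (hy i).symm (hy j).symm)))
  have hq' : ∀ i, q.app k (constHom k P i) = f.app k (φ (s i)) := fun i => (hq k _).trans (hy i)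
  refine ⟨q, hφ.hom_ext hx.chart fun g => ?_, fun q' hq2 =>
    hasDenseImage_constHom.hom_ext hx.chart fun i => ?_⟩
  · change q.app k (p.app k (φ g)) = _
    rw [hp, hq', key]
  · rw [hq', ← hq2]
    change _ = q'.app k (p.app k (φ (s i)))
    rw [hp, hs]

/-- An idempotent function over L takes only the values 0 and 1 on Γ. Applying to its coefficients a
k-linear retraction that fixes 1 yields a function over k with the same values, so no new components
appear. -/
theorem baseChange {τ : Type v} (C : Chart G τ) (h : SeparatesComponents φ c) {L : Type v}
    [Field L] (σ : k →+* L) :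
    SeparatesComponents (G := G.baseChange σ) ((G.extendPoint σ).comp φ) c where
  surjective := h.surjective
  exists_indicator i := by
    obtain ⟨f, hf⟩ := h.exists_indicator i
    refine ⟨f.baseChange σ, fun g => ?_⟩
    let _ : Algebra k L := ((algebraMap L L).comp σ).toAlgebra
    refine (f.naturality (Algebra.ofId k L) (φ g)).trans ?_
    rw [hf, ← IdempotentPartition.map_single (σ : k →+* L)]
    rfl
  eq_of_idempotent f hf {g g'} hg := by
    let _ : Algebra k L := σ.toAlgebra
    obtain ⟨Q, hQ⟩ := (C.baseChange σ).exists_polynomial f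
    obtain ⟨r, hr⟩ := (Algebra.linearMap k L).exists_leftInverse_of_injective
      (LinearMap.ker_eq_bot.mpr (algebraMap k L).injective)
    have hr' : r 1 = 1 :=
      (congrArg r (map_one (algebraMap k L)).symm).trans (LinearMap.congr_fun hr 1)
    have key : ∀ g, f.toFun L ((G.extendPoint σ).comp φ g) =
        algebraMap k L ((RegularFunction.polynomial (mapCoeff r Q) C.coord).toFun k (φ g)) := by
      intro g
      have e : f.toFun L ((G.extendPoint σ).comp φ g) =
          MvPolynomial.aeval (fun i => algebraMap k L ((C.coord i).toFun k (φ g))) Q := by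
        refine (hQ L _).trans ?_
        congr 2
        funext i
        let _ : Algebra k L := ((algebraMap L L).comp σ).toAlgebra
        exact (C.coord i).naturality (Algebra.ofId k L) (φ g)
      have e2 : (RegularFunction.polynomial (mapCoeff r Q) C.coord).toFun k (φ g) =
          r (f.toFun L ((G.extendPoint σ).comp φ g)) := by
        rw [e]
        exact aeval_mapCoeff_field r Q _
      rw [e2]
      rcases IsIdempotentElem.iff_eq_zero_or_one.mp (hf g) with h0 | h0
      · rw [h0, map_zero, map_zero]
      · rw [h0, hr', map_one]
    rw [key, key]
    congr 1
    exact h.eq_of_idempotent _ (fun g => (algebraMap k L).injective (by rw [map_mul, ← key, hf])) hg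

theorem of_hom (h : SeparatesComponents φ c) {ψ : Γ →* H.obj k} (e : Hom G H) (e' : Hom H G)
    (he : ∀ g, e.app k (φ g) = ψ g) (he' : ∀ g, e'.app k (ψ g) = φ g) :
    SeparatesComponents ψ c where
  surjective := h.surjective
  exists_indicator i := by
    obtain ⟨f, hf⟩ := h.exists_indicator i
    exact ⟨f.comp e', fun g => (congrArg (f.toFun k) (he' g)).trans (hf g)⟩
  eq_of_idempotent f hf {g g'} hg := by
    have hc : ∀ g, (f.comp e).toFun k (φ g) = f.toFun k (ψ g) := fun g =>
      congrArg (f.toFun k) (he g)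
    rw [← hc, ← hc]
    exact h.eq_of_idempotent _ (fun g => by rw [hc, hf]) hg

end SeparatesComponents

end Components

end GroupFunctor

/-! ## Existence of the component group -/

/-- In a reduced ring an idempotent is determined by the set of minimal primes containing it, and a
Noetherian ring has finitely many minimal primes. -/
theorem finite_isIdempotentElem (R : Type*) [CommRing R] [IsNoetherianRing R] [IsReduced R] :
    {e : R | IsIdempotentElem e}.Finite := by
  have hfin := minimalPrimes.finite_of_isNoetherianRing R
  refine Set.Finite.of_injOn (f := fun e : R => {p ∈ minimalPrimes R | e ∈ p})
    (t := 𝒫 minimalPrimes R) (fun _ _ => Set.sep_subset _ _) ?_ hfin.finite_subsets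
  have key : ∀ e e' : R, {p ∈ minimalPrimes R | e ∈ p} = {p ∈ minimalPrimes R | e' ∈ p} →
      IsIdempotentElem e' → e = e * e' := fun e e' h he' => by
    have h0 : e * (1 - e') ∈ nilradical R := by
      rw [nilradical, ← Ideal.sInf_minimalPrimes, Ideal.mem_sInf]
      intro p hp
      have hprime : p.IsPrime := hp.1.1
      by_cases hep : e ∈ p
      · exact p.mul_mem_right _ hep
      · refine p.mul_mem_left _ ((hprime.mem_or_mem (x := e') (y := 1 - e') ?_).resolve_left ?_)
        · rw [mul_sub, mul_one, he'.eq, sub_self]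
          exact p.zero_mem
        · exact fun h' => hep (h.symm.subset (⟨hp, h'⟩ : p ∈ {p ∈ minimalPrimes R | e' ∈ p})).2
    rw [nilradical_eq_zero, Ideal.zero_eq_bot, Ideal.mem_bot, mul_sub, mul_one, sub_eq_zero] at h0
    exact h0
  intro e he e' he' h
  rw [key e e' h he', mul_comm, ← key e' e h.symm he]

namespace GroupFunctor

variable {k : Type v} [Field k] {G : GroupFunctor.{v, w} k} {Γ : Type u} [Group Γ]

/-- The regular function `x ↦ f (x γ)`, for a `k`-point `γ`. -/
def RegularFunction.rightTranslate (f : RegularFunction G) (γ : G.obj k) : RegularFunction G where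
  toFun A _ _ x := f.toFun A (x * G.map (Algebra.ofId k A) γ)
  naturality {A B} _ _ _ _ φ x := by
    have h : φ.comp (Algebra.ofId k A) = Algebra.ofId k B := Subsingleton.elim _ _
    rw [← f.naturality, map_mul, ← G.map_comp, h]

/-- The restrictions to `Γ` of regular functions that take the values `0` and `1`. -/
def idempotentFunctions (φ : Γ →* G.obj k) : Set (Γ → k) :=
  {b | (∃ f : RegularFunction G, ∀ g, f.toFun k (φ g) = b g) ∧ ∀ g, b g * b g = b g}

theorem map_ofId_self (x : G.obj k) : G.map (Algebra.ofId k k) x = x := by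
  have h : Algebra.ofId k k = AlgHom.id k k := Subsingleton.elim _ _
  rw [h, G.map_id]

/-- They are idempotents in the ring of polynomial functions restricted to Γ, which is Noetherian as
a quotient of a polynomial ring in finitely many variables and reduced as a ring of functions. -/
theorem finite_idempotentFunctions {τ : Type v} [Finite τ] (C : Chart G τ) (φ : Γ →* G.obj k) :
    (idempotentFunctions φ).Finite := by
  let ev : MvPolynomial τ k →+* (Γ → k) :=
    RingHom.pi fun g => (MvPolynomial.aeval fun i => (C.coord i).toFun k (φ g)).toRingHom
  have : IsReduced ev.range := isReduced_of_injective ev.range.subtype Subtype.val_injective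
  refine ((finite_isIdempotentElem ev.range).image Subtype.val).subset ?_
  rintro b ⟨⟨f, hf⟩, hb⟩
  obtain ⟨Q, hQ⟩ := C.exists_polynomial f
  exact ⟨⟨b, Q, funext fun g => (hQ k (φ g)).symm.trans (hf g)⟩, Subtype.ext (funext hb), rfl⟩

/-- The right translation action of `Γ` on the idempotent functions. -/
def idempotentAction (φ : Γ →* G.obj k) : Γ →* Equiv.Perm (idempotentFunctions φ) :=
  letI : MulAction Γ (idempotentFunctions φ) :=
    { smul := fun γ b => ⟨fun g => b.1 (g * γ), by
        obtain ⟨⟨f, hf⟩, hb⟩ := b.2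
        refine ⟨⟨f.rightTranslate (φ γ), fun g => ?_⟩, fun g => hb _⟩
        refine Eq.trans ?_ (hf (g * γ))
        rw [map_mul]
        exact congrArg (fun z => f.toFun k (φ g * z)) (map_ofId_self (φ γ))⟩
      one_smul := fun b => Subtype.ext (funext fun g => congrArg b.1 (mul_one g))
      mul_smul := fun γ δ b => Subtype.ext (funext fun g => congrArg b.1 (mul_assoc g γ δ).symm) }
  MulAction.toPermHom Γ (idempotentFunctions φ)

theorem idempotentAction_apply (φ : Γ →* G.obj k) (γ : Γ) (b : idempotentFunctions φ) (g : Γ) :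
    (idempotentAction φ γ b).1 g = b.1 (g * γ) := rfl

/-- Left translates of idempotent functions are again idempotent functions, so comparing values at γ
and γ' already controls all right translates. -/
theorem idempotentAction_eq_iff (φ : Γ →* G.obj k) (γ γ' : Γ) :
    idempotentAction φ γ = idempotentAction φ γ' ↔ ∀ b ∈ idempotentFunctions φ, b γ = b γ' := by
  refine ⟨fun h b hb => ?_, fun h => Equiv.ext fun b => Subtype.ext (funext fun g => ?_)⟩
  · have := congrArg (fun e => (e ⟨b, hb⟩).1 1) h
    simpa only [idempotentAction_apply, one_mul] using this
  · rw [idempotentAction_apply, idempotentAction_apply]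
    refine h (fun x => b.1 (g * x)) ?_
    obtain ⟨⟨f, hf⟩, hb⟩ := b.2
    refine ⟨⟨f.leftTranslate (φ g), fun x => ?_⟩, fun x => hb _⟩
    refine Eq.trans ?_ (hf (g * x))
    rw [map_mul]
    exact congrArg (fun z => f.toFun k (z * φ x)) (map_ofId_self (φ g))

/-- The group P is the image of Γ in the permutations of the finite set of idempotent functions;
`Shrink` moves it to the universe of k. -/
theorem exists_separatesComponents {τ : Type v} [Finite τ] (C : Chart G τ) (φ : Γ →* G.obj k) :
    ∃ (P : Type v) (_ : Group P) (_ : Fintype P) (c : Γ →* P), SeparatesComponents φ c := by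
  classical
  have := (finite_idempotentFunctions C φ).to_subtype
  let _ := Fintype.ofFinite (idempotentFunctions φ)
  let e := (Shrink.mulEquiv.{v} (α := (idempotentAction φ).range)).symm
  let c := e.toMonoidHom.comp (idempotentAction φ).rangeRestrict
  have hc : ∀ γ γ', c γ = c γ' ↔ ∀ b ∈ idempotentFunctions φ, b γ = b γ' := fun γ γ' => by
    rw [← idempotentAction_eq_iff]
    exact e.injective.eq_iff.trans Subtype.ext_iff
  have hsurj : Function.Surjective c :=
    e.surjective.comp (idempotentAction φ).rangeRestrict_surjective
  refine ⟨Shrink.{v} (idempotentAction φ).range, inferInstance, inferInstance, c, hsurj,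
    fun i => ?_, fun f hf g g' hg => (hc g g').mp hg _ ⟨⟨f, fun _ => rfl⟩, hf⟩⟩
  obtain ⟨γ, rfl⟩ := hsurj i
  choose f hf using fun b : idempotentFunctions φ => b.2.1
  -- Indicator of the class of γ: the factor for b is 1 where b takes the value b(γ) and 0
  -- elsewhere, since both values are 0 or 1.
  refine ⟨⟨fun A _ _ x => ∏ b : idempotentFunctions φ,
      (1 - ((f b).toFun A x - algebraMap k A (b.1 γ)) ^ 2), fun ψ x => ?_⟩, fun g => ?_⟩
  · rw [map_prod]
    exact Finset.prod_congr rfl fun b _ => by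
      rw [(f b).naturality, map_sub, map_one, map_pow, map_sub, ψ.commutes]
  · change ∏ b : idempotentFunctions φ, (1 - ((f b).toFun k (φ g) - b.1 γ) ^ 2) = _
    simp only [hf]
    by_cases h : c g = c γ
    · rw [h, IdempotentPartition.single_same]
      exact Finset.prod_eq_one fun b _ => by rw [(hc g γ).mp h b.1 b.2]; ring
    · rw [IdempotentPartition.single_ne (Ne.symm h)]
      rw [hc] at h
      push Not at h
      obtain ⟨b, hb, hne⟩ := h
      refine Finset.prod_eq_zero (Finset.mem_univ ⟨b, hb⟩) ?_
      rcases IsIdempotentElem.iff_eq_zero_or_one.mp (hb.2 g) with h1 | h1 <;>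
        rcases IsIdempotentElem.iff_eq_zero_or_one.mp (hb.2 γ) with h2 | h2 <;>
        simp_all

end GroupFunctor

/-! ## Reductivity -/

namespace GroupFunctor

/-! ### Smoothness from density of rational points -/

section Reduced

variable {k : Type v} [Field k] {G : GroupFunctor.{v, w} k} {Γ : Type u} [Group Γ] {τ : Type v}

theorem Chart.mem_ideal (C : Chart G τ) {φ : Γ →* G.obj k} (hφ : HasDenseImage φ)
    {q : MvPolynomial τ k}
    (hq : ∀ g, MvPolynomial.aeval (fun i => (C.coord i).toFun k (φ g)) q = 0) : q ∈ C.ideal := by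
  have := hφ (RegularFunction.polynomial q C.coord) hq _ C.point
  change MvPolynomial.aeval (fun i => (C.coord i).toFun _ C.point) q = 0 at this
  simp only [C.coord_point] at this
  rw [← Ideal.Quotient.eq_zero_iff_mem, ← this]
  have h := MvPolynomial.comp_aeval_apply (R := k) MvPolynomial.X (Ideal.Quotient.mkₐ k C.ideal) q
  rw [MvPolynomial.aeval_X_left_apply] at h
  exact h

/-- The points of Γ separate the elements of the coordinate ring R. After slicing by linear forms on
K they also separate K ⊗ R, which therefore embeds into the reduced ring of functions Γ → K. -/
theorem isGeometricallyReduced_of_hasDenseImage (C : Chart G τ) {φ : Γ →* G.obj k}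
    (hφ : HasDenseImage φ) : G.IsGeometricallyReduced := by
  refine ⟨_, inferInstance, inferInstance, C.point, C.isCoordinateRing, ?_⟩
  rw [Algebra.isGeometricallyReduced_field_iff]
  suffices ∀ (K R : Type v) [Field K] [Algebra k K] [CommRing R] [Algebra k R]
      (ev' : Γ → R →ₐ[k] k), (∀ r, (∀ g, ev' g r = 0) → r = 0) → IsReduced (K ⊗[k] R) from
    this _ _ (fun g => C.evalPoint (φ g)) fun r hr => by
      obtain ⟨q, rfl⟩ := Ideal.Quotient.mk_surjective r
      exact Ideal.Quotient.eq_zero_iff_mem.mpr (C.mem_ideal hφ hr)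
  intro K R _ _ _ _ ev' hev
  let ev : K ⊗[k] R →ₐ[K] (Γ → K) := AlgHom.pi fun g =>
    Algebra.TensorProduct.lift (AlgHom.id K K) ((Algebra.ofId k K).comp (ev' g))
      fun _ _ => mul_comm _ _
  refine isReduced_of_injective ev ((injective_iff_map_eq_zero ev).mpr fun z hz => ?_)
  refine eq_zero_of_forall_rTensor z fun c => ?_
  have key : ∀ (g : Γ) (z : K ⊗[k] R),
      ev' g (TensorProduct.lid k R (c.rTensor R z)) = c (ev z g) := fun g z => by
    induction z with
    | zero => simp
    | add x y hx hy => simp only [map_add, Pi.add_apply, hx, hy]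
    | tmul a r =>
      have : ev (a ⊗ₜ r) g = a * algebraMap k K (ev' g r) :=
        Algebra.TensorProduct.lift_tmul (AlgHom.id K K) ((Algebra.ofId k K).comp (ev' g))
          (fun _ _ => Commute.all _ _) a r
      rw [this, mul_comm, ← Algebra.smul_def, map_smul, LinearMap.rTensor_tmul,
        TensorProduct.lid_tmul, map_smul, smul_eq_mul, smul_eq_mul, mul_comm]
  exact hev _ fun g => by rw [key, hz, Pi.zero_apply, map_zero]

end Reduced

/-! ### Triviality of reduced closed subgroups -/

section Trivial

variable {k : Type v} [Field k] {G : GroupFunctor.{v, w} k}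

/-- A coordinate ring of a closed subgroup of an affine algebraic group is of finite type. -/
theorem finiteType_of_isClosedImmersion {τ : Type v} [Finite τ] (C : Chart G τ)
    {U : SubgroupFunctor G} (hU : U.incl.IsClosedImmersion) {R : Type v} [CommRing R] [Algebra k R]
    {x : U.toGroupFunctor.obj R} (hx : U.toGroupFunctor.IsCoordinateRing R x) :
    Algebra.FiniteType k R := by
  obtain ⟨I, hI⟩ := hU.2 _ C.point
  obtain ⟨y, hy⟩ := (hI _ (Ideal.Quotient.mkₐ k I)).mpr fun a ha =>
    Ideal.Quotient.eq_zero_iff_mem.mpr ha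
  have hψ : G.map (C.evalPoint x.1) C.point = x.1 := C.map_evalPoint x.1
  have h0 := (hI _ (C.evalPoint x.1)).mp ⟨x, hψ.symm⟩
  let ψ := Ideal.Quotient.liftₐ I (C.evalPoint x.1) h0
  -- The closed locus at the universal point of G has coordinate ring O(G)/I, and R is a retract of
  -- it.
  have hid : ψ.comp (hx.hom y) = AlgHom.id k R := by
    refine (hx R).1 ?_
    change U.toGroupFunctor.map _ x = U.toGroupFunctor.map _ x
    rw [U.toGroupFunctor.map_comp, hx.map_hom, U.toGroupFunctor.map_id]
    refine Subtype.ext ?_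
    change G.map ψ y.1 = x.1
    have hy' : y.1 = G.map (Ideal.Quotient.mkₐ k I) C.point := hy
    rw [hy', ← G.map_comp]
    exact hψ
  have hs : Function.Surjective ψ := fun r => ⟨hx.hom y r, DFunLike.congr_fun hid r⟩
  exact Algebra.FiniteType.of_surjective (ψ.comp (Ideal.Quotient.mkₐ k I))
    (hs.comp Ideal.Quotient.mk_surjective)

/-- The Nullstellensatz: the nilradical is an intersection of maximal ideals, all with residue field
k. -/
theorem eq_zero_of_forall_algHom [IsAlgClosed k] {R : Type*} [CommRing R] [Algebra k R]
    [Algebra.FiniteType k R] [IsReduced R] (d : R) (hd : ∀ χ : R →ₐ[k] k, χ d = 0) : d = 0 := by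
  have : IsJacobsonRing R := isJacobsonRing_of_finiteType (A := k)
  rw [← Ideal.mem_bot, ← Ideal.zero_eq_bot, ← nilradical_eq_zero R, nilradical,
    Ideal.radical_eq_jacobson, Ideal.jacobson, Ideal.mem_sInf]
  rintro p ⟨-, hp⟩
  let _ := Ideal.Quotient.field p
  have : Module.Finite k (R ⧸ p) := finite_of_finite_type_of_isJacobsonRing k (R ⧸ p)
  let ε := AlgEquiv.ofBijective (Algebra.ofId k (R ⧸ p))
    IsAlgClosed.algebraMap_bijective_of_isIntegral
  have := hd (ε.symm.toAlgHom.comp (Ideal.Quotient.mkₐ k p))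
  exact Ideal.Quotient.eq_zero_iff_mem.mp ((map_eq_zero_iff _ ε.symm.injective).mp this)

/-- A reduced closed subgroup without nontrivial rational points over an algebraically closed field
is trivial. -/
theorem isTrivial_of_carrier_eq_bot [IsAlgClosed k] {τ : Type v} [Finite τ] (C : Chart G τ)
    {U : SubgroupFunctor G} (hU : U.incl.IsClosedImmersion)
    (hred : U.toGroupFunctor.IsGeometricallyReduced) (h : U.carrier k = ⊥) : U.IsTrivial := by
  obtain ⟨R, _, _, x, hx, _⟩ := hred
  have := finiteType_of_isClosedImmersion C hU hx
  have : IsReduced R := Algebra.isReduced_of_isGeometricallyReduced k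
  -- All specializations of the universal point at k-points are trivial, so its coordinates agree
  -- with those of 1.
  have hx1 : x = 1 := by
    refine Subtype.ext (C.injective R fun i => sub_eq_zero.mp
      (eq_zero_of_forall_algHom (k := k) _ fun χ => ?_))
    have h1 : (U.toGroupFunctor.map χ x).1 = 1 :=
      (h.le : ∀ ⦃y⦄, y ∈ U.carrier k → y = 1) (U.toGroupFunctor.map χ x).2
    rw [map_sub, ← (C.coord i).naturality, ← (C.coord i).naturality, sub_eq_zero]
    exact congrArg ((C.coord i).toFun k) (h1.trans (map_one (G.map χ)).symm)
  intro A _ _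
  rw [eq_bot_iff]
  intro u hu
  obtain ⟨ψ, hψ⟩ := (hx A).2 ⟨u, hu⟩
  subst hx1
  exact congrArg Subtype.val (hψ.symm.trans (map_one _))

end Trivial

/-! ### The criterion for reductivity -/

section Reductive

variable {k : Type v} [Field k] [CharZero k] {G : GroupFunctor.{v, w} k} {Γ : Type u} [Group Γ]

/-- The values of a homomorphism to `GL_n` lie in the span of its values on a dense subgroup. -/
theorem HasDenseImage.mem_spanAlgebra {k : Type v} [Field k] {G : GroupFunctor.{v, w} k}
    {φ : Γ →* G.obj k} (hφ : HasDenseImage φ) {n : ℕ} (e : Hom G (GLn k n))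
    {ρ : Γ →* GeneralLinearGroup (Fin n) k} (h : ∀ g, e.app k (φ g) = ρ g) (x : G.obj k) :
    Units.val (α := Matrix (Fin n) (Fin n) k) (e.app k x) ∈ spanAlgebra ρ := by
  rw [mem_spanAlgebra_iff]
  by_contra hx
  -- A linear form that separates the value at x from the span would be a regular function vanishing
  -- on the dense subgroup but not at x.
  obtain ⟨f, hf, hle⟩ := Submodule.exists_le_ker_of_notMem hx
  have hfM : ∀ M : Matrix (Fin n) (Fin n) k,
      f M = ∑ i, ∑ j, algebraMap k k (f (Matrix.single i j 1)) * M i j := fun M => by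
    conv_lhs => rw [Matrix.matrix_eq_sum_single M]
    simp only [map_sum]
    refine Finset.sum_congr rfl fun i _ => Finset.sum_congr rfl fun j _ => ?_
    rw [← mul_one (M i j), ← smul_eq_mul (M i j), ← Matrix.smul_single, map_smul, smul_eq_mul,
      smul_eq_mul, mul_one, mul_comm]
    rfl
  refine hf ((hfM _).trans (hφ ⟨fun A _ _ x => ∑ i, ∑ j, algebraMap k A (f (Matrix.single i j 1)) *
    (Units.val (α := Matrix (Fin n) (Fin n) A) (e.app A x)) i j, fun ψ x => ?_⟩ (fun g => ?_) k x))
  · rw [e.naturality, map_sum]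
    refine Finset.sum_congr rfl fun i _ => ?_
    rw [map_sum]
    refine Finset.sum_congr rfl fun j _ => ?_
    rw [map_mul, ψ.commutes]
    rfl
  · refine (hfM _).symm.trans ?_
    rw [h]
    exact hle (Submodule.subset_span ⟨g, rfl⟩)

/-- The points of U over the algebraic closure become unipotent matrices that lie in the span of
ρ(Γ) by density and are normalized by ρ(Γ), hence are trivial. A reduced U with only the trivial
point is trivial. -/
theorem isReductive_of_isClosedEmbedding {τ : Type v} [Finite τ] (C : Chart G τ) {φ : Γ →* G.obj k}
    (hφ : HasDenseImage φ) {n : ℕ} {ρ : Γ →* GeneralLinearGroup (Fin n) (AlgebraicClosure k)}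
    (hs : HasStableComplements (spanAlgebra ρ : Set (Matrix (Fin n) (Fin n) (AlgebraicClosure k))))
    {e : Hom (G.baseChange (algebraMap k (AlgebraicClosure k))) (GLn (AlgebraicClosure k) n)}
    (he : IsClosedEmbedding e)
    (h : ∀ g, e.app _ (G.extendPoint (algebraMap k (AlgebraicClosure k)) (φ g)) = ρ g) :
    G.IsReductive := by
  refine ⟨C.isAffineAlgebraic, isGeometricallyReduced_of_hasDenseImage C hφ,
    fun U hU hnorm hred _ huni => isTrivial_of_carrier_eq_bot (C.baseChange _) hU hred ?_⟩
  have hd := hφ.baseChange C (algebraMap k (AlgebraicClosure k))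
  have hN := eq_one_of_unipotent_of_normalized ρ (spanAlgebra ρ) hs rfl
    ((U.carrier (AlgebraicClosure k)).map (e.app (AlgebraicClosure k)))
    (by
      rintro _ ⟨x, -, rfl⟩
      exact hd.mem_spanAlgebra e h x)
    (by
      rintro g _ ⟨x, hx, rfl⟩
      refine ⟨_, (hnorm (AlgebraicClosure k)).conj_mem x hx
        (G.extendPoint (algebraMap k (AlgebraicClosure k)) (φ g))⁻¹, ?_⟩
      rw [inv_inv]
      refine (map_mul (e.app (AlgebraicClosure k)) _ _).trans (congrArg₂ _ ?_ (h g))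
      refine (map_mul (e.app (AlgebraicClosure k)) _ _).trans (congrArg₂ _ ?_ rfl)
      exact (map_inv (e.app (AlgebraicClosure k)) _).trans (congrArg _ (h g)))
    (by
      rintro _ ⟨x, hx, rfl⟩
      exact huni n (e.comp U.incl) ⟨x, hx⟩)
  exact (Subgroup.map_eq_bot_iff_of_injective _ (he.injective _)).mp hN

end Reductive

end GroupFunctor

/-! ## Monodromy groups of descended laws -/

open GroupFunctor

/-- Transport of a chart along an isomorphism. -/
def GroupFunctor.Chart.ofIso {k : Type v} [Field k] {G : GroupFunctor.{v, w} k}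
    {H : GroupFunctor.{v, w'} k} {τ : Type v} (C : Chart G τ) (e : Iso G H) : Chart H τ where
  coord i := (C.coord i).comp e.symm.toHom
  ideal := C.ideal
  injective A _ _ {x y} h := (e.app A).symm.injective (C.injective A h)
  exists_point A _ _ p h := by
    obtain ⟨x, hx⟩ := C.exists_point A p h
    exact ⟨e.app A x, fun i =>
      (congrArg ((C.coord i).toFun A) ((e.app A).symm_apply_apply x)).trans (hx i)⟩
  aeval_coord A _ _ x {q} hq := C.aeval_coord A ((e.app A).symm x) hq

/-- Coordinates on the general linear group. -/
def chartGLn (k : Type) [Field k] (n : ℕ) :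
    Chart (GLn k n) ((Fin n × Fin n) ⊕ (Fin n × Fin n)) :=
  (unitChart (Matrix.stdBasis k (Fin n) (Fin n))).ofIso (unitGroupMatrixIso k n)

section BaseChange

variable {k L M : Type v} [Field k] [Field L] [Field M] {G : GroupFunctor.{v, w} k}

theorem baseChangeTrans_extendPoint (f : k →+* L) (g : L →+* M) (h : k →+* M) (e : h = g.comp f)
    (x : G.obj k) : (G.baseChangeTrans f g h e).toHom.app M (G.extendPoint h x) =
      (G.baseChange f).extendPoint g (G.extendPoint f x) := by
  subst e
  let _ : Algebra k L := ((algebraMap L L).comp f).toAlgebra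
  let _ : Algebra k M := (((algebraMap M M).comp g).comp f).toAlgebra
  let ψ : L →ₐ[k] M := { g with commutes' := fun _ => rfl }
  have h : Algebra.ofId k M = ψ.comp (Algebra.ofId k L) := Subsingleton.elim _ _
  change G.map (Algebra.ofId k M) x = G.map ψ (G.map (Algebra.ofId k L) x)
  rw [h, G.map_comp]

theorem baseChange_extendPoint {H : GroupFunctor.{v, w'} k} (e : Hom G H) (f : k →+* L)
    (x : G.obj k) : (e.baseChange f).app L (G.extendPoint f x) = H.extendPoint f (e.app k x) := by
  let _ : Algebra k L := ((algebraMap L L).comp f).toAlgebra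
  exact e.naturality (Algebra.ofId k L) x

end BaseChange

theorem iso_ext {k : Type v} [Field k] {G : GroupFunctor.{v, w} k} {H : GroupFunctor.{v, w'} k}
    {e e' : Iso G H} (h : e.toHom = e'.toHom) : e = e' := by
  ext A _ _ x
  exact congrArg (fun f : Hom G H => f.app A x) h

namespace Frame

variable {Γ : Type u} [Group Γ] {n : ℕ} {k L : Type} [Field k] [Field L] [Algebra k L]
  [CharZero L] {ρ : Γ →* GeneralLinearGroup (Fin n) L} {m : ℕ} (F : Frame k ρ m)
  (hs : HasStableComplements (spanAlgebra ρ : Set (Matrix (Fin n) (Fin n) L)))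

/-- Coordinates on the monodromy group. -/
def chart : Chart (monodromyGroup F.law) (Fin m ⊕ Fin m) :=
  (unitChart (F.basis hs)).zariskiClosure (toUnitGroup F.law).range

include hs in
theorem hasDenseImage : HasDenseImage (toMonodromyGroup F.law) :=
  hasDenseImage_toImageClosure (unitChart (F.basis hs)) (toUnitGroup F.law)

include hs in
theorem hasDenseImage_baseChange {k' : Type} [Field k'] (σ : k →+* k') :
    HasDenseImage (G := (monodromyGroup F.law).baseChange σ)
      (((monodromyGroup F.law).extendPoint σ).comp (toMonodromyGroup F.law)) :=
  (F.hasDenseImage hs).baseChange (F.chart hs) σ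

include hs in
theorem exists_closedEmbedding_unitGroup {k' : Type} [Field k'] [Algebra k k'] {T : Type w}
    [Ring T] [Algebra k T] [Algebra k' T] [IsScalarTower k k' T]
    (s : F.law.quotientAlgebra →ₐ[k] T) (hinj : Function.Injective (extendScalars k' s)) :
    ∃ e : Hom ((monodromyGroup F.law).baseChange (algebraMap k k')) (unitGroup k' T),
      IsClosedEmbedding e ∧ ∀ γ, Units.val (α := k' ⊗[k'] T)
        (e.app k' ((monodromyGroup F.law).extendPoint (algebraMap k k')
          (toMonodromyGroup F.law γ))) = 1 ⊗ₜ s (F.cls γ) := by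
  obtain ⟨e, he, hval⟩ := exists_closedEmbedding_baseChange (L := k') (F.basis hs) s hinj
  exact ⟨e.comp ((SubgroupFunctor.incl _).baseChange _),
    he.comp (isClosedEmbedding_incl_baseChange (unitChart (F.basis hs)) _ _),
    fun γ => hval (toUnitGroup F.law γ) (F.cls γ) (F.toUnitGroup_val γ)⟩

include hs in
theorem exists_closedEmbedding_GLn {k' : Type} [Field k'] [Algebra k k'] {d : ℕ}
    (s : F.law.quotientAlgebra →ₐ[k] Matrix (Fin d) (Fin d) k')
    (hinj : Function.Injective (extendScalars k' s)) {ψ : Γ →* GeneralLinearGroup (Fin d) k'}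
    (hψ : ∀ γ, s (F.cls γ) = (ψ γ).val) :
    ∃ e : Hom ((monodromyGroup F.law).baseChange (algebraMap k k')) (GLn k' d),
      IsClosedEmbedding e ∧ ∀ γ, e.app k' ((monodromyGroup F.law).extendPoint (algebraMap k k')
        (toMonodromyGroup F.law γ)) = ψ γ := by
  obtain ⟨e, he, hval⟩ := F.exists_closedEmbedding_unitGroup hs s hinj
  exact ⟨(unitGroupMatrixIso k' d).toHom.comp e, (isClosedEmbedding_iso _).comp he,
    fun γ => Units.ext ((unitGroupMatrixIso_apply _ _ (hval γ)).trans (hψ γ))⟩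

include hs in
theorem exists_embedding :
    ∃ e : Hom ((monodromyGroup F.law).baseChange (algebraMap k L)) (GLn L n),
      IsClosedEmbedding e ∧ ∀ γ, e.app L ((monodromyGroup F.law).extendPoint (algebraMap k L)
        (toMonodromyGroup F.law γ)) = ρ γ :=
  F.exists_closedEmbedding_GLn hs (F.quotientHom hs) (F.extendScalars_quotientHom_injective hs)
    (F.quotientHom_cls hs)

/-- The faithful representation of the monodromy group over `L`. -/
def embedding : Hom ((monodromyGroup F.law).baseChange (algebraMap k L)) (GLn L n) :=
  (F.exists_embedding hs).choose

theorem isClosedEmbedding_embedding : IsClosedEmbedding (F.embedding hs) :=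
  (F.exists_embedding hs).choose_spec.1

theorem embedding_apply (γ : Γ) :
    (F.embedding hs).app L ((monodromyGroup F.law).extendPoint (algebraMap k L)
      (toMonodromyGroup F.law γ)) = ρ γ :=
  (F.exists_embedding hs).choose_spec.2 γ

include hs in
theorem exists_iso_linearMonodromyGroup :
    ∃ θ : Iso ((monodromyGroup F.law).baseChange (algebraMap k L)) (linearMonodromyGroup ρ),
      ∀ γ, θ.app L ((monodromyGroup F.law).extendPoint (algebraMap k L)
        (toMonodromyGroup F.law γ)) = toLinearMonodromyGroup ρ γ := by
  obtain ⟨θ, -, hθ⟩ := exists_iso_imageClosure (F.isClosedEmbedding_embedding hs)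
    (F.hasDenseImage_baseChange hs (algebraMap k L)) (F.embedding_apply hs)
  exact ⟨θ, hθ⟩

include hs in
theorem isReductive [CharZero k] [IsAlgClosure k L] : (monodromyGroup F.law).IsReductive := by
  -- Reductivity refers to `AlgebraicClosure k`, so ρ and the embedding of the quotient algebra are
  -- carried over from L.
  let σ : L ≃ₐ[k] AlgebraicClosure k := IsAlgClosure.equiv k L (AlgebraicClosure k)
  let s : F.law.quotientAlgebra →ₐ[k] Matrix (Fin n) (Fin n) (AlgebraicClosure k) :=
    σ.toAlgHom.mapMatrix.comp (F.quotientHom hs)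
  have hscls : ∀ γ, s (F.cls γ) = (ρ γ).val.map σ := fun γ =>
    congrArg (fun M => M.map σ) (F.quotientHom_cls hs γ)
  have hinj : Function.Injective (extendScalars (AlgebraicClosure k) s) := by
    refine extendScalars_injective (F.basis hs) s ?_
    simp only [basis_apply, hscls]
    rw [Fintype.linearIndependent_iff]
    intro c hc i
    have h0 : ∑ i, σ.symm (c i) • (ρ (F.g i)).val = 0 := by
      ext a b
      apply σ.injective
      have := congrFun (congrFun hc a) b
      simpa [Matrix.sum_apply] using this
    have := Fintype.linearIndependent_iff.mp F.linearIndependent _ h0 i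
    simpa using this
  obtain ⟨e, he, hval⟩ := F.exists_closedEmbedding_GLn hs s hinj
    (ψ := (GeneralLinearGroup.map ((σ.toRingEquiv : L ≃+* AlgebraicClosure k) :
      L →+* AlgebraicClosure k)).comp ρ) hscls
  exact isReductive_of_isClosedEmbedding (F.chart hs) (F.hasDenseImage hs)
    (hs.map_ringEquiv σ.toRingEquiv) he hval

include hs in
-- The same map c from Γ to a finite group P separates components over k and over L, so both
-- component groups are constant on P. Their compatibility is checked on Γ, and their points over
-- either field are P.
theorem exists_componentGroup
    (θ : Iso ((monodromyGroup F.law).baseChange (algebraMap k L)) (linearMonodromyGroup ρ))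
    (hθ : ∀ γ, θ.app L ((monodromyGroup F.law).extendPoint (algebraMap k L)
        (toMonodromyGroup F.law γ)) = toLinearMonodromyGroup ρ γ) :
    ∃ (P : GroupFunctor.{0, 0} k) (p : Hom (monodromyGroup F.law) P)
      (Q : GroupFunctor.{0, 0} L) (q : Hom (linearMonodromyGroup ρ) Q),
      IsComponentGroup p ∧ IsComponentGroup q ∧
      (∃ κ : Iso (P.baseChange (algebraMap k L)) Q,
        κ.toHom.comp (p.baseChange (algebraMap k L)) = q.comp θ.toHom) ∧
      Function.Bijective (P.extendPoint (algebraMap k L)) := by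
  obtain ⟨P, _, _, c, hc⟩ := exists_separatesComponents (F.chart hs) (toMonodromyGroup F.law)
  obtain ⟨p, hp⟩ := hc.exists_hom (F.hasDenseImage hs)
  have hd : HasDenseImage (toLinearMonodromyGroup ρ) :=
    hasDenseImage_toImageClosure (chartGLn L n) ρ
  have hc' : SeparatesComponents (toLinearMonodromyGroup ρ) c :=
    (hc.baseChange (F.chart hs) (algebraMap k L)).of_hom θ.toHom θ.symm.toHom hθ
      fun γ => (MulEquiv.symm_apply_eq _).mpr (hθ γ).symm
  obtain ⟨q, hq⟩ := hc'.exists_hom hd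
  let κ : Iso ((constGroup k P).baseChange (algebraMap k L)) (constGroup L P) :=
    { app := fun A _ _ => MulEquiv.refl (IdempotentPartition P A)
      naturality := fun _ _ => rfl }
  have hκ : ∀ i, (constGroup k P).extendPoint (algebraMap k L) (constHom k P i) = constHom L P i :=
    fun i => IdempotentPartition.map_single (algebraMap k L) i
  refine ⟨constGroup k P, p, constGroup L P, q, hc.isComponentGroup (F.hasDenseImage hs) hp,
    hc'.isComponentGroup hd hq, ⟨κ, ?_⟩, ?_⟩
  · refine (F.hasDenseImage_baseChange hs (algebraMap k L)).hom_ext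
      isCoordinateRing_constGroup.chart fun γ => ?_
    have h1 : (p.baseChange (algebraMap k L)).app L ((monodromyGroup F.law).extendPoint
        (algebraMap k L) (toMonodromyGroup F.law γ)) = constHom L P (c γ) := by
      rw [baseChange_extendPoint, hp, hκ]
    have h2 : q.app L (θ.app L ((monodromyGroup F.law).extendPoint
        (algebraMap k L) (toMonodromyGroup F.law γ))) = constHom L P (c γ) := by
      rw [hθ, hq]
    exact h1.trans h2.symm
  · have : (constGroup k P).extendPoint (algebraMap k L) ∘ constHom k P = constHom L P :=
      funext hκ
    rw [← constHom_bijective.of_comp_iff, this]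
    exact constHom_bijective

include hs in
/-- Over the field of definition of `ρ`, the monodromy group is the usual one. -/
theorem exists_embedding_of_map_eq (ρ₀ : Γ →* GeneralLinearGroup (Fin n) k)
    (h : ∀ γ, GeneralLinearGroup.map (algebraMap k L) (ρ₀ γ) = ρ γ) :
    ∃ e : Hom (monodromyGroup F.law) (GLn k n), IsClosedEmbedding e ∧
      ∀ γ, e.app k (toMonodromyGroup F.law γ) = ρ₀ γ := by
  have hmap : ∀ x, groupAlgebraHom k ρ x = (groupAlgebraHom k ρ₀ x).map (algebraMap k L) :=
    fun x => by
      induction x using MonoidAlgebra.induction_linear with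
      | zero => ext; simp
      | add p q hp hq => rw [map_add, map_add, hp, hq]; ext; simp
      | single g c =>
        rw [groupAlgebraHom_single, groupAlgebraHom_single, ← h]
        ext i j
        rw [Matrix.smul_apply, Matrix.map_apply, Matrix.smul_apply, smul_eq_mul, map_mul,
          Algebra.smul_def]
        rfl
  -- The maps from k[Γ] to M_n(L) and to M_n(k) have the same kernel, so the quotient algebra
  -- already embeds into M_n(k).
  have hiff : ∀ x y, F.law.ker.ringCon x y ↔ groupAlgebraHom k ρ₀ x = groupAlgebraHom k ρ₀ y :=
    fun x y => by
      rw [F.ringCon_ker_law_iff hs, hmap, hmap]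
      exact (Matrix.map_injective (algebraMap k L).injective).eq_iff
  let s : F.law.quotientAlgebra →ₐ[k] Matrix (Fin n) (Fin n) k :=
    F.law.ker.ringCon.liftₐ (groupAlgebraHom k ρ₀) fun {x y} h => (hiff x y).mp h
  have hinj : Function.Injective s := fun x y hxy => by
    obtain ⟨x, rfl⟩ := F.law.ker.ringCon.mk'_surjective x
    obtain ⟨y, rfl⟩ := F.law.ker.ringCon.mk'_surjective y
    exact (RingCon.eq _).mpr ((hiff x y).mpr hxy)
  have hscls : ∀ γ, s (F.cls γ) = (ρ₀ γ).val := fun γ =>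
    (groupAlgebraHom_single ρ₀ γ (1 : k)).trans (one_smul _ _)
  refine ⟨(unitGroupMatrixIso k n).toHom.comp ((unitGroupMap s).comp (SubgroupFunctor.incl _)),
    (isClosedEmbedding_iso _).comp ((isClosedEmbedding_unitGroupMap (F.basis hs) hinj).comp
      (isClosedEmbedding_incl (unitChart (F.basis hs)) _)), fun γ => Units.ext
    ((unitGroupMatrixIso_apply _ _ ?_).trans (hscls γ))⟩
  change Algebra.TensorProduct.map (AlgHom.id k k) s (1 ⊗ₜ F.cls γ) = _
  rw [Algebra.TensorProduct.map_tmul]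
  rfl

include hs in
theorem exists_iso_of_map_eq (ρ₀ : Γ →* GeneralLinearGroup (Fin n) k)
    (h : ∀ γ, GeneralLinearGroup.map (algebraMap k L) (ρ₀ γ) = ρ γ) :
    ∃ θ : Iso (monodromyGroup F.law) (linearMonodromyGroup ρ₀),
      ∀ γ, θ.app k (toMonodromyGroup F.law γ) = toLinearMonodromyGroup ρ₀ γ := by
  obtain ⟨e, he, hval⟩ := F.exists_embedding_of_map_eq hs ρ₀ h
  obtain ⟨θ, -, hθ⟩ := exists_iso_imageClosure he (F.hasDenseImage hs) hval
  exact ⟨θ, hθ⟩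

variable {k' : Type} [Field k'] [Algebra k' L] {m' : ℕ} (F' : Frame k' ρ m')

include hs in
theorem exists_iso_baseChange [Algebra k k'] [IsScalarTower k k' L] :
    ∃ ι : Iso ((monodromyGroup F.law).baseChange (algebraMap k k')) (monodromyGroup F'.law),
      ∀ γ, ι.app k' ((monodromyGroup F.law).extendPoint (algebraMap k k')
        (toMonodromyGroup F.law γ)) = toMonodromyGroup F'.law γ := by
  obtain ⟨s, hscls, hinj⟩ := F.exists_quotientAlgebra_hom hs F'
  obtain ⟨e, he, hval⟩ := F.exists_closedEmbedding_unitGroup hs s hinj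
  obtain ⟨ι, -, hι⟩ := exists_iso_imageClosure he
    (F.hasDenseImage_baseChange hs (algebraMap k k')) (ψ := toUnitGroup F'.law)
    fun γ => Units.ext ((hval γ).trans (by rw [hscls]; rfl))
  exact ⟨ι, hι⟩

include hs in
theorem iso_baseChange_unique (σ : k →+* k')
    {ι ι' : Iso ((monodromyGroup F.law).baseChange σ) (monodromyGroup F'.law)}
    (h : ∀ γ, ι.app k' ((monodromyGroup F.law).extendPoint σ (toMonodromyGroup F.law γ)) =
      toMonodromyGroup F'.law γ)
    (h' : ∀ γ, ι'.app k' ((monodromyGroup F.law).extendPoint σ (toMonodromyGroup F.law γ)) =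
      toMonodromyGroup F'.law γ) : ι' = ι :=
  iso_ext ((F.hasDenseImage_baseChange hs σ).hom_ext (F'.chart hs) fun γ =>
    (h' γ).trans (h γ).symm)

/-- The embeddings for different fields are chosen independently, yet they are compatible: each
sends γ to ρ(γ) itself, not just to a conjugate, and Γ is dense. -/
theorem embedding_eq_comp (σ : k →+* k') (hσ : algebraMap k L = (algebraMap k' L).comp σ)
    {ι : Iso ((monodromyGroup F.law).baseChange σ) (monodromyGroup F'.law)}
    (h : ∀ γ, ι.app k' ((monodromyGroup F.law).extendPoint σ (toMonodromyGroup F.law γ)) =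
      toMonodromyGroup F'.law γ) :
    F.embedding hs = (F'.embedding hs).comp ((ι.toHom.baseChange (algebraMap k' L)).comp
      ((monodromyGroup F.law).baseChangeTrans σ (algebraMap k' L) (algebraMap k L) hσ).toHom) := by
  refine (F.hasDenseImage_baseChange hs (algebraMap k L)).hom_ext (chartGLn L n) fun γ => ?_
  refine (F.embedding_apply hs γ).trans (Eq.trans ?_ (congrArg
    (fun z => (F'.embedding hs).app L ((ι.toHom.baseChange (algebraMap k' L)).app L z))
    (baseChangeTrans_extendPoint σ (algebraMap k' L) (algebraMap k L) hσ
      (toMonodromyGroup F.law γ)).symm))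
  rw [baseChange_extendPoint]
  exact ((congrArg (fun z => (F'.embedding hs).app L ((monodromyGroup F'.law).extendPoint
    (algebraMap k' L) z)) (h γ)).trans (F'.embedding_apply hs γ)).symm

end Frame

/-! ## Fields of definition -/

theorem exists_map_eq_of_forall_mem {Γ : Type*} [Group Γ] {k L : Type*} [Field k] [Field L]
    (f : k →+* L) {n : ℕ} (ρ : Γ →* GeneralLinearGroup (Fin n) L)
    (h : ∀ γ i j, (ρ γ).val i j ∈ f.fieldRange) :
    ∃ ρ₀ : Γ →* GeneralLinearGroup (Fin n) k, ∀ γ, GeneralLinearGroup.map f (ρ₀ γ) = ρ γ := by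
  have hex : ∀ γ, ∃ g : GeneralLinearGroup (Fin n) k, GeneralLinearGroup.map f g = ρ γ :=
      fun γ => by
    choose M hM using h γ
    have hM' : (Matrix.of M).map f = (ρ γ).val := Matrix.ext hM
    have hdet : (Matrix.of M).det ≠ 0 := fun h0 => by
      have h1 : (ρ γ).val.det = 0 := by
        rw [← hM', ← RingHom.mapMatrix_apply, ← RingHom.map_det, h0, map_zero]
      exact ((Matrix.isUnit_iff_isUnit_det _).mp (ρ γ).isUnit).ne_zero h1
    exact ⟨GeneralLinearGroup.mkOfDetNeZero (Matrix.of M) hdet, Units.ext hM'⟩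
  choose g hg using hex
  have hinj : Function.Injective (GeneralLinearGroup.map (n := Fin n) f) := fun a b hab =>
    Units.ext (Matrix.map_injective f.injective (congrArg Units.val hab))
  exact ⟨MonoidHom.mk' g fun a b => hinj (by rw [map_mul, hg, hg, hg, map_mul]), hg⟩

/-- It suffices to adjoin the entries of the finitely many basis matrices ρ(g i): every other ρ(γ)
is a combination of them with coefficients in E. -/
theorem Frame.exists_finite_extension {Γ : Type u} [Group Γ] {k L : Type v} [Field k] [Field L]
    [Algebra k L] [Algebra.IsAlgebraic k L] {n m : ℕ} {ρ : Γ →* GeneralLinearGroup (Fin n) L}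
    {E : IntermediateField k L} (F : Frame E ρ m) :
    ∃ (E' : IntermediateField k L) (h : E ≤ E'), (IntermediateField.inclusion h).toRingHom.Finite ∧
      ∀ γ i j, (ρ γ).val i j ∈ (algebraMap E' L).fieldRange := by
  let S : Set L := Set.range fun t : Fin m × Fin n × Fin n => (ρ (F.g t.1)).val t.2.1 t.2.2
  let E₁ := IntermediateField.adjoin E S
  have : Algebra.IsAlgebraic E L := Algebra.IsAlgebraic.tower_top (K := k) E
  have hfin : FiniteDimensional E E₁ := by
    have : Finite S := (Set.finite_range _).to_subtype
    exact IntermediateField.finiteDimensional_adjoin fun x _ => Algebra.IsIntegral.isIntegral x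
  have h : E ≤ E₁.restrictScalars k := fun x hx => E₁.algebraMap_mem ⟨x, hx⟩
  refine ⟨E₁.restrictScalars k, h, RingHom.finite_algebraMap.mpr hfin, fun γ i j => ?_⟩
  rw [F.eq_sum γ, Matrix.sum_apply]
  refine sum_mem fun l _ => ⟨⟨algebraMap E L (F.coord γ l) * (ρ (F.g l)).val i j,
    E₁.mul_mem (E₁.algebraMap_mem _)
      (IntermediateField.subset_adjoin E S ⟨(l, i, j), rfl⟩)⟩, rfl⟩

theorem algebraMap_eq_comp_inclusion {k L : Type*} [Field k] [Field L] [Algebra k L]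
    {E E' : IntermediateField k L} (h : E ≤ E') :
    algebraMap E L = (algebraMap E' L).comp (IntermediateField.inclusion h).toRingHom := rfl

theorem HasCharpolyOver.of_le {Γ : Type u} [Group Γ] {k L : Type v} [Field k] [Field L]
    [Algebra k L] {E E' : IntermediateField k L} (h : E ≤ E') {n : ℕ}
    {ρ : Γ →* GeneralLinearGroup (Fin n) L} (hE : HasCharpolyOver (algebraMap E L) ρ) :
    HasCharpolyOver (algebraMap E' L) ρ := fun g => by
  obtain ⟨q, hq⟩ := (Polynomial.mem_lifts _).mp (hE g)
  exact (Polynomial.mem_lifts _).mpr ⟨q.map (IntermediateField.inclusion h).toRingHom, by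
    rw [Polynomial.map_map, ← algebraMap_eq_comp_inclusion, hq]⟩

end Monodromy

end

/-! ### The main theorem -/

open Monodromy

theorem mainTheorem8 {K : Type*} [Field K] [NumberField K] (ℓ : ℕ) [Fact ℓ.Prime] (n : ℕ)
    (ρ : Field.absoluteGaloisGroup K →* GeneralLinearGroup (Fin n) (PadicAlgCl ℓ))
    (hcont : Continuous ρ) (hss : (toRepresentation ρ).IsSemisimpleRepresentation) :
    -- the descended determinant laws `D F : F[Γ] → F`, for all `F` over which `ρ` has its
    -- characteristic polynomials; they exist and are unique
    ∃ D : ∀ F : IntermediateField ℚ_[ℓ] (PadicAlgCl ℓ),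
        HasCharpolyOver (algebraMap F (PadicAlgCl ℓ)) ρ →
        DeterminantLaw F (MonoidAlgebra F (Field.absoluteGaloisGroup K)) n,
      (∀ (F : IntermediateField ℚ_[ℓ] (PadicAlgCl ℓ))
        (hF : HasCharpolyOver (algebraMap F (PadicAlgCl ℓ)) ρ)
        (D' : DeterminantLaw F (MonoidAlgebra F (Field.absoluteGaloisGroup K)) n),
        (detLaw ρ).FactorsThrough (algebraMap F (PadicAlgCl ℓ)) D' ↔ D' = D F hF) ∧
    -- the representations `j F`
    ∃ j : ∀ (F : IntermediateField ℚ_[ℓ] (PadicAlgCl ℓ))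
        (hF : HasCharpolyOver (algebraMap F (PadicAlgCl ℓ)) ρ),
        Hom ((monodromyGroup (D F hF)).baseChange (algebraMap F (PadicAlgCl ℓ)))
          (GLn (PadicAlgCl ℓ) n),
      ∀ (F : IntermediateField ℚ_[ℓ] (PadicAlgCl ℓ))
        (hF : HasCharpolyOver (algebraMap F (PadicAlgCl ℓ)) ρ),
      -- (i) `j F` is faithful and realizes `ρ`
      ((j F hF).IsClosedImmersion ∧
        ∃ M : GeneralLinearGroup (Fin n) (PadicAlgCl ℓ), ∀ g,
          ((j F hF).app (PadicAlgCl ℓ) ((monodromyGroup (D F hF)).extendPoint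
            (algebraMap F (PadicAlgCl ℓ)) (toMonodromyGroup (D F hF) g)) :
            GeneralLinearGroup (Fin n) (PadicAlgCl ℓ)) = M * ρ g * M⁻¹) ∧
      -- (ii) the group is a reductive `F`-model of the usual monodromy group, with the same
      -- component group
      (∃ θ : Iso ((monodromyGroup (D F hF)).baseChange (algebraMap F (PadicAlgCl ℓ)))
          (linearMonodromyGroup ρ),
        (∀ g, θ.app (PadicAlgCl ℓ) ((monodromyGroup (D F hF)).extendPoint
            (algebraMap F (PadicAlgCl ℓ)) (toMonodromyGroup (D F hF) g)) =
          toLinearMonodromyGroup ρ g) ∧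
        (monodromyGroup (D F hF)).IsReductive ∧
        ∃ (P : GroupFunctor.{0, 0} F) (p : Hom (monodromyGroup (D F hF)) P)
          (Q : GroupFunctor.{0, 0} (PadicAlgCl ℓ)) (q : Hom (linearMonodromyGroup ρ) Q),
          GroupFunctor.IsComponentGroup p ∧ GroupFunctor.IsComponentGroup q ∧
          (∃ κ : Iso (P.baseChange (algebraMap F (PadicAlgCl ℓ))) Q,
            κ.toHom.comp (p.baseChange (algebraMap F (PadicAlgCl ℓ))) = q.comp θ.toHom) ∧
          Function.Bijective (P.extendPoint (algebraMap F (PadicAlgCl ℓ)))) ∧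
      -- (iii) over a finite extension the group embeds into `GL_n`, realizing `ρ`
      (∃ (F' : IntermediateField ℚ_[ℓ] (PadicAlgCl ℓ)) (h : F ≤ F')
        (hF' : HasCharpolyOver (algebraMap F' (PadicAlgCl ℓ)) ρ),
        (IntermediateField.inclusion h).toRingHom.Finite ∧
        ∃ i : Hom (monodromyGroup (D F' hF')) (GLn F' n), i.IsClosedImmersion ∧
          ∃ M : GeneralLinearGroup (Fin n) (PadicAlgCl ℓ), ∀ g,
            GeneralLinearGroup.map (algebraMap F' (PadicAlgCl ℓ))
              (i.app F' (toMonodromyGroup (D F' hF') g)) = M * ρ g * M⁻¹) ∧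
      -- (iv) compatibility with extension of the field
      (∀ (F' : IntermediateField ℚ_[ℓ] (PadicAlgCl ℓ)) (h : F ≤ F')
        (hF' : HasCharpolyOver (algebraMap F' (PadicAlgCl ℓ)) ρ),
        ∃ ι : Iso ((monodromyGroup (D F hF)).baseChange (IntermediateField.inclusion h).toRingHom)
            (monodromyGroup (D F' hF')),
          (∀ g, ι.app F' ((monodromyGroup (D F hF)).extendPoint
              (IntermediateField.inclusion h).toRingHom (toMonodromyGroup (D F hF) g)) =
            toMonodromyGroup (D F' hF') g) ∧
          j F hF = (j F' hF').comp ((ι.toHom.baseChange (algebraMap F' (PadicAlgCl ℓ))).comp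
            ((monodromyGroup (D F hF)).baseChangeTrans (IntermediateField.inclusion h).toRingHom
              (algebraMap F' (PadicAlgCl ℓ)) (algebraMap F (PadicAlgCl ℓ)) rfl).toHom) ∧
          ∀ ι' : Iso ((monodromyGroup (D F hF)).baseChange
              (IntermediateField.inclusion h).toRingHom) (monodromyGroup (D F' hF')),
            (∀ g, ι'.app F' ((monodromyGroup (D F hF)).extendPoint
              (IntermediateField.inclusion h).toRingHom (toMonodromyGroup (D F hF) g)) =
              toMonodromyGroup (D F' hF') g) → ι' = ι) ∧
      -- (v) if `ρ` is defined over `F`, the group is the usual monodromy group over `F`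
      (∀ ρF : Field.absoluteGaloisGroup K →* GeneralLinearGroup (Fin n) F,
        (∀ g, GeneralLinearGroup.map (algebraMap F (PadicAlgCl ℓ)) (ρF g) = ρ g) →
        ∃ θ : Iso (monodromyGroup (D F hF)) (linearMonodromyGroup ρF),
          ∀ g, θ.app F (toMonodromyGroup (D F hF) g) = toLinearMonodromyGroup ρF g) := by
  have hs := hasStableComplements_of_isSemisimple ρ hss
  -- One frame is fixed for each F, and both the law and the representation for F are built from it.
  let m := fun (F : IntermediateField ℚ_[ℓ] (PadicAlgCl ℓ))
    (hF : HasCharpolyOver (algebraMap F (PadicAlgCl ℓ)) ρ) => (exists_frame hs hF).choose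
  let fr : ∀ (F : IntermediateField ℚ_[ℓ] (PadicAlgCl ℓ))
    (hF : HasCharpolyOver (algebraMap F (PadicAlgCl ℓ)) ρ), Frame F ρ (m F hF) :=
    fun F hF => (exists_frame hs hF).choose_spec.some
  refine ⟨fun F hF => (fr F hF).law, fun F hF D' =>
    ⟨fun h => DeterminantLaw.eq_of_factorsThrough h (fr F hF).factorsThrough_law,
      fun h => h ▸ (fr F hF).factorsThrough_law⟩, fun F hF => (fr F hF).embedding hs,
    fun F hF => ⟨⟨((fr F hF).isClosedEmbedding_embedding hs).isClosedImmersion, 1, fun g => ?_⟩,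
      ?_, ?_, fun F' h hF' => ?_, fun ρF hρF => (fr F hF).exists_iso_of_map_eq hs ρF hρF⟩⟩
  -- The conjugating matrix is 1, because the embedding realizes ρ on the nose.
  · rw [one_mul, inv_one, mul_one]
    exact (fr F hF).embedding_apply hs g
  · obtain ⟨θ, hθ⟩ := (fr F hF).exists_iso_linearMonodromyGroup hs
    -- `PadicAlgCl ℓ` is an algebraic closure of each intermediate field, as the reductivity
    -- argument requires.
    have : Algebra.IsAlgebraic F (PadicAlgCl ℓ) := Algebra.IsAlgebraic.tower_top (K := ℚ_[ℓ]) F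
    have : IsAlgClosure F (PadicAlgCl ℓ) := ⟨inferInstance, inferInstance⟩
    exact ⟨θ, hθ, (fr F hF).isReductive hs, (fr F hF).exists_componentGroup hs θ hθ⟩
  · obtain ⟨F', h, hfin, hmem⟩ := (fr F hF).exists_finite_extension
    obtain ⟨ρ₀, hρ₀⟩ := exists_map_eq_of_forall_mem (algebraMap F' (PadicAlgCl ℓ)) ρ hmem
    have hF' : HasCharpolyOver (algebraMap F' (PadicAlgCl ℓ)) ρ := hF.of_le h
    obtain ⟨i, hi, hval⟩ := (fr F' hF').exists_embedding_of_map_eq hs ρ₀ hρ₀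
    refine ⟨F', h, hF', hfin, i, hi.isClosedImmersion, 1, fun g => ?_⟩
    rw [one_mul, inv_one, mul_one, ← hρ₀]
    exact congrArg _ (hval g)
  · let _ : Algebra F F' := (IntermediateField.inclusion h).toRingHom.toAlgebra
    have : IsScalarTower F F' (PadicAlgCl ℓ) := IsScalarTower.of_algebraMap_eq fun _ => rfl
    obtain ⟨ι, hι⟩ := (fr F hF).exists_iso_baseChange hs (fr F' hF')
    exact ⟨ι, hι, (fr F hF).embedding_eq_comp hs (fr F' hF') _
      (algebraMap_eq_comp_inclusion h) hι, fun ι' hι' =>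
      (fr F hF).iso_baseChange_unique hs (fr F' hF') _ hι hι'⟩
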